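/- Let $\mathbb K$ be $\mathbb R$ or $\mathbb C$ and let $D\subseteq\mathbb K^2$ be an open coordinate domain with metric $ds^2=\lambda(x_1,x_2)(dx_1^2+dx_2^2)$, $\lambda$ analytic and nowhere zero on $D$. Use the Poisson bracket $\{R,S\}=\sum_j(\partial_{p_j}R\,\partial_{x_j}S-\partial_{x_j}R\,\partial_{p_j}S)$. A second-order superintegrable system on $D$ consists of $\mathcal H=\mathcal H_0+V$ with $\mathcal H_0=\frac1\lambda(p_1^2+p_2^2)$, and of $\mathcal L_k=\mathcal L_k^0+W_k$ with $\mathcal L^0_k=\sum_{i,j}a^{ij}_{(k)}p_ip_j$, $a_{(k)}^{ij}=a_{(k)}^{ji}$ $(k=1,2)$, all coefficients being analytic on $D$, such that $\{\mathcal L_k,\mathcal H\}=0$ and $\mathcal H,\mathcal L_1,\mathcal L_2$ are functionally independent (their differentials are linearly independent on a dense subset of the phase space over $D$). It is nondegenerate if (a) at every point of $D$ the quadratic forms $\mathcal H_0,\mathcal L_1^0,\mathcal L_2^0$ in $p$ are linearly independent, and (b) for every $x_0\in D$ the values at $x_0$ of $V',\partial_1V',\partial_2V',\partial_1^2V'$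 can be prescribed arbitrarily, and there is exactly one germ at $x_0$ of an analytic potential $V'$ with these values that is admissible, i.e. for which there are analytic $W_1',W_2'$ near $x_0$ with $\{\mathcal L^0_k+W'_k,\mathcal H_0+V'\}=0$, $k=1,2$. Theorem. For every nondegenerate second-order superintegrable system on $D$ and every $x_0\in D$ there are an open neighbourhood $N\subseteq D$ of $x_0$ and analytic functions $U,w_1,w_2$ on $N$, with $U$ vanishing identically on no nonempty open subset of $N$ and with $\{\mathcal L^0_k+w_k,\mathcal H_0+U\}=0$ for $k=1,2$, such that on $M=\{x\in N: U(x)\neq0\}$ the Stäckel transform $$\tilde\lambda=\lambda U,\qquad \tilde V=V/U,\qquad \tilde{\mathcal H}=\tfrac{1}{\tilde\lambda}(p_1^2+p_2^2)+\tilde V,\qquad \tilde{\mathcal L}_k=\mathcal L_k-\frac{w_k}{U}\mathcal H$$ is again a nondegenerate second-order superintegrable system, and its metric $\tilde\lambda(dx_1^2+dx_2^2)$ has constant Gaussian curvature on $M$. That is, every nondegenerate superintegrable 2D system is (locally, away from the zeros of the multiplier) Stäckel equivalent to a superintegrable system on a space of constant curvature. -/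

import Mathlib

open Filter Topology

noncomputable section

/-- Points of a coordinate chart `(x, y) = (x₁, x₂)` with values in `𝕜` (`ℝ` or `ℂ`); the same type
is used for the momenta `(p₁, p₂)`. -/
abbrev Coord (𝕜 : Type*) : Type _ := Fin 2 → 𝕜

/-- The phase space over a chart: pairs `(q, p)`. -/
abbrev PhaseSpace (𝕜 : Type*) : Type _ := (Fin 2 → 𝕜) × (Fin 2 → 𝕜)

/-- The partial derivative `∂f/∂x_i`. -/
def partialDeriv {𝕜 : Type*} [RCLike 𝕜] (i : Fin 2) (f : Coord 𝕜 → 𝕜) (x : Coord 𝕜) : 𝕜 :=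
  fderiv 𝕜 f x (Pi.single i 1)

/-- The Poisson bracket `{R, S} = ∑ⱼ (∂R/∂pⱼ ∂S/∂qⱼ - ∂R/∂qⱼ ∂S/∂pⱼ)`. -/
def poissonBracket {𝕜 : Type*} [RCLike 𝕜] (R S : PhaseSpace 𝕜 → 𝕜) (z : PhaseSpace 𝕜) : 𝕜 :=
  ∑ j : Fin 2,
    (fderiv 𝕜 R z (0, Pi.single j 1) * fderiv 𝕜 S z (Pi.single j 1, 0)
      - fderiv 𝕜 R z (Pi.single j 1, 0) * fderiv 𝕜 S z (0, Pi.single j 1))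

/-- The natural Hamiltonian `(p₁² + p₂²) / lam + V` of the metric `lam (dx² + dy²)`. -/
def hamiltonian {𝕜 : Type*} [RCLike 𝕜] (lam V : Coord 𝕜 → 𝕜) (z : PhaseSpace 𝕜) : 𝕜 :=
  (z.2 0 ^ 2 + z.2 1 ^ 2) / lam z.1 + V z.1

/-- The second-order phase space function `∑ᵢⱼ a^{ij}(x) pᵢ pⱼ + W(x)`. -/
def quadraticIntegral {𝕜 : Type*} [RCLike 𝕜] (a : Coord 𝕜 → Matrix (Fin 2) (Fin 2) 𝕜)
    (W : Coord 𝕜 → 𝕜) (z : PhaseSpace 𝕜) : 𝕜 :=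
  (∑ i : Fin 2, ∑ j : Fin 2, a z.1 i j * z.2 i * z.2 j) + W z.1

/-- The data of a second-order system with three generators in conformal coordinates: the
conformal factor of the metric, the potential, and the coefficients of two further phase space
functions `L₁, L₂` that are quadratic in the momenta. -/
structure SecondOrderSystem (𝕜 : Type*) [RCLike 𝕜] where
  /-- the conformal factor `λ` of the metric `λ (dx² + dy²)` -/
  metric : Coord 𝕜 → 𝕜
  /-- the potential `V` -/
  potential : Coord 𝕜 → 𝕜
  /-- the coefficients `a_{(k)}^{ij}` of the quadratic part of `L_k` -/
  quad : Fin 2 → Coord 𝕜 → Matrix (Fin 2) (Fin 2) 𝕜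
  /-- the scalar part `W_{(k)}` of `L_k` -/
  scalar : Fin 2 → Coord 𝕜 → 𝕜

namespace SecondOrderSystem

/-- The Hamiltonian `H` of a system. -/
def ham {𝕜 : Type*} [RCLike 𝕜] (S : SecondOrderSystem 𝕜) : PhaseSpace 𝕜 → 𝕜 :=
  hamiltonian S.metric S.potential

/-- The functions `L₁, L₂` of a system (indexed by `0, 1`). -/
def integral {𝕜 : Type*} [RCLike 𝕜] (S : SecondOrderSystem 𝕜) (k : Fin 2) : PhaseSpace 𝕜 → 𝕜 :=
  quadraticIntegral (S.quad k) (S.scalar k)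

/-- Second-order (maximal) superintegrability in two dimensions over the coordinate domain `D`:
all data are analytic on `D`, the metric is nonsingular, `L₁, L₂` are constants of the motion, and
`H, L₁, L₂` are functionally independent, i.e. their differentials are linearly independent on a
dense subset of the phase space over `D`. -/
structure IsSuperintegrableOn {𝕜 : Type*} [RCLike 𝕜] (S : SecondOrderSystem 𝕜)
    (D : Set (Coord 𝕜)) : Prop where
  isOpen : IsOpen D
  analytic_metric : AnalyticOnNhd 𝕜 S.metric D
  metric_ne_zero : ∀ x ∈ D, S.metric x ≠ 0
  analytic_potential : AnalyticOnNhd 𝕜 S.potential D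
  analytic_quad : ∀ k i j, AnalyticOnNhd 𝕜 (fun x => S.quad k x i j) D
  quad_symm : ∀ k, ∀ x ∈ D, (S.quad k x).IsSymm
  analytic_scalar : ∀ k, AnalyticOnNhd 𝕜 (S.scalar k) D
  constant_of_motion : ∀ k, ∀ x ∈ D, ∀ p : Coord 𝕜,
    poissonBracket (S.integral k) S.ham (x, p) = 0
  functionally_independent :
    D ×ˢ (Set.univ : Set (Coord 𝕜)) ⊆
      closure {z | z.1 ∈ D ∧ LinearIndependent 𝕜
        ![fderiv 𝕜 S.ham z, fderiv 𝕜 (S.integral 0) z, fderiv 𝕜 (S.integral 1) z]}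

/-- Functional linear independence of the quadratic parts of `H, L₁, L₂` over `D`: a relation
`c₀(x) H₀ + c₁(x) L₁⁰ + c₂(x) L₂⁰ = 0` between the quadratic forms forces `c₀ = c₁ = c₂ = 0`. -/
def IsFunctionallyLinearlyIndependentOn {𝕜 : Type*} [RCLike 𝕜] (S : SecondOrderSystem 𝕜)
    (D : Set (Coord 𝕜)) : Prop :=
  ∀ x ∈ D, ∀ c₀ c₁ c₂ : 𝕜,
    (∀ p : Coord 𝕜, c₀ * hamiltonian S.metric 0 (x, p)
      + c₁ * quadraticIntegral (S.quad 0) 0 (x, p)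
      + c₂ * quadraticIntegral (S.quad 1) 0 (x, p) = 0) →
    c₀ = 0 ∧ c₁ = 0 ∧ c₂ = 0

/-- `V` is, near the point `x`, an admissible potential for the metric and the quadratic parts of
`L₁, L₂` of the system: with suitable scalar parts `W₁, W₂` the functions `L₁⁰ + W₁`, `L₂⁰ + W₂`
are constants of the motion for `H₀ + V`. -/
def IsAdmissiblePotentialAt {𝕜 : Type*} [RCLike 𝕜] (S : SecondOrderSystem 𝕜)
    (V : Coord 𝕜 → 𝕜) (x : Coord 𝕜) : Prop :=
  AnalyticAt 𝕜 V x ∧ ∃ W : Fin 2 → Coord 𝕜 → 𝕜, ∀ k, AnalyticAt 𝕜 (W k) x ∧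
    ∀ᶠ y in 𝓝 x, ∀ p : Coord 𝕜,
      poissonBracket (quadraticIntegral (S.quad k) (W k)) (hamiltonian S.metric V) (y, p) = 0

/-- The values of `V, V₁, V₂, V₁₁` at `x` are the entries of `c`. -/
def HasPotentialData {𝕜 : Type*} [RCLike 𝕜] (V : Coord 𝕜 → 𝕜) (x : Coord 𝕜)
    (c : Fin 4 → 𝕜) : Prop :=
  V x = c 0 ∧ partialDeriv 0 V x = c 1 ∧ partialDeriv 1 V x = c 2 ∧
    partialDeriv 0 (partialDeriv 0 V) x = c 3

/-- Nondegeneracy over the domain `D` of regular points: the quadratic parts of `H, L₁, L₂` are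
functionally linearly independent (so that the two Bertrand-Darboux equations can be solved for
`V₂₂ - V₁₁` and `V₁₂`), and at every point of `D` the values of `V, V₁, V₂, V₁₁` can be prescribed
arbitrarily and determine a unique germ of an admissible potential. -/
def IsNondegenerateOn {𝕜 : Type*} [RCLike 𝕜] (S : SecondOrderSystem 𝕜)
    (D : Set (Coord 𝕜)) : Prop :=
  S.IsFunctionallyLinearlyIndependentOn D ∧
  ∀ x ∈ D, ∀ c : Fin 4 → 𝕜, ∃ V : Coord 𝕜 → 𝕜,
    S.IsAdmissiblePotentialAt V x ∧ HasPotentialData V x c ∧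
    ∀ V' : Coord 𝕜 → 𝕜, S.IsAdmissiblePotentialAt V' x → HasPotentialData V' x c → V' =ᶠ[𝓝 x] V

/-- `U`, with scalar parts `w₁, w₂`, is a Stäckel multiplier over `N`: `L_k⁰ + w_k` are constants
of the motion for `H₀ + U`, and `U` vanishes identically on no nonempty open part of `N`. -/
structure IsStackelMultiplierOn {𝕜 : Type*} [RCLike 𝕜] (S : SecondOrderSystem 𝕜)
    (N : Set (Coord 𝕜)) (U : Coord 𝕜 → 𝕜) (w : Fin 2 → Coord 𝕜 → 𝕜) : Prop where
  analytic_multiplier : AnalyticOnNhd 𝕜 U N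
  analytic_scalar : ∀ k, AnalyticOnNhd 𝕜 (w k) N
  constant_of_motion : ∀ k, ∀ x ∈ N, ∀ p : Coord 𝕜,
    poissonBracket (quadraticIntegral (S.quad k) (w k)) (hamiltonian S.metric U) (x, p) = 0
  dense_ne_zero : N ⊆ closure {x | x ∈ N ∧ U x ≠ 0}

/-- The Stäckel transform by `U, w`: the metric becomes `λ U`, the potential `V / U`, and `L_k`
becomes `L_k - (w_k / U) H`. It lives where `U ≠ 0`. -/
def stackelTransform {𝕜 : Type*} [RCLike 𝕜] (S : SecondOrderSystem 𝕜)
    (U : Coord 𝕜 → 𝕜) (w : Fin 2 → Coord 𝕜 → 𝕜) : SecondOrderSystem 𝕜 where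
  metric := fun x => S.metric x * U x
  potential := fun x => S.potential x / U x
  quad := fun k x => S.quad k x - (w k x / (U x * S.metric x)) • (1 : Matrix (Fin 2) (Fin 2) 𝕜)
  scalar := fun k x => S.scalar k x - w k x / U x * S.potential x

end SecondOrderSystem

/-- The Gaussian curvature `-(1 / (2 lam)) Δ (log lam)` of the metric `lam (dx² + dy²)`, written
without the logarithm. -/
def gaussianCurvature {𝕜 : Type*} [RCLike 𝕜] (lam : Coord 𝕜 → 𝕜) (x : Coord 𝕜) : 𝕜 :=
  -(∑ i : Fin 2, (partialDeriv i (partialDeriv i lam) x / lam x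
      - (partialDeriv i lam x / lam x) ^ 2)) / (2 * lam x)

/-- The metric `lam (dx² + dy²)` has constant curvature over `M`. -/
def HasConstantCurvatureOn {𝕜 : Type*} [RCLike 𝕜] (lam : Coord 𝕜 → 𝕜) (M : Set (Coord 𝕜)) :
    Prop :=
  ∃ κ : 𝕜, ∀ x ∈ M, gaussianCurvature lam x = κ

end

/-! Write `Q = a¹¹ - a²²` and `P = 2a¹²` for the traceless part of a Killing tensor. Subtracting
Killing equations removes `λ` and leaves the Cauchy-Riemann equations for `f = Q + iP`. So all that
matters is a pair `f₀, f₁`, its discriminant `δ = P₀Q₁ - P₁Q₀ = Im(f₀ f̄₁)` and its Wronskian `X +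
iY = f₀'f₁ - f₀f₁'`. Nondegeneracy gives `δ ≠ 0`, and `δ² Δ log δ = -(X² + Y²)`.

For an admissible potential `V`, the two Bertrand-Darboux equations for `μ = λV` involve only `P_k,
Q_k`. Solved for `μ₁₁ - μ₂₂` and `μ₁₂`, they form a linear system with coefficients in `δ, X, Y`.
Since `μ, μ₁, μ₂, μ₁₁` can be prescribed at every point, the integrability conditions of that system
hold: two equations on the jets of `δ, X, Y`. A Stäckel transform with multiplier `U` replaces the
metric by `λU`, so the task is to find a solution `μ` of constant curvature.

If `X² + Y² ≢ 0`, take `μ = (X² + Y²)/δ²`. The identity for `Δ log δ` is Liouville's equation for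
`μ`, of curvature `-1`; over `ℝ` this `μ` is the Poincaré metric pulled back by `f₀/f₁`. The
integrability conditions say exactly what is needed for it to solve the canonical system
(`canonical_system_of_jets`). By uniqueness it is `λU` for an admissible `U`.

If `X = Y = 0`, the quantity `G = μΔμ - |∇μ|²` obeys `2δ ∇G = -3G ∇δ` for every solution
(`flatness_of_jets`), so initial data with `G = 0` give a flat metric.

If `X² + Y² = 0` but the Wronskian is not zero, then `X + iY = 0` for a root `i` of `-1`. With `D =
∂₁ - i∂₂` and `E = ∂₁ + i∂₂`, the function `F = 2δ Eμ + Eδ μ` satisfies `EF = 0` and a linear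
equation for `D²F` in `F, DF` (`null_system_of_jets`). Data with `F = DF = 0` force `F = 0`, hence
`E log μ = -½ E log δ`. As `DE log δ = 0` here, the metric is flat.

Nondegeneracy passes through the transform because multiplication by `U` matches the admissible
potentials. Functional independence needs a separate argument: a Jacobian minor, polynomial in the
momenta, can vanish identically only if the Wronskian and `∂₁(λU tr ã_k)` vanish, where `ã_k` is the
transformed tensor. -/

noncomputable section

/-! ### The differential ring of analytic germs -/

section AnalyticGerm

variable {𝕜 : Type*} [RCLike 𝕜]

theorem AnalyticAt.partialDeriv {f : Coord 𝕜 → 𝕜} {x : Coord 𝕜} (hf : AnalyticAt 𝕜 f x)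
    (i : Fin 2) : AnalyticAt 𝕜 (partialDeriv i f) x :=
  ((ContinuousLinearMap.apply 𝕜 𝕜 (Pi.single i (1 : 𝕜) : Coord 𝕜)).analyticAt _).comp hf.fderiv

theorem Filter.EventuallyEq.partialDeriv {f g : Coord 𝕜 → 𝕜} {x : Coord 𝕜} (h : f =ᶠ[𝓝 x] g)
    (i : Fin 2) : partialDeriv i f =ᶠ[𝓝 x] partialDeriv i g := by
  filter_upwards [h.fderiv (𝕜 := 𝕜)] with y hy
  simp only [_root_.partialDeriv, hy]

/-- The ring of germs at `x` of analytic functions. -/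
def analyticGermSubring (x : Coord 𝕜) : Subring (Germ (𝓝 x) 𝕜) where
  carrier := {g | ∃ f : Coord 𝕜 → 𝕜, AnalyticAt 𝕜 f x ∧ (f : Germ (𝓝 x) 𝕜) = g}
  mul_mem' := by
    rintro _ _ ⟨f, hf, rfl⟩ ⟨g, hg, rfl⟩
    exact ⟨f * g, hf.mul hg, rfl⟩
  one_mem' := ⟨1, analyticAt_const, rfl⟩
  add_mem' := by
    rintro _ _ ⟨f, hf, rfl⟩ ⟨g, hg, rfl⟩
    exact ⟨f + g, hf.add hg, rfl⟩
  zero_mem' := ⟨0, analyticAt_const, rfl⟩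
  neg_mem' := by
    rintro _ ⟨f, hf, rfl⟩
    exact ⟨-f, hf.neg, rfl⟩

/-- Germs at `x` of analytic functions. -/
abbrev AnalyticGerm (x : Coord 𝕜) : Type _ := ↥(analyticGermSubring x)

/-- The germ of a function that is analytic at `x`. -/
def germAt {x : Coord 𝕜} (f : Coord 𝕜 → 𝕜) (hf : AnalyticAt 𝕜 f x) : AnalyticGerm x :=
  ⟨(f : Germ (𝓝 x) 𝕜), f, hf, rfl⟩

theorem germAt_surj {x : Coord 𝕜} (a : AnalyticGerm x) :
    ∃ (f : Coord 𝕜 → 𝕜) (hf : AnalyticAt 𝕜 f x), germAt f hf = a := by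
  obtain ⟨_, f, hf, rfl⟩ := a
  exact ⟨f, hf, rfl⟩

theorem germAt_eq_iff {x : Coord 𝕜} {f g : Coord 𝕜 → 𝕜} (hf : AnalyticAt 𝕜 f x)
    (hg : AnalyticAt 𝕜 g x) : germAt f hf = germAt g hg ↔ f =ᶠ[𝓝 x] g := by
  exact Subtype.ext_iff.trans Germ.coe_eq

theorem germAt_add {x : Coord 𝕜} {f g : Coord 𝕜 → 𝕜} (hf : AnalyticAt 𝕜 f x)
    (hg : AnalyticAt 𝕜 g x) : germAt (fun y => f y + g y) (hf.add hg) = germAt f hf + germAt g hg :=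
  rfl

theorem germAt_mul {x : Coord 𝕜} {f g : Coord 𝕜 → 𝕜} (hf : AnalyticAt 𝕜 f x)
    (hg : AnalyticAt 𝕜 g x) : germAt (fun y => f y * g y) (hf.mul hg) = germAt f hf * germAt g hg :=
  rfl

/-- The partial derivative of a germ, as a germ. -/
def germPartial {x : Coord 𝕜} (i : Fin 2) (a : AnalyticGerm x) : AnalyticGerm x :=
  ⟨Quotient.map' (partialDeriv i) (fun _ _ h => Filter.EventuallyEq.partialDeriv h i) a.1, by
    obtain ⟨_, f, hf, rfl⟩ := a
    exact ⟨_, hf.partialDeriv i, rfl⟩⟩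

theorem germPartial_germAt {x : Coord 𝕜} (i : Fin 2) {f : Coord 𝕜 → 𝕜} (hf : AnalyticAt 𝕜 f x) :
    germPartial i (germAt f hf) = germAt (partialDeriv i f) (hf.partialDeriv i) :=
  rfl

/-- The partial derivative as a derivation of the ring of analytic germs. -/
def germDeriv (x : Coord 𝕜) (i : Fin 2) : Derivation ℤ (AnalyticGerm x) (AnalyticGerm x) :=
  Derivation.mk' (AddMonoidHom.toIntLinearMap
    { toFun := germPartial i
      map_zero' := by
        change germPartial i (germAt (fun _ => 0) analyticAt_const) =
          germAt (fun _ => 0) analyticAt_const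
        rw [germPartial_germAt, germAt_eq_iff]
        filter_upwards with y
        simp [partialDeriv]
      map_add' := by
        intro a b
        obtain ⟨f, hf, rfl⟩ := germAt_surj a
        obtain ⟨g, hg, rfl⟩ := germAt_surj b
        rw [← germAt_add, germPartial_germAt, germPartial_germAt, germPartial_germAt, ← germAt_add,
          germAt_eq_iff]
        filter_upwards [hf.eventually_analyticAt, hg.eventually_analyticAt] with y hfy hgy
        simp only [partialDeriv]
        rw [fderiv_fun_add hfy.differentiableAt hgy.differentiableAt]
        rfl }) (by
    intro a b
    obtain ⟨f, hf, rfl⟩ := germAt_surj a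
    obtain ⟨g, hg, rfl⟩ := germAt_surj b
    change germPartial i _ = germAt f hf * germPartial i _ + germAt g hg * germPartial i _
    rw [← germAt_mul, germPartial_germAt, germPartial_germAt, germPartial_germAt, ← germAt_mul,
      ← germAt_mul, ← germAt_add, germAt_eq_iff]
    filter_upwards [hf.eventually_analyticAt, hg.eventually_analyticAt] with y hfy hgy
    simp only [partialDeriv]
    rw [fderiv_fun_mul hfy.differentiableAt hgy.differentiableAt]
    rfl)

theorem germDeriv_germAt {x : Coord 𝕜} (i : Fin 2) {f : Coord 𝕜 → 𝕜} (hf : AnalyticAt 𝕜 f x) :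
    germDeriv x i (germAt f hf) = germAt (partialDeriv i f) (hf.partialDeriv i) :=
  rfl

theorem partialDeriv_comm {x : Coord 𝕜} {f : Coord 𝕜 → 𝕜} (hf : AnalyticAt 𝕜 f x) (i j : Fin 2) :
    partialDeriv i (partialDeriv j f) x = partialDeriv j (partialDeriv i f) x := by
  have h (k l : Fin 2) : partialDeriv k (partialDeriv l f) x =
      fderiv 𝕜 (fderiv 𝕜 f) x (Pi.single k 1) (Pi.single l 1) := by
    change fderiv 𝕜 (fun y => fderiv 𝕜 f y (Pi.single l 1)) x (Pi.single k 1) = _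
    rw [fderiv_clm_apply hf.fderiv.differentiableAt (differentiableAt_const _)]
    simp
  rw [h, h]
  exact (hf.contDiffAt (n := ⊤)).isSymmSndFDerivAt_of_omega.eq _ _

theorem germDeriv_comm {x : Coord 𝕜} (i j : Fin 2) (a : AnalyticGerm x) :
    germDeriv x i (germDeriv x j a) = germDeriv x j (germDeriv x i a) := by
  obtain ⟨f, hf, rfl⟩ := germAt_surj a
  simp only [germDeriv_germAt, germAt_eq_iff]
  filter_upwards [hf.eventually_analyticAt] with y hy using partialDeriv_comm hy i j

/-- Evaluation of germs at the base point. -/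
def germValue (x : Coord 𝕜) : AnalyticGerm x →+* 𝕜 :=
  (Germ.valueRingHom : Germ (𝓝 x) 𝕜 →+* 𝕜).comp (analyticGermSubring x).subtype

theorem germValue_germAt {x : Coord 𝕜} {f : Coord 𝕜 → 𝕜} (hf : AnalyticAt 𝕜 f x) :
    germValue x (germAt f hf) = f x :=
  rfl

end AnalyticGerm

/-! ### Uniqueness for total linear differential systems -/

section LinearSystem

variable {𝕜 : Type*} [RCLike 𝕜]

theorem fderiv_eq_sum_partialDeriv (f : Coord 𝕜 → 𝕜) (x v : Coord 𝕜) :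
    fderiv 𝕜 f x v = v 0 * partialDeriv 0 f x + v 1 * partialDeriv 1 f x := by
  have hv : v = v 0 • (Pi.single 0 1 : Coord 𝕜) + v 1 • (Pi.single 1 1 : Coord 𝕜) := by
    ext j; fin_cases j <;> simp
  conv_lhs => rw [hv]
  simp only [map_add, map_smul, smul_eq_mul, partialDeriv]

/-- A solution of a total linear differential system that vanishes at a point vanishes nearby. -/
theorem eventually_eq_zero_of_linear_system {n : ℕ} {x₀ : Coord 𝕜} (u : Fin n → Coord 𝕜 → 𝕜)
    (A : Fin 2 → Fin n → Fin n → Coord 𝕜 → 𝕜) (hA : ∀ i j k, ContinuousAt (A i j k) x₀)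
    (hu : ∀ᶠ y in 𝓝 x₀, ∀ j, DifferentiableAt 𝕜 (u j) y)
    (hsys : ∀ᶠ y in 𝓝 x₀, ∀ i j, partialDeriv i (u j) y = ∑ k, A i j k y * u k y)
    (h0 : ∀ j, u j x₀ = 0) : ∀ᶠ y in 𝓝 x₀, ∀ j, u j y = 0 := by
  have hbd : ∀ᶠ y in 𝓝 x₀, ∀ i j k, ‖A i j k y‖ < ‖A i j k x₀‖ + 1 := by
    simp only [eventually_all]
    intro i j k
    exact (hA i j k).norm.eventually (gt_mem_nhds (lt_add_one _))
  obtain ⟨r, hr, hball⟩ := Metric.eventually_nhds_iff_ball.1 (hu.and (hsys.and hbd))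
  set C : ℝ := ∑ i, ∑ j, ∑ k, (‖A i j k x₀‖ + 1) with hC
  have hCle : ∀ i j k, ‖A i j k x₀‖ + 1 ≤ C := by
    intro i j k
    calc ‖A i j k x₀‖ + 1 ≤ ∑ k, (‖A i j k x₀‖ + 1) :=
          Finset.single_le_sum (f := fun k => ‖A i j k x₀‖ + 1) (fun _ _ => by positivity)
            (Finset.mem_univ k)
      _ ≤ ∑ j, ∑ k, (‖A i j k x₀‖ + 1) :=
          Finset.single_le_sum (f := fun j => ∑ k, (‖A i j k x₀‖ + 1)) (fun _ _ => by positivity)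
            (Finset.mem_univ j)
      _ ≤ C := Finset.single_le_sum (f := fun i => ∑ j, ∑ k, (‖A i j k x₀‖ + 1))
            (fun _ _ => by positivity) (Finset.mem_univ i)
  have hC0 : 0 ≤ C := by positivity
  filter_upwards [Metric.ball_mem_nhds x₀ hr] with y hy
  set v := y - x₀ with hv
  -- Along the segment from `x₀` to `y` the system becomes a linear ODE in a real parameter, and
  -- Grönwall's inequality applies.
  let γ : ℝ → Coord 𝕜 := fun t => x₀ + t • v
  have hγmem : ∀ t ∈ Set.Icc (0 : ℝ) 1, γ t ∈ Metric.ball x₀ r := by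
    intro t ht
    have hy' : ‖v‖ < r := by simpa [dist_eq_norm] using hy
    simp only [γ, Metric.mem_ball, dist_eq_norm, add_sub_cancel_left, norm_smul, Real.norm_eq_abs,
      abs_of_nonneg ht.1]
    nlinarith [ht.2, norm_nonneg v]
  have hγ : ∀ t, HasDerivAt γ v t := by
    intro t
    have h := ((hasDerivAt_id t).smul_const v).const_add x₀
    rw [one_smul] at h
    exact h
  let f : ℝ → (Fin n → 𝕜) := fun t j => u j (γ t)
  let f' : ℝ → (Fin n → 𝕜) := fun t j => fderiv 𝕜 (u j) (γ t) v
  have hf : ∀ t ∈ Set.Icc (0 : ℝ) 1, HasDerivAt f (f' t) t := by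
    intro t ht
    rw [hasDerivAt_pi]
    intro j
    have h1 := (((hball _ (hγmem t ht)).1 j).hasFDerivAt.restrictScalars ℝ)
    exact h1.comp_hasDerivAt t (hγ t)
  have hzero := eq_zero_of_abs_deriv_le_mul_abs_self_of_eq_zero_right (f := f) (f' := f')
    -- Two partial derivatives, each at most `n * C * ‖f t‖`, are paired with coordinates of `v` at
    -- most `‖v‖`.
    (K := 2 * ‖v‖ * (n * C)) (a := 0) (b := 1)
    (fun t ht => (hf t ht).continuousAt.continuousWithinAt)
    (fun t ht => (hf t (Set.Ico_subset_Icc_self ht)).hasDerivWithinAt)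
    (by ext j; simpa [f, γ] using h0 j) (by
      intro t ht
      have hm := hγmem t (Set.Ico_subset_Icc_self ht)
      have hp : ∀ i j, ‖partialDeriv i (u j) (γ t)‖ ≤ n * C * ‖f t‖ := by
        intro i j
        rw [(hball _ hm).2.1 i j]
        calc ‖∑ k, A i j k (γ t) * u k (γ t)‖ ≤ ∑ k : Fin n, C * ‖f t‖ := by
              refine norm_sum_le_of_le _ fun k _ => ?_
              rw [norm_mul]
              exact mul_le_mul (((hball _ hm).2.2 i j k).le.trans (hCle i j k))
                (norm_le_pi_norm (f t) k) (norm_nonneg _) hC0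
          _ = n * C * ‖f t‖ := by simp [mul_assoc]
      have hv0 : ∀ i, ‖v i‖ ≤ ‖v‖ := norm_le_pi_norm v
      rw [pi_norm_le_iff_of_nonneg (by positivity)]
      intro j
      simp only [f', fderiv_eq_sum_partialDeriv]
      refine (norm_add_le _ _).trans ?_
      rw [norm_mul, norm_mul]
      have e0 := mul_le_mul (hv0 0) (hp 0 j) (norm_nonneg _) (norm_nonneg v)
      have e1 := mul_le_mul (hv0 1) (hp 1 j) (norm_nonneg _) (norm_nonneg v)
      linarith)
  intro j
  have := congrFun (hzero 1 (by simp)) j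
  simpa [f, γ, hv] using this

end LinearSystem

/-! ### The Poisson bracket as Killing and gradient equations -/

section Bracket

variable {𝕜 : Type*} [RCLike 𝕜]

theorem hasFDerivAt_momentum (z : PhaseSpace 𝕜) (i : Fin 2) :
    HasFDerivAt (fun z : PhaseSpace 𝕜 => z.2 i)
      ((ContinuousLinearMap.proj i : Coord 𝕜 →L[𝕜] 𝕜).comp
        (ContinuousLinearMap.snd 𝕜 (Coord 𝕜) (Coord 𝕜))) z :=
  ((ContinuousLinearMap.proj i : Coord 𝕜 →L[𝕜] 𝕜).comp
    (ContinuousLinearMap.snd 𝕜 (Coord 𝕜) (Coord 𝕜))).hasFDerivAt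

theorem hasFDerivAt_position {f : Coord 𝕜 → 𝕜} {z : PhaseSpace 𝕜}
    (hf : DifferentiableAt 𝕜 f z.1) :
    HasFDerivAt (fun z : PhaseSpace 𝕜 => f z.1)
      ((fderiv 𝕜 f z.1).comp (ContinuousLinearMap.fst 𝕜 (Coord 𝕜) (Coord 𝕜))) z :=
  hf.hasFDerivAt.comp z hasFDerivAt_fst

theorem fderiv_hamiltonian {lam V : Coord 𝕜 → 𝕜} {x : Coord 𝕜} (hlam : DifferentiableAt 𝕜 lam x)
    (hV : DifferentiableAt 𝕜 V x) (h0 : lam x ≠ 0) (p v w : Coord 𝕜) :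
    fderiv 𝕜 (hamiltonian lam V) (x, p) (v, w) =
      2 * (p 0 * w 0 + p 1 * w 1) / lam x
        - (p 0 ^ 2 + p 1 ^ 2) * fderiv 𝕜 lam x v / lam x ^ 2 + fderiv 𝕜 V x v := by
  have h := ((((hasFDerivAt_momentum (x, p) 0).pow 2).fun_add
    ((hasFDerivAt_momentum (x, p) 1).pow 2)).mul
      ((hasFDerivAt_inv h0).comp (x, p)
        (hasFDerivAt_position (f := lam) (z := (x, p)) hlam))).fun_add
    (hasFDerivAt_position (f := V) (z := (x, p)) hV)
  have e : hamiltonian lam V = fun z : PhaseSpace 𝕜 =>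
      (z.2 0 ^ 2 + z.2 1 ^ 2) * (lam z.1)⁻¹ + V z.1 := by
    funext z
    simp only [hamiltonian, div_eq_mul_inv]
  rw [e]
  erw [h.fderiv]
  simp
  field_simp
  ring

theorem fderiv_quadraticIntegral {a : Coord 𝕜 → Matrix (Fin 2) (Fin 2) 𝕜} {W : Coord 𝕜 → 𝕜}
    {x : Coord 𝕜} (ha : ∀ i j, DifferentiableAt 𝕜 (fun y => a y i j) x)
    (hW : DifferentiableAt 𝕜 W x) (p v w : Coord 𝕜) :
    fderiv 𝕜 (quadraticIntegral a W) (x, p) (v, w) =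
      ∑ i, ∑ j, (fderiv 𝕜 (fun y => a y i j) x v * p i * p j
        + a x i j * (w i * p j + p i * w j)) + fderiv 𝕜 W x v := by
  have h := (HasFDerivAt.fun_sum (u := Finset.univ) fun i _ =>
    HasFDerivAt.fun_sum (u := Finset.univ) fun j _ =>
      ((hasFDerivAt_position (f := fun y => a y i j) (z := (x, p)) (ha i j)).fun_mul
        (hasFDerivAt_momentum (x, p) i)).fun_mul (hasFDerivAt_momentum (x, p) j)).fun_add
    (hasFDerivAt_position (f := W) (z := (x, p)) hW)
  have e : quadraticIntegral a W = fun z : PhaseSpace 𝕜 =>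
      (∑ i : Fin 2, ∑ j : Fin 2, a z.1 i j * z.2 i * z.2 j) + W z.1 := rfl
  rw [e, h.fderiv]
  simp
  ring

/-- The Killing tensor equations at `x` for a symmetric tensor `a` and the metric
`lam (dx² + dy²)`. -/
structure IsKillingAt (lam : Coord 𝕜 → 𝕜) (a : Coord 𝕜 → Matrix (Fin 2) (Fin 2) 𝕜)
    (x : Coord 𝕜) : Prop where
  eq000 : lam x * partialDeriv 0 (fun y => a y 0 0) x
    + a x 0 0 * partialDeriv 0 lam x + a x 0 1 * partialDeriv 1 lam x = 0
  eq111 : lam x * partialDeriv 1 (fun y => a y 1 1) x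
    + a x 0 1 * partialDeriv 0 lam x + a x 1 1 * partialDeriv 1 lam x = 0
  eq001 : lam x * (2 * partialDeriv 0 (fun y => a y 0 1) x + partialDeriv 1 (fun y => a y 0 0) x)
    + a x 0 1 * partialDeriv 0 lam x + a x 1 1 * partialDeriv 1 lam x = 0
  eq011 : lam x * (2 * partialDeriv 1 (fun y => a y 0 1) x + partialDeriv 0 (fun y => a y 1 1) x)
    + a x 0 0 * partialDeriv 0 lam x + a x 0 1 * partialDeriv 1 lam x = 0

/-- The equations for the scalar part `W` of a constant of the motion with leading part `a`. -/
structure IsScalarPartAt (lam V : Coord 𝕜 → 𝕜) (a : Coord 𝕜 → Matrix (Fin 2) (Fin 2) 𝕜)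
    (W : Coord 𝕜 → 𝕜) (x : Coord 𝕜) : Prop where
  eq0 : partialDeriv 0 W x =
    lam x * (a x 0 0 * partialDeriv 0 V x + a x 0 1 * partialDeriv 1 V x)
  eq1 : partialDeriv 1 W x =
    lam x * (a x 0 1 * partialDeriv 0 V x + a x 1 1 * partialDeriv 1 V x)

/-- The bracket is odd in the momenta: the cubic part sees only `lam` and `a`, the linear part
compares `dW` with `lam a dV`. Symmetry is needed near `x`, not only at `x`, because the derivatives
of `a y 1 0` are replaced by those of `a y 0 1`. -/
theorem poissonBracket_eq {lam V : Coord 𝕜 → 𝕜} {a : Coord 𝕜 → Matrix (Fin 2) (Fin 2) 𝕜}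
    {W : Coord 𝕜 → 𝕜} {x : Coord 𝕜} (hlam : DifferentiableAt 𝕜 lam x)
    (hV : DifferentiableAt 𝕜 V x) (h0 : lam x ≠ 0)
    (ha : ∀ i j, DifferentiableAt 𝕜 (fun y => a y i j) x) (hW : DifferentiableAt 𝕜 W x)
    (hsymm : ∀ᶠ y in 𝓝 x, (a y).IsSymm) (p : Coord 𝕜) :
    poissonBracket (quadraticIntegral a W) (hamiltonian lam V) (x, p) =
      -(2 / lam x ^ 2) * ((lam x * partialDeriv 0 (fun y => a y 0 0) x
          + a x 0 0 * partialDeriv 0 lam x + a x 0 1 * partialDeriv 1 lam x) * p 0 ^ 3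
        + (lam x * (2 * partialDeriv 0 (fun y => a y 0 1) x + partialDeriv 1 (fun y => a y 0 0) x)
          + a x 0 1 * partialDeriv 0 lam x + a x 1 1 * partialDeriv 1 lam x) * (p 0 ^ 2 * p 1)
        + (lam x * (2 * partialDeriv 1 (fun y => a y 0 1) x + partialDeriv 0 (fun y => a y 1 1) x)
          + a x 0 0 * partialDeriv 0 lam x + a x 0 1 * partialDeriv 1 lam x) * (p 0 * p 1 ^ 2)
        + (lam x * partialDeriv 1 (fun y => a y 1 1) x
          + a x 0 1 * partialDeriv 0 lam x + a x 1 1 * partialDeriv 1 lam x) * p 1 ^ 3)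
      + (2 / lam x) * ((lam x * (a x 0 0 * partialDeriv 0 V x + a x 0 1 * partialDeriv 1 V x)
          - partialDeriv 0 W x) * p 0
        + (lam x * (a x 0 1 * partialDeriv 0 V x + a x 1 1 * partialDeriv 1 V x)
          - partialDeriv 1 W x) * p 1) := by
  have h10 : (fun y => a y 1 0) =ᶠ[𝓝 x] fun y => a y 0 1 := by
    filter_upwards [hsymm] with y hy using hy.apply 0 1
  simp only [poissonBracket, fderiv_hamiltonian hlam hV h0, fderiv_quadraticIntegral ha hW,
    Fin.sum_univ_two, h10.fderiv_eq, h10.eq_of_nhds, map_zero, partialDeriv]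
  simp
  field_simp
  ring

/-- On each axis the values at `1` and `2` separate `t³` from `t`; the two diagonals then give the
mixed cubic coefficients. -/
theorem coeff_eq_zero_of_cubic_add_linear {c d c₀ c₁ c₂ c₃ d₀ d₁ : 𝕜} (hc : c ≠ 0) (hd : d ≠ 0)
    (h : ∀ p : Coord 𝕜, c * (c₀ * p 0 ^ 3 + c₁ * (p 0 ^ 2 * p 1) + c₂ * (p 0 * p 1 ^ 2)
      + c₃ * p 1 ^ 3) + d * (d₀ * p 0 + d₁ * p 1) = 0) :
    c₀ = 0 ∧ c₁ = 0 ∧ c₂ = 0 ∧ c₃ = 0 ∧ d₀ = 0 ∧ d₁ = 0 := by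
  have e1 := h ![1, 0]
  have e2 := h ![2, 0]
  have e3 := h ![0, 1]
  have e4 := h ![0, 2]
  have e5 := h ![1, 1]
  have e6 := h ![1, -1]
  simp only [Matrix.cons_val_zero, Matrix.cons_val_one] at e1 e2 e3 e4 e5 e6
  refine ⟨mul_left_cancel₀ hc ?_, mul_left_cancel₀ hc ?_, mul_left_cancel₀ hc ?_,
    mul_left_cancel₀ hc ?_, mul_left_cancel₀ hd ?_, mul_left_cancel₀ hd ?_⟩
  · linear_combination (-1 / 3) * e1 + (1 / 6) * e2
  · linear_combination (1 / 2) * e5 - (1 / 2) * e6 - e3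
  · linear_combination (1 / 2) * e5 + (1 / 2) * e6 - e1
  · linear_combination (-1 / 3) * e3 + (1 / 6) * e4
  · linear_combination (4 / 3) * e1 - (1 / 6) * e2
  · linear_combination (4 / 3) * e3 - (1 / 6) * e4

theorem poissonBracket_eq_zero_iff {lam V : Coord 𝕜 → 𝕜} {a : Coord 𝕜 → Matrix (Fin 2) (Fin 2) 𝕜}
    {W : Coord 𝕜 → 𝕜} {x : Coord 𝕜} (hlam : DifferentiableAt 𝕜 lam x)
    (hV : DifferentiableAt 𝕜 V x) (h0 : lam x ≠ 0)
    (ha : ∀ i j, DifferentiableAt 𝕜 (fun y => a y i j) x) (hW : DifferentiableAt 𝕜 W x)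
    (hsymm : ∀ᶠ y in 𝓝 x, (a y).IsSymm) :
    (∀ p, poissonBracket (quadraticIntegral a W) (hamiltonian lam V) (x, p) = 0) ↔
      IsKillingAt lam a x ∧ IsScalarPartAt lam V a W x := by
  simp only [poissonBracket_eq hlam hV h0 ha hW hsymm]
  constructor
  · intro h
    obtain ⟨h1, h2, h3, h4, h5, h6⟩ := coeff_eq_zero_of_cubic_add_linear
      (neg_ne_zero.2 (div_ne_zero two_ne_zero (pow_ne_zero 2 h0))) (div_ne_zero two_ne_zero h0) h
    exact ⟨⟨h1, h4, h2, h3⟩, (sub_eq_zero.1 h5).symm, (sub_eq_zero.1 h6).symm⟩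
  · rintro ⟨⟨h1, h2, h3, h4⟩, h5, h6⟩ p
    rw [h1, h2, h3, h4, h5, h6]
    ring

end Bracket

/-! ### Pointwise identities between jets; suffixes on `d`, `m`, `X`, `Y` denote partial derivatives
-/

section JetAlgebra

variable {K : Type*} [Field K] [CharZero K]

/-- The compatibility condition of the canonical system, evaluated at a point where `μ = 0`. The
hypotheses are the two equations, the discriminant identity and their derivatives; second
derivatives in direction 2 of `X, Y` have been rewritten by Cauchy-Riemann. The free second
derivative `m11` and the third derivatives of `δ` cancel, leaving one linear relation between `m1`
and `m2`. -/
theorem integrability_of_jets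
    {d d1 d2 d11 d12 d22 d111 d112 d122 d222 X Y X1 Y1 X11 Y11 : K}
    {m1 m2 m11 m12 m22 m111 m112 m122 m222 m1112 m1222 : K} (hd : d ≠ 0)
    (hK : d * (d11 + d22) - (d1 ^ 2 + d2 ^ 2) = -(X ^ 2 + Y ^ 2))
    (hK1 : d1 * (d11 + d22) + d * (d111 + d122) - (2 * d1 * d11 + 2 * d2 * d12)
      = -(2 * X * X1 + 2 * Y * Y1))
    (hK2 : d2 * (d11 + d22) + d * (d112 + d222) - (2 * d1 * d12 + 2 * d2 * d22)
      = -(-2 * X * Y1 + 2 * Y * X1))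
    (hS : 2 * d * (m11 - m22) = -3 * (d1 + Y) * m1 + 3 * (d2 + X) * m2)
    (hR : 4 * d * m12 = -3 * (d2 - X) * m1 - 3 * (d1 - Y) * m2)
    (hS1 : 2 * d1 * (m11 - m22) + 2 * d * (m111 - m122) =
      -3 * (d11 + Y1) * m1 - 3 * (d1 + Y) * m11 + 3 * (d12 + X1) * m2 + 3 * (d2 + X) * m12
        + (-(d11 - d22) - 2 * Y1) * m1)
    (hS2 : 2 * d2 * (m11 - m22) + 2 * d * (m112 - m222) =
      -3 * (d12 + X1) * m1 - 3 * (d1 + Y) * m12 + 3 * (d22 - Y1) * m2 + 3 * (d2 + X) * m22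
        + (-(d11 - d22) - 2 * Y1) * m2)
    (hR1 : 4 * d1 * m12 + 4 * d * m112 = -3 * (d12 - X1) * m1 - 3 * (d2 - X) * m11
      - 3 * (d11 - Y1) * m2 - 3 * (d1 - Y) * m12 + (2 * X1 - 2 * d12) * m1)
    (hR2 : 4 * d2 * m12 + 4 * d * m122 = -3 * (d22 + Y1) * m1 - 3 * (d2 - X) * m12
      - 3 * (d12 - X1) * m2 - 3 * (d1 - Y) * m22 + (2 * X1 - 2 * d12) * m2)
    (hS12 : 2 * d12 * (m11 - m22) + 2 * d1 * (m112 - m222) + 2 * d2 * (m111 - m122)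
      + 2 * d * (m1112 - m1222) =
      -3 * (d112 + X11) * m1 - 3 * (d11 + Y1) * m12 - 3 * (d12 + X1) * m11 - 3 * (d1 + Y) * m112
        + 3 * (d122 - Y11) * m2 + 3 * (d12 + X1) * m22 + 3 * (d22 - Y1) * m12 + 3 * (d2 + X) * m122
        + (-(d112 - d222) - 2 * X11) * m1 + (-(d111 - d122) - 2 * Y11) * m2
        + (-(d11 - d22) - 2 * Y1) * m12)
    (hR11 : 4 * d11 * m12 + 8 * d1 * m112 + 4 * d * m1112 =
      -3 * (d112 - X11) * m1 - 6 * (d12 - X1) * m11 - 3 * (d2 - X) * m111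
        - 3 * (d111 - Y11) * m2 - 6 * (d11 - Y1) * m12 - 3 * (d1 - Y) * m112
        + (4 * X11 - 4 * d112) * m1 + (2 * X1 - 2 * d12) * m11)
    (hR22 : 4 * d22 * m12 + 8 * d2 * m122 + 4 * d * m1222 =
      -3 * (d222 + X11) * m1 - 6 * (d22 + Y1) * m12 - 3 * (d2 - X) * m122
        - 3 * (d122 + Y11) * m2 - 6 * (d12 - X1) * m22 - 3 * (d1 - Y) * m222
        + (-4 * Y11 - 4 * d122) * m2 + (2 * X1 - 2 * d12) * m22) :
    m1 * (8 * d ^ 2 * X11 - 10 * d * (X1 * d1 + Y1 * d2) - 3 * d * (X * (d11 - d22) + 2 * Y * d12)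
        + 6 * (X * (d1 ^ 2 - d2 ^ 2) + 2 * Y * d1 * d2) + 6 * (X ^ 2 + Y ^ 2) * d2
        + 8 * d * (X * Y1 - Y * X1))
      = m2 * (-8 * d ^ 2 * Y11 - 10 * d * (X1 * d2 - Y1 * d1)
        - 3 * d * (2 * X * d12 - Y * (d11 - d22)) + 6 * (2 * X * d1 * d2 - Y * (d1 ^ 2 - d2 ^ 2))
        + 6 * (X ^ 2 + Y ^ 2) * d1 - 8 * d * (X * X1 + Y * Y1)) := by
  have e22 : d22 = (d1 ^ 2 + d2 ^ 2 - (X ^ 2 + Y ^ 2)) / d - d11 := by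
    field_simp; linear_combination hK
  have e122 : d122 = (2 * d1 * d11 + 2 * d2 * d12 - (2 * X * X1 + 2 * Y * Y1)
      - d1 * (d11 + d22)) / d - d111 := by
    field_simp; linear_combination hK1
  have e222 : d222 = (2 * d1 * d12 + 2 * d2 * d22 - (-2 * X * Y1 + 2 * Y * X1)
      - d2 * (d11 + d22)) / d - d112 := by
    field_simp; linear_combination hK2
  have f22 : m22 = m11 - (-3 * (d1 + Y) * m1 + 3 * (d2 + X) * m2) / (2 * d) := by
    field_simp; linear_combination -hS
  have f12 : m12 = (-3 * (d2 - X) * m1 - 3 * (d1 - Y) * m2) / (4 * d) := by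
    field_simp; linear_combination hR
  have f112 : m112 = (-3 * (d12 - X1) * m1 - 3 * (d2 - X) * m11
      - 3 * (d11 - Y1) * m2 - 3 * (d1 - Y) * m12 + (2 * X1 - 2 * d12) * m1
      - 4 * d1 * m12) / (4 * d) := by
    field_simp; linear_combination hR1
  have f122 : m122 = (-3 * (d22 + Y1) * m1 - 3 * (d2 - X) * m12
      - 3 * (d12 - X1) * m2 - 3 * (d1 - Y) * m22 + (2 * X1 - 2 * d12) * m2
      - 4 * d2 * m12) / (4 * d) := by
    field_simp; linear_combination hR2
  have f111 : m111 = m122 + (-3 * (d11 + Y1) * m1 - 3 * (d1 + Y) * m11 + 3 * (d12 + X1) * m2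
      + 3 * (d2 + X) * m12 + (-(d11 - d22) - 2 * Y1) * m1 - 2 * d1 * (m11 - m22)) / (2 * d) := by
    field_simp; linear_combination hS1
  have f222 : m222 = m112 - (-3 * (d12 + X1) * m1 - 3 * (d1 + Y) * m12 + 3 * (d22 - Y1) * m2
      + 3 * (d2 + X) * m22 + (-(d11 - d22) - 2 * Y1) * m2 - 2 * d2 * (m11 - m22)) / (2 * d) := by
    field_simp; linear_combination -hS2
  -- The combination `2 ∂₁∂₂S - ∂₁²R + ∂₂²R` is the one in which the fourth derivatives of `μ`
  -- cancel.
  have key : 2 * (2 * d12 * (m11 - m22) + 2 * d1 * (m112 - m222) + 2 * d2 * (m111 - m122))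
      - (4 * d11 * m12 + 8 * d1 * m112) + (4 * d22 * m12 + 8 * d2 * m122) =
      2 * (-3 * (d112 + X11) * m1 - 3 * (d11 + Y1) * m12 - 3 * (d12 + X1) * m11
        - 3 * (d1 + Y) * m112
        + 3 * (d122 - Y11) * m2 + 3 * (d12 + X1) * m22 + 3 * (d22 - Y1) * m12 + 3 * (d2 + X) * m122
        + (-(d112 - d222) - 2 * X11) * m1 + (-(d111 - d122) - 2 * Y11) * m2
        + (-(d11 - d22) - 2 * Y1) * m12)
      - (-3 * (d112 - X11) * m1 - 6 * (d12 - X1) * m11 - 3 * (d2 - X) * m111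
        - 3 * (d111 - Y11) * m2 - 6 * (d11 - Y1) * m12 - 3 * (d1 - Y) * m112
        + (4 * X11 - 4 * d112) * m1 + (2 * X1 - 2 * d12) * m11)
      + (-3 * (d222 + X11) * m1 - 6 * (d22 + Y1) * m12 - 3 * (d2 - X) * m122
        - 3 * (d122 + Y11) * m2 - 6 * (d12 - X1) * m22 - 3 * (d1 - Y) * m222
        + (-4 * Y11 - 4 * d122) * m2 + (2 * X1 - 2 * d12) * m22) := by
    linear_combination 2 * hS12 - hR11 + hR22
  clear hS12 hR11 hR22 hS1 hS2 hR1 hR2 hS hR hK hK1 hK2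
  subst f111 f222 f112 f122 f22 f12 e222 e122 e22
  rw [← sub_eq_zero] at key ⊢
  -- After the elimination, the two sides of `key` differ by `5 / (2 d²)` times the difference of
  -- the two sides of the claim.
  have h5 : (-5 / (2 * d ^ 2) : K) ≠ 0 :=
    div_ne_zero (by norm_num) (mul_ne_zero two_ne_zero (pow_ne_zero 2 hd))
  refine mul_left_cancel₀ h5 ?_
  rw [mul_zero, ← neg_eq_zero, ← key]
  field_simp
  ring

/-- Here `m = (X² + Y²)/δ²`. Its defects in the two canonical equations are the real and imaginary
parts of `(X + iY)(R + iR')/δ³`, where `R, R'` are the two integrability expressions. The last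
equation is Liouville's and rests on the discriminant identity alone: the second derivatives of `X,
Y` cancel in `m11 + m22`. -/
theorem canonical_system_of_jets
    {d d1 d2 d11 d12 d22 X Y X1 Y1 X11 Y11 m m1 m2 m11 m12 m22 : K} (hd : d ≠ 0)
    (hK : d * (d11 + d22) - (d1 ^ 2 + d2 ^ 2) = -(X ^ 2 + Y ^ 2))
    (hm : m * d ^ 2 = X ^ 2 + Y ^ 2)
    (hm1 : m1 * d ^ 2 + 2 * m * d * d1 = 2 * X * X1 + 2 * Y * Y1)
    (hm2 : m2 * d ^ 2 + 2 * m * d * d2 = -2 * X * Y1 + 2 * Y * X1)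
    (hm11 : m11 * d ^ 2 + 4 * m1 * d * d1 + 2 * m * (d1 ^ 2 + d * d11) =
      2 * X1 ^ 2 + 2 * X * X11 + 2 * Y1 ^ 2 + 2 * Y * Y11)
    (hm12 : m12 * d ^ 2 + 2 * m1 * d * d2 + 2 * m2 * d * d1 + 2 * m * (d1 * d2 + d * d12) =
      -2 * X * Y11 + 2 * Y * X11)
    (hm22 : m22 * d ^ 2 + 4 * m2 * d * d2 + 2 * m * (d2 ^ 2 + d * d22) =
      2 * X1 ^ 2 - 2 * X * X11 + 2 * Y1 ^ 2 - 2 * Y * Y11)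
    (hJ : 8 * d ^ 2 * X11 - 10 * d * (X1 * d1 + Y1 * d2)
        - 3 * d * (X * (d11 - d22) + 2 * Y * d12)
        + 6 * (X * (d1 ^ 2 - d2 ^ 2) + 2 * Y * d1 * d2) + 6 * (X ^ 2 + Y ^ 2) * d2
        + 8 * d * (X * Y1 - Y * X1) = 0)
    (hJ' : -8 * d ^ 2 * Y11 - 10 * d * (X1 * d2 - Y1 * d1)
        - 3 * d * (2 * X * d12 - Y * (d11 - d22)) + 6 * (2 * X * d1 * d2 - Y * (d1 ^ 2 - d2 ^ 2))
        + 6 * (X ^ 2 + Y ^ 2) * d1 - 8 * d * (X * X1 + Y * Y1) = 0) :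
    2 * d * (m11 - m22) = -3 * (d1 + Y) * m1 + 3 * (d2 + X) * m2 + (-(d11 - d22) - 2 * Y1) * m ∧
      4 * d * m12 = -3 * (d2 - X) * m1 - 3 * (d1 - Y) * m2 + (2 * X1 - 2 * d12) * m ∧
      m * (m11 + m22) - (m1 ^ 2 + m2 ^ 2) = 2 * m ^ 3 := by
  obtain ⟨R, hR⟩ : ∃ R, R = 8 * d ^ 2 * X11 - 10 * d * (X1 * d1 + Y1 * d2)
        - 3 * d * (X * (d11 - d22) + 2 * Y * d12)
        + 6 * (X * (d1 ^ 2 - d2 ^ 2) + 2 * Y * d1 * d2) + 6 * (X ^ 2 + Y ^ 2) * d2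
        + 8 * d * (X * Y1 - Y * X1) := ⟨_, rfl⟩
  obtain ⟨R', hR'⟩ : ∃ R', R' = -8 * d ^ 2 * Y11 - 10 * d * (X1 * d2 - Y1 * d1)
        - 3 * d * (2 * X * d12 - Y * (d11 - d22)) + 6 * (2 * X * d1 * d2 - Y * (d1 ^ 2 - d2 ^ 2))
        + 6 * (X ^ 2 + Y ^ 2) * d1 - 8 * d * (X * X1 + Y * Y1) := ⟨_, rfl⟩
  rw [← hR] at hJ
  rw [← hR'] at hJ'
  have e22 : d22 = (d1 ^ 2 + d2 ^ 2 - (X ^ 2 + Y ^ 2)) / d - d11 := by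
    field_simp; linear_combination hK
  have f : m = (X ^ 2 + Y ^ 2) / d ^ 2 := by field_simp; linear_combination hm
  have f1 : m1 = (2 * X * X1 + 2 * Y * Y1 - 2 * m * d * d1) / d ^ 2 := by
    field_simp; linear_combination hm1
  have f2 : m2 = (-2 * X * Y1 + 2 * Y * X1 - 2 * m * d * d2) / d ^ 2 := by
    field_simp; linear_combination hm2
  have f11 : m11 = (2 * X1 ^ 2 + 2 * X * X11 + 2 * Y1 ^ 2 + 2 * Y * Y11 - 4 * m1 * d * d1
      - 2 * m * (d1 ^ 2 + d * d11)) / d ^ 2 := by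
    field_simp; linear_combination hm11
  have f12 : m12 = (-2 * X * Y11 + 2 * Y * X11 - 2 * m1 * d * d2 - 2 * m2 * d * d1
      - 2 * m * (d1 * d2 + d * d12)) / d ^ 2 := by
    field_simp; linear_combination hm12
  have f22 : m22 = (2 * X1 ^ 2 - 2 * X * X11 + 2 * Y1 ^ 2 - 2 * Y * Y11 - 4 * m2 * d * d2
      - 2 * m * (d2 ^ 2 + d * d22)) / d ^ 2 := by
    field_simp; linear_combination hm22
  clear hK hm hm1 hm2 hm11 hm12 hm22
  subst f11 f12 f22 f1 f2 f e22
  refine ⟨?_, ?_, ?_⟩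
  · rw [← sub_eq_zero]
    refine Eq.trans (b := (X * R - Y * R') / d ^ 3) ?_ (by rw [hJ, hJ']; simp)
    rw [hR, hR']
    field_simp
    ring
  · rw [← sub_eq_zero]
    refine Eq.trans (b := (X * R' + Y * R) / d ^ 3) ?_ (by rw [hJ, hJ']; simp)
    rw [hR, hR']
    field_simp
    ring
  · field_simp
    ring

/-- With zero Wronskian, `G = m (m11 + m22) - (m1² + m2²)` satisfies `∇G = -(3/2) G ∇ log δ`: the
vanishing of `G` propagates from one point. -/
theorem flatness_of_jets {d d1 d2 d11 d12 d22 d111 d112 d122 d222 : K}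
    {m m1 m2 m11 m12 m22 m111 m112 m122 m222 : K} (hd : d ≠ 0)
    (hK : d * (d11 + d22) - (d1 ^ 2 + d2 ^ 2) = 0)
    (hK1 : d1 * (d11 + d22) + d * (d111 + d122) - (2 * d1 * d11 + 2 * d2 * d12) = 0)
    (hK2 : d2 * (d11 + d22) + d * (d112 + d222) - (2 * d1 * d12 + 2 * d2 * d22) = 0)
    (hS : 2 * d * (m11 - m22) = -3 * d1 * m1 + 3 * d2 * m2 - (d11 - d22) * m)
    (hR : 4 * d * m12 = -3 * d2 * m1 - 3 * d1 * m2 - 2 * d12 * m)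
    (hS1 : 2 * d1 * (m11 - m22) + 2 * d * (m111 - m122) =
      -3 * d11 * m1 - 3 * d1 * m11 + 3 * d12 * m2 + 3 * d2 * m12
        - (d11 - d22) * m1 - (d111 - d122) * m)
    (hS2 : 2 * d2 * (m11 - m22) + 2 * d * (m112 - m222) =
      -3 * d12 * m1 - 3 * d1 * m12 + 3 * d22 * m2 + 3 * d2 * m22
        - (d11 - d22) * m2 - (d112 - d222) * m)
    (hR1 : 4 * d1 * m12 + 4 * d * m112 = -3 * d12 * m1 - 3 * d2 * m11
      - 3 * d11 * m2 - 3 * d1 * m12 - 2 * d12 * m1 - 2 * d112 * m)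
    (hR2 : 4 * d2 * m12 + 4 * d * m122 = -3 * d22 * m1 - 3 * d2 * m12
      - 3 * d12 * m2 - 3 * d1 * m22 - 2 * d12 * m2 - 2 * d122 * m) :
    2 * d * (m * (m111 + m122) + m1 * (m11 + m22) - (2 * m1 * m11 + 2 * m2 * m12)) =
      -3 * d1 * (m * (m11 + m22) - (m1 ^ 2 + m2 ^ 2)) ∧
    2 * d * (m * (m112 + m222) + m2 * (m11 + m22) - (2 * m1 * m12 + 2 * m2 * m22)) =
      -3 * d2 * (m * (m11 + m22) - (m1 ^ 2 + m2 ^ 2)) := by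
  have e22 : d22 = (d1 ^ 2 + d2 ^ 2) / d - d11 := by
    field_simp; linear_combination hK
  have e122 : d122 = (2 * d1 * d11 + 2 * d2 * d12 - d1 * (d11 + d22)) / d - d111 := by
    field_simp; linear_combination hK1
  have e222 : d222 = (2 * d1 * d12 + 2 * d2 * d22 - d2 * (d11 + d22)) / d - d112 := by
    field_simp; linear_combination hK2
  have f22 : m22 = m11 - (-3 * d1 * m1 + 3 * d2 * m2 - (d11 - d22) * m) / (2 * d) := by
    field_simp; linear_combination -hS
  have f12 : m12 = (-3 * d2 * m1 - 3 * d1 * m2 - 2 * d12 * m) / (4 * d) := by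
    field_simp; linear_combination hR
  have f112 : m112 = (-3 * d12 * m1 - 3 * d2 * m11
      - 3 * d11 * m2 - 3 * d1 * m12 - 2 * d12 * m1 - 2 * d112 * m - 4 * d1 * m12) / (4 * d) := by
    field_simp; linear_combination hR1
  have f122 : m122 = (-3 * d22 * m1 - 3 * d2 * m12
      - 3 * d12 * m2 - 3 * d1 * m22 - 2 * d12 * m2 - 2 * d122 * m - 4 * d2 * m12) / (4 * d) := by
    field_simp; linear_combination hR2
  have f111 : m111 = m122 + (-3 * d11 * m1 - 3 * d1 * m11 + 3 * d12 * m2 + 3 * d2 * m12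
        - (d11 - d22) * m1 - (d111 - d122) * m - 2 * d1 * (m11 - m22)) / (2 * d) := by
    field_simp; linear_combination hS1
  have f222 : m222 = m112 - (-3 * d12 * m1 - 3 * d1 * m12 + 3 * d22 * m2 + 3 * d2 * m22
        - (d11 - d22) * m2 - (d112 - d222) * m - 2 * d2 * (m11 - m22)) / (2 * d) := by
    field_simp; linear_combination -hS2
  clear hS1 hS2 hR1 hR2 hS hR hK hK1 hK2
  subst f111 f222 f112 f122 f22 f12 e222 e122 e22
  constructor
  · field_simp
    ring
  · field_simp
    ring

/-- Suffixes `z, w` stand for `D = ∂₁ - I∂₂` and `E = ∂₁ + I∂₂`, and `B` for the Wronskian factor `X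
- IY` that need not vanish. The left side is `2δ² D²F` for `F = 2δ Eμ + Eδ μ`. The integrability
condition `hJ` removes `Bww`, which is what makes the right side a combination of `F` and `DF`. -/
theorem null_system_of_jets {I d dz dw dzz dzw dww dzzw B Bw Bww : K}
    {m mz mw mzz mzw mww mzzw : K} (hd : d ≠ 0)
    (hK : d * dzw = dz * dw) (hKz : d * dzzw = dzz * dw)
    (hJ : 2 * d ^ 2 * Bww - 5 * d * dw * Bw - 3 * d * B * dww + 6 * B * dw ^ 2 = 0)
    (hZ : 2 * d * mzz + 3 * dz * mz + dzz * m = -I * (3 * B * mw + Bw * m))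
    (hW : 2 * d * mww + 3 * dw * mw + dww * m = 0)
    (hZw : 2 * dw * mzz + 2 * d * mzzw + 3 * dzw * mz + 3 * dz * mzw + dzzw * m + dzz * mw =
      -I * (4 * Bw * mw + 3 * B * mww + Bww * m)) :
    2 * d ^ 2 * (2 * d * mzzw + 4 * dz * mzw + 2 * dzz * mw + dzzw * m + 2 * dzw * mz + dw * mzz) =
      d * dz * (2 * d * mzw + 2 * dz * mw + dzw * m + dw * mz)
      + (-dz ^ 2 + d * dzz - I * (4 * d * Bw - 6 * B * dw)) * (2 * d * mw + dw * m) := by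
  have e1 : dzw = dz * dw / d := by field_simp; linear_combination hK
  have e2 : dzzw = dzz * dw / d := by field_simp; linear_combination hKz
  have e3 : Bww = (5 * d * dw * Bw + 3 * d * B * dww - 6 * B * dw ^ 2) / (2 * d ^ 2) := by
    field_simp; linear_combination hJ
  have e4 : mww = -(3 * dw * mw + dww * m) / (2 * d) := by field_simp; linear_combination hW
  have e5 : mzz = (-I * (3 * B * mw + Bw * m) - 3 * dz * mz - dzz * m) / (2 * d) := by
    field_simp; linear_combination hZ
  have e6 : mzzw = (-I * (4 * Bw * mw + 3 * B * mww + Bww * m)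
      - (2 * dw * mzz + 3 * dzw * mz + 3 * dz * mzw + dzzw * m + dzz * mw)) / (2 * d) := by
    field_simp; linear_combination hZw
  clear hK hKz hJ hZ hW hZw
  subst e6 e5 e4 e3 e2 e1
  field_simp
  ring

end JetAlgebra

/-! ### Conformal Killing pairs and their potentials in a differential ring -/

section DifferentialAlgebra

variable {A : Type*} [CommRing A] {d₁ d₂ : Derivation ℤ A A}

theorem Derivation.map_ofNat_eq_zero (d : Derivation ℤ A A) (n : ℕ) [n.AtLeastTwo] :
    d (ofNat(n) : A) = 0 :=
  d.map_natCast n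

/-- The differential relations between the discriminant `δ` of two conformal Killing tensors and
their Wronskian `X + iY`. -/
structure IsKillingFrame (d₁ d₂ : Derivation ℤ A A) (δ X Y : A) : Prop where
  cr₁ : d₂ Y = d₁ X
  cr₂ : d₂ X = -d₁ Y
  disc : δ * (d₁ (d₁ δ) + d₂ (d₂ δ)) - (d₁ δ * d₁ δ + d₂ δ * d₂ δ) = -(X * X + Y * Y)

/-- The canonical equations for the products of the admissible potentials with the metric. -/
structure IsConformalPotential (d₁ d₂ : Derivation ℤ A A) (δ X Y μ : A) : Prop where
  eqS : 2 * δ * (d₁ (d₁ μ) - d₂ (d₂ μ)) = -3 * (d₁ δ + Y) * d₁ μ + 3 * (d₂ δ + X) * d₂ μ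
    + (-(d₁ (d₁ δ) - d₂ (d₂ δ)) - 2 * d₁ Y) * μ
  eqR : 4 * δ * d₁ (d₂ μ) = -3 * (d₂ δ - X) * d₁ μ - 3 * (d₁ δ - Y) * d₂ μ
    + (2 * d₁ X - 2 * d₁ (d₂ δ)) * μ

/-- With `f_k = Q_k + iP_k` holomorphic, `X + iY = f₀'f₁ - f₀f₁'` is holomorphic too. The last
identity is `δ² Δ log δ = -|f₀'f₁ - f₀f₁'|²` for `δ = Im(f₀ f̄₁)`. -/
theorem isKillingFrame_of_pairs (hcomm : ∀ a, d₂ (d₁ a) = d₁ (d₂ a)) {P₀ Q₀ P₁ Q₁ : A}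
    (hP₀ : d₂ P₀ = d₁ Q₀) (hQ₀ : d₂ Q₀ = -d₁ P₀) (hP₁ : d₂ P₁ = d₁ Q₁) (hQ₁ : d₂ Q₁ = -d₁ P₁) :
    IsKillingFrame d₁ d₂ (P₀ * Q₁ - P₁ * Q₀)
      (d₁ Q₀ * Q₁ - d₁ P₀ * P₁ - Q₀ * d₁ Q₁ + P₀ * d₁ P₁)
      (d₁ Q₀ * P₁ + d₁ P₀ * Q₁ - Q₀ * d₁ P₁ - P₀ * d₁ Q₁) := by
  constructor <;>
  · simp only [map_add, map_sub, map_neg, Derivation.leibniz, smul_eq_mul, hcomm, hP₀, hQ₀, hP₁, hQ₁]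
    ring

/-- Cramer's rule, with determinant `δ` up to a factor: the `Q`-combination eliminates `μ₁₂`, the
`P`-combination eliminates `μ₁₁ - μ₂₂`. -/
theorem isConformalPotential_of_pairs (hcomm : ∀ a, d₂ (d₁ a) = d₁ (d₂ a)) {P₀ Q₀ P₁ Q₁ μ : A}
    (hP₀ : d₂ P₀ = d₁ Q₀) (hQ₀ : d₂ Q₀ = -d₁ P₀) (hP₁ : d₂ P₁ = d₁ Q₁) (hQ₁ : d₂ Q₁ = -d₁ P₁)
    (h₀ : 2 * Q₀ * d₁ (d₂ μ) - P₀ * (d₁ (d₁ μ) - d₂ (d₂ μ)) - 3 * d₁ P₀ * d₁ μ + 3 * d₁ Q₀ * d₂ μ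
      - 2 * d₁ (d₁ P₀) * μ = 0)
    (h₁ : 2 * Q₁ * d₁ (d₂ μ) - P₁ * (d₁ (d₁ μ) - d₂ (d₂ μ)) - 3 * d₁ P₁ * d₁ μ + 3 * d₁ Q₁ * d₂ μ
      - 2 * d₁ (d₁ P₁) * μ = 0) :
    IsConformalPotential d₁ d₂ (P₀ * Q₁ - P₁ * Q₀)
      (d₁ Q₀ * Q₁ - d₁ P₀ * P₁ - Q₀ * d₁ Q₁ + P₀ * d₁ P₁)
      (d₁ Q₀ * P₁ + d₁ P₀ * Q₁ - Q₀ * d₁ P₁ - P₀ * d₁ Q₁) μ := by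
  constructor
  · simp only [map_add, map_sub, map_neg, Derivation.leibniz, smul_eq_mul, hcomm, hP₀, hQ₀, hP₁, hQ₁]
    linear_combination 2 * Q₀ * h₁ - 2 * Q₁ * h₀
  · simp only [map_add, map_sub, map_neg, Derivation.leibniz, smul_eq_mul, hP₀, hQ₀, hP₁, hQ₁]
    linear_combination 2 * P₀ * h₁ - 2 * P₁ * h₀

/-- The Bertrand-Darboux equation is the closedness of `dW`. Subtracting `W` from half of `l (a + c)
V` absorbs the trace: by the Killing equations, the gradient of `l (a + c) V - 2 W` depends only on
`μ = l V` and the traceless part. Equality of its mixed derivatives is therefore an equation for `μ`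
without `l`. -/
theorem bertrand_darboux (hcomm : ∀ a, d₂ (d₁ a) = d₁ (d₂ a)) {l a b c V W q p : A}
    (k₀₀₀ : l * d₁ a + a * d₁ l + b * d₂ l = 0) (k₁₁₁ : l * d₂ c + b * d₁ l + c * d₂ l = 0)
    (hq : q = a - c) (hp : p = b + b) (hP : d₂ p = d₁ q) (hQ : d₂ q = -d₁ p)
    (hW₁ : d₁ W = l * (a * d₁ V + b * d₂ V)) (hW₂ : d₂ W = l * (b * d₁ V + c * d₂ V)) :
    2 * q * d₁ (d₂ (l * V)) - p * (d₁ (d₁ (l * V)) - d₂ (d₂ (l * V)))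
      - 3 * d₁ p * d₁ (l * V) + 3 * d₁ q * d₂ (l * V) - 2 * d₁ (d₁ p) * (l * V) = 0 := by
  obtain rfl : p = 2 * b := by rw [hp, two_mul]
  subst hq
  have h₁ : d₁ (l * (a + c) * V - 2 * W) =
      -((a - c) * d₁ (l * V) + 2 * b * d₂ (l * V) + d₁ (a - c) * (l * V)) := by
    simp only [map_add, map_sub, Derivation.leibniz, smul_eq_mul, Derivation.map_ofNat_eq_zero, hW₁]
    linear_combination 2 * V * k₀₀₀
  have h₂ : d₂ (l * (a + c) * V - 2 * W) =
      (a - c) * d₂ (l * V) - 2 * b * d₁ (l * V) + d₂ (a - c) * (l * V) := by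
    simp only [map_add, map_sub, Derivation.leibniz, smul_eq_mul, Derivation.map_ofNat_eq_zero, hW₂]
    linear_combination 2 * V * k₁₁₁
  have h := hcomm (l * (a + c) * V - 2 * W)
  rw [h₁, h₂, hQ] at h
  generalize l * V = m at h ⊢
  generalize a - c = q at h hP hQ ⊢
  generalize 2 * b = p at h hP hQ ⊢
  simp only [map_add, map_sub, map_neg, Derivation.leibniz, smul_eq_mul, hcomm, hP, hQ] at h
  linear_combination -h

variable {K : Type*} [Field K] [CharZero K] (v : A →+* K)

/-- The equations are identities in the ring, so they may be differentiated twice before `v` is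
applied; only the value `v μ` is assumed to vanish, not `μ`. -/
theorem IsConformalPotential.integrability (hcomm : ∀ a, d₂ (d₁ a) = d₁ (d₂ a)) {δ X Y μ : A}
    (hf : IsKillingFrame d₁ d₂ δ X Y) (hμ : IsConformalPotential d₁ d₂ δ X Y μ) (hδ : v δ ≠ 0)
    (h0 : v μ = 0) :
    v (d₁ μ) * (8 * v δ ^ 2 * v (d₁ (d₁ X)) - 10 * v δ * (v (d₁ X) * v (d₁ δ) + v (d₁ Y) * v (d₂ δ))
        - 3 * v δ * (v X * (v (d₁ (d₁ δ)) - v (d₂ (d₂ δ))) + 2 * v Y * v (d₁ (d₂ δ)))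
        + 6 * (v X * (v (d₁ δ) ^ 2 - v (d₂ δ) ^ 2) + 2 * v Y * v (d₁ δ) * v (d₂ δ))
        + 6 * (v X ^ 2 + v Y ^ 2) * v (d₂ δ)
        + 8 * v δ * (v X * v (d₁ Y) - v Y * v (d₁ X)))
      = v (d₂ μ) * (-8 * v δ ^ 2 * v (d₁ (d₁ Y))
        - 10 * v δ * (v (d₁ X) * v (d₂ δ) - v (d₁ Y) * v (d₁ δ))
        - 3 * v δ * (2 * v X * v (d₁ (d₂ δ)) - v Y * (v (d₁ (d₁ δ)) - v (d₂ (d₂ δ))))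
        + 6 * (2 * v X * v (d₁ δ) * v (d₂ δ) - v Y * (v (d₁ δ) ^ 2 - v (d₂ δ) ^ 2))
        + 6 * (v X ^ 2 + v Y ^ 2) * v (d₁ δ) - 8 * v δ * (v X * v (d₁ X) + v Y * v (d₁ Y))) := by
  have hK := congrArg v hf.disc
  have hK1 := congrArg (fun a => v (d₁ a)) hf.disc
  have hK2 := congrArg (fun a => v (d₂ a)) hf.disc
  have hS := congrArg v hμ.eqS
  have hS1 := congrArg (fun a => v (d₁ a)) hμ.eqS
  have hS2 := congrArg (fun a => v (d₂ a)) hμ.eqS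
  have hS12 := congrArg (fun a => v (d₁ (d₂ a))) hμ.eqS
  have hR := congrArg v hμ.eqR
  have hR1 := congrArg (fun a => v (d₁ a)) hμ.eqR
  have hR2 := congrArg (fun a => v (d₂ a)) hμ.eqR
  have hR11 := congrArg (fun a => v (d₁ (d₁ a))) hμ.eqR
  have hR22 := congrArg (fun a => v (d₂ (d₂ a))) hμ.eqR
  simp only [map_add, map_sub, map_neg, map_mul, map_ofNat, Derivation.leibniz, smul_eq_mul, hcomm,
    Derivation.map_ofNat_eq_zero, map_zero, hf.cr₁, hf.cr₂, h0]
    at hK hK1 hK2 hS hS1 hS2 hS12 hR hR1 hR2 hR11 hR22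
  refine integrability_of_jets hδ (d111 := v (d₁ (d₁ (d₁ δ)))) (d112 := v (d₁ (d₁ (d₂ δ))))
    (d122 := v (d₁ (d₂ (d₂ δ)))) (d222 := v (d₂ (d₂ (d₂ δ)))) (m11 := v (d₁ (d₁ μ)))
    (m12 := v (d₁ (d₂ μ))) (m22 := v (d₂ (d₂ μ))) (m111 := v (d₁ (d₁ (d₁ μ))))
    (m112 := v (d₁ (d₁ (d₂ μ)))) (m122 := v (d₁ (d₂ (d₂ μ)))) (m222 := v (d₂ (d₂ (d₂ μ))))
    (m1112 := v (d₁ (d₁ (d₁ (d₂ μ))))) (m1222 := v (d₁ (d₂ (d₂ (d₂ μ)))))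
    ?_ ?_ ?_ ?_ ?_ ?_ ?_ ?_ ?_ ?_ ?_ ?_
  · linear_combination hK
  · linear_combination hK1
  · linear_combination hK2
  · linear_combination hS
  · linear_combination hR
  · linear_combination hS1
  · linear_combination hS2
  · linear_combination hR1
  · linear_combination hR2
  · linear_combination hS12
  · linear_combination hR11
  · linear_combination hR22

end DifferentialAlgebra

/-! ### Canonical, flat and null solutions: from ring identities to values -/

section DifferentialAlgebraValues

variable {A : Type*} [CommRing A] {d₁ d₂ : Derivation ℤ A A}
variable {K : Type*} [Field K] [CharZero K] (v : A →+* K)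

theorem IsKillingFrame.canonical_values (hcomm : ∀ a, d₂ (d₁ a) = d₁ (d₂ a)) {δ X Y m : A}
    (hf : IsKillingFrame d₁ d₂ δ X Y) (hδ : v δ ≠ 0) (hm : m * (δ * δ) = X * X + Y * Y)
    (hJ : 8 * v δ ^ 2 * v (d₁ (d₁ X)) - 10 * v δ * (v (d₁ X) * v (d₁ δ) + v (d₁ Y) * v (d₂ δ))
        - 3 * v δ * (v X * (v (d₁ (d₁ δ)) - v (d₂ (d₂ δ))) + 2 * v Y * v (d₁ (d₂ δ)))
        + 6 * (v X * (v (d₁ δ) ^ 2 - v (d₂ δ) ^ 2) + 2 * v Y * v (d₁ δ) * v (d₂ δ))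
        + 6 * (v X ^ 2 + v Y ^ 2) * v (d₂ δ)
        + 8 * v δ * (v X * v (d₁ Y) - v Y * v (d₁ X)) = 0)
    (hJ' : -8 * v δ ^ 2 * v (d₁ (d₁ Y))
        - 10 * v δ * (v (d₁ X) * v (d₂ δ) - v (d₁ Y) * v (d₁ δ))
        - 3 * v δ * (2 * v X * v (d₁ (d₂ δ)) - v Y * (v (d₁ (d₁ δ)) - v (d₂ (d₂ δ))))
        + 6 * (2 * v X * v (d₁ δ) * v (d₂ δ) - v Y * (v (d₁ δ) ^ 2 - v (d₂ δ) ^ 2))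
        + 6 * (v X ^ 2 + v Y ^ 2) * v (d₁ δ) - 8 * v δ * (v X * v (d₁ X) + v Y * v (d₁ Y)) = 0) :
    2 * v δ * (v (d₁ (d₁ m)) - v (d₂ (d₂ m))) =
        -3 * (v (d₁ δ) + v Y) * v (d₁ m) + 3 * (v (d₂ δ) + v X) * v (d₂ m)
          + (-(v (d₁ (d₁ δ)) - v (d₂ (d₂ δ))) - 2 * v (d₁ Y)) * v m ∧
      4 * v δ * v (d₁ (d₂ m)) = -3 * (v (d₂ δ) - v X) * v (d₁ m) - 3 * (v (d₁ δ) - v Y) * v (d₂ m)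
        + (2 * v (d₁ X) - 2 * v (d₁ (d₂ δ))) * v m ∧
      v m * (v (d₁ (d₁ m)) + v (d₂ (d₂ m))) - (v (d₁ m) ^ 2 + v (d₂ m) ^ 2) = 2 * v m ^ 3 := by
  have hK := congrArg v hf.disc
  have h := congrArg v hm
  have h1 := congrArg (fun a => v (d₁ a)) hm
  have h2 := congrArg (fun a => v (d₂ a)) hm
  have h11 := congrArg (fun a => v (d₁ (d₁ a))) hm
  have h12 := congrArg (fun a => v (d₁ (d₂ a))) hm
  have h22 := congrArg (fun a => v (d₂ (d₂ a))) hm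
  simp only [map_add, map_sub, map_neg, map_mul, Derivation.leibniz, smul_eq_mul, hcomm,
    hf.cr₁, hf.cr₂] at hK h h1 h2 h11 h12 h22
  refine canonical_system_of_jets hδ ?_ ?_ ?_ ?_ ?_ ?_ ?_ hJ hJ'
  · linear_combination hK
  · linear_combination h
  · linear_combination h1
  · linear_combination h2
  · linear_combination h11
  · linear_combination h12
  · linear_combination h22

theorem IsConformalPotential.flatness_values (hcomm : ∀ a, d₂ (d₁ a) = d₁ (d₂ a)) {δ μ : A}
    (hf : IsKillingFrame d₁ d₂ δ 0 0) (hμ : IsConformalPotential d₁ d₂ δ 0 0 μ) (hδ : v δ ≠ 0) :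
    2 * v δ * v (d₁ (μ * (d₁ (d₁ μ) + d₂ (d₂ μ)) - (d₁ μ * d₁ μ + d₂ μ * d₂ μ))) =
      -3 * v (d₁ δ) * v (μ * (d₁ (d₁ μ) + d₂ (d₂ μ)) - (d₁ μ * d₁ μ + d₂ μ * d₂ μ)) ∧
    2 * v δ * v (d₂ (μ * (d₁ (d₁ μ) + d₂ (d₂ μ)) - (d₁ μ * d₁ μ + d₂ μ * d₂ μ))) =
      -3 * v (d₂ δ) * v (μ * (d₁ (d₁ μ) + d₂ (d₂ μ)) - (d₁ μ * d₁ μ + d₂ μ * d₂ μ)) := by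
  have hK := congrArg v hf.disc
  have hK1 := congrArg (fun a => v (d₁ a)) hf.disc
  have hK2 := congrArg (fun a => v (d₂ a)) hf.disc
  have hS := congrArg v hμ.eqS
  have hS1 := congrArg (fun a => v (d₁ a)) hμ.eqS
  have hS2 := congrArg (fun a => v (d₂ a)) hμ.eqS
  have hR := congrArg v hμ.eqR
  have hR1 := congrArg (fun a => v (d₁ a)) hμ.eqR
  have hR2 := congrArg (fun a => v (d₂ a)) hμ.eqR
  simp only [map_add, map_sub, map_neg, map_mul, map_ofNat, Derivation.leibniz, smul_eq_mul, hcomm,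
    Derivation.map_ofNat_eq_zero, map_zero] at hK hK1 hK2 hS hS1 hS2 hR hR1 hR2 ⊢
  have h := flatness_of_jets hδ (d1 := v (d₁ δ)) (d2 := v (d₂ δ)) (d11 := v (d₁ (d₁ δ))) (d12 := v (d₁ (d₂ δ)))
    (d22 := v (d₂ (d₂ δ))) (d111 := v (d₁ (d₁ (d₁ δ))))
    (d112 := v (d₁ (d₁ (d₂ δ)))) (d122 := v (d₁ (d₂ (d₂ δ)))) (d222 := v (d₂ (d₂ (d₂ δ))))
    (m := v μ) (m1 := v (d₁ μ)) (m2 := v (d₂ μ)) (m11 := v (d₁ (d₁ μ)))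
    (m12 := v (d₁ (d₂ μ))) (m22 := v (d₂ (d₂ μ))) (m111 := v (d₁ (d₁ (d₁ μ))))
    (m112 := v (d₁ (d₁ (d₂ μ)))) (m122 := v (d₁ (d₂ (d₂ μ)))) (m222 := v (d₂ (d₂ (d₂ μ))))
    (by linear_combination hK) (by linear_combination hK1) (by linear_combination hK2)
    (by linear_combination hS) (by linear_combination hR) (by linear_combination hS1)
    (by linear_combination hS2) (by linear_combination hR1) (by linear_combination hR2)
  constructor
  · linear_combination h.1
  · linear_combination h.2

theorem null_system_of_frame {D E : Derivation ℤ A A} (hcomm : ∀ a, E (D a) = D (E a))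
    {I δ B μ : A} (hEI : E I = 0)
    (hK : δ * D (E δ) = D δ * E δ)
    (hZ : 2 * δ * D (D μ) + 3 * D δ * D μ + D (D δ) * μ = -I * (3 * B * E μ + E B * μ))
    (hW : 2 * δ * E (E μ) + 3 * E δ * E μ + E (E δ) * μ = 0) (hδ : v δ ≠ 0)
    (hJ : 2 * v δ ^ 2 * v (E (E B)) - 5 * v δ * v (E δ) * v (E B) - 3 * v δ * v B * v (E (E δ))
      + 6 * v B * v (E δ) ^ 2 = 0) :
    2 * v δ ^ 2 * v (D (D (2 * δ * E μ + E δ * μ))) =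
      v δ * v (D δ) * v (D (2 * δ * E μ + E δ * μ))
      + (-v (D δ) ^ 2 + v δ * v (D (D δ)) - v I * (4 * v δ * v (E B) - 6 * v B * v (E δ)))
        * v (2 * δ * E μ + E δ * μ) := by
  have hv := congrArg v hK
  have hKz := congrArg (fun a => v (D a)) hK
  have hZ' := congrArg v hZ
  have hZw := congrArg (fun a => v (E a)) hZ
  have hW' := congrArg v hW
  simp only [map_add, map_neg, map_mul, map_ofNat, Derivation.leibniz, smul_eq_mul, hcomm,
    Derivation.map_ofNat_eq_zero, map_zero, hEI] at hv hKz hZ' hZw hW' ⊢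
  have h := null_system_of_jets hδ (I := v I) (dz := v (D δ)) (dw := v (E δ)) (dzz := v (D (D δ)))
    (dzw := v (D (E δ))) (dww := v (E (E δ))) (dzzw := v (D (D (E δ)))) (B := v B) (Bw := v (E B))
    (Bww := v (E (E B))) (m := v μ) (mz := v (D μ)) (mw := v (E μ)) (mzz := v (D (D μ)))
    (mzw := v (D (E μ))) (mww := v (E (E μ))) (mzzw := v (D (D (E μ))))
    (by linear_combination hv) (by linear_combination hKz) hJ (by linear_combination hZ')
    (by linear_combination hW') (by linear_combination hZw)
  linear_combination h

/-- `F = 0` says `E log μ = -½ E log δ`, and `hK` says `D E log δ = 0`; so `D E log μ = 0`. Written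
without logarithms, only the values of `F` and `D F` are needed. -/
theorem flat_of_null_system {D E : Derivation ℤ A A} {δ μ : A} (hδ : v δ ≠ 0)
    (hK : δ * D (E δ) = D δ * E δ) (hF : v (2 * δ * E μ + E δ * μ) = 0)
    (hDF : v (D (2 * δ * E μ + E δ * μ)) = 0) :
    v (μ * D (E μ)) = v (D μ * E μ) := by
  have hK' := congrArg v hK
  simp only [map_add, map_mul, map_ofNat, Derivation.leibniz, smul_eq_mul,
    Derivation.map_ofNat_eq_zero, map_zero] at hK' hF hDF ⊢
  refine mul_left_cancel₀ (mul_ne_zero two_ne_zero (pow_ne_zero 2 hδ)) ?_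
  linear_combination v δ * v μ * hDF - v δ * v (D μ) * hF - v μ * v (D δ) * hF + v μ ^ 2 * (-hK')

/-- The canonical equations in null coordinates, when one of the two Wronskians vanishes. -/
theorem IsConformalPotential.null_form (hcomm : ∀ a, d₂ (d₁ a) = d₁ (d₂ a)) {i δ X Y μ : A}
    (hi : i * i = -1) (hi₁ : d₁ i = 0) (hi₂ : d₂ i = 0) (hXY : X + i * Y = 0)
    (hf : IsKillingFrame d₁ d₂ δ X Y) (hμ : IsConformalPotential d₁ d₂ δ X Y μ) :
    2 * δ * (d₁ - i • d₂) ((d₁ - i • d₂) μ) + 3 * (d₁ - i • d₂) δ * (d₁ - i • d₂) μ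
        + (d₁ - i • d₂) ((d₁ - i • d₂) δ) * μ
        = -i * (3 * (X - i * Y) * (d₁ + i • d₂) μ + (d₁ + i • d₂) (X - i * Y) * μ) ∧
      2 * δ * (d₁ + i • d₂) ((d₁ + i • d₂) μ) + 3 * (d₁ + i • d₂) δ * (d₁ + i • d₂) μ
        + (d₁ + i • d₂) ((d₁ + i • d₂) δ) * μ = 0 := by
  have h₁ := congrArg d₁ hXY
  have hS := hμ.eqS
  have hR := hμ.eqR
  simp only [map_add, map_sub, Derivation.leibniz, smul_eq_mul, hcomm, Derivation.add_apply,
    Derivation.sub_apply, Derivation.smul_apply, hi₁, hi₂, map_zero, hf.cr₁, hf.cr₂] at h₁ ⊢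
  constructor
  · linear_combination hS - i * hR + (2 * δ * d₂ (d₂ μ) + 3 * d₂ μ * d₂ δ + 3 * X * d₂ μ
      - 3 * Y * d₁ μ + d₂ (d₂ δ) * μ - 2 * μ * d₁ Y - i * (3 * d₂ μ * Y + μ * d₁ X)) * hi
  · linear_combination hS + i * hR + (2 * δ * d₂ (d₂ μ) + 3 * d₂ μ * d₂ δ + d₂ (d₂ δ) * μ
      - 3 * Y * d₁ μ - 2 * μ * d₁ Y) * hi + (3 * d₂ μ + 3 * i * d₁ μ) * hXY + 2 * i * μ * h₁

/-- The right side `-(X² + Y²)` of the discriminant identity factors through `X + iY = 0`, and `D E`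
is the Laplacian: thus `D E log δ = 0`. -/
theorem null_disc (hcomm : ∀ a, d₂ (d₁ a) = d₁ (d₂ a)) {i δ X Y : A}
    (hi : i * i = -1) (hi₁ : d₁ i = 0) (hi₂ : d₂ i = 0) (hXY : X + i * Y = 0)
    (hf : IsKillingFrame d₁ d₂ δ X Y) :
    δ * (d₁ - i • d₂) ((d₁ + i • d₂) δ) = (d₁ - i • d₂) δ * (d₁ + i • d₂) δ := by
  have h := hf.disc
  simp only [map_add, Derivation.leibniz, smul_eq_mul, hcomm, Derivation.add_apply,
    Derivation.sub_apply, Derivation.smul_apply, hi₁, hi₂]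
  linear_combination h - (X - i * Y) * hXY + (d₂ δ * d₂ δ - δ * d₂ (d₂ δ) - Y * Y) * hi

/-- This is `hJ + I * hJ'` modulo `X + I Y = 0`: the linear terms combine into products with `X - I
Y` and its derivatives, and the terms quadratic in the Wronskian drop out. -/
theorem null_integrability {I d d1 d2 d11 d12 d22 X Y X1 Y1 X11 Y11 : K} (hi : I * I = -1)
    (hA : X + I * Y = 0) (hA1 : X1 + I * Y1 = 0)
    (hJ : 8 * d ^ 2 * X11 - 10 * d * (X1 * d1 + Y1 * d2)
        - 3 * d * (X * (d11 - d22) + 2 * Y * d12)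
        + 6 * (X * (d1 ^ 2 - d2 ^ 2) + 2 * Y * d1 * d2) + 6 * (X ^ 2 + Y ^ 2) * d2
        + 8 * d * (X * Y1 - Y * X1) = 0)
    (hJ' : -8 * d ^ 2 * Y11 - 10 * d * (X1 * d2 - Y1 * d1)
        - 3 * d * (2 * X * d12 - Y * (d11 - d22)) + 6 * (2 * X * d1 * d2 - Y * (d1 ^ 2 - d2 ^ 2))
        + 6 * (X ^ 2 + Y ^ 2) * d1 - 8 * d * (X * X1 + Y * Y1) = 0) :
    2 * d ^ 2 * (4 * (X11 - I * Y11)) - 5 * d * (d1 + I * d2) * (2 * (X1 - I * Y1))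
      - 3 * d * (X - I * Y) * (d11 - d22 + 2 * I * d12)
      + 6 * (X - I * Y) * (d1 + I * d2) ^ 2 = 0 := by
  grind

end DifferentialAlgebraValues

/-! ### Uniqueness for the canonical equations -/

section CanonicalSystem

variable {𝕜 : Type*} [RCLike 𝕜]

theorem germDeriv_swap (x : Coord 𝕜) (a : AnalyticGerm x) :
    germDeriv x 1 (germDeriv x 0 a) = germDeriv x 0 (germDeriv x 1 a) :=
  germDeriv_comm 1 0 a

/-- A solution of a system prescribing `μ₁₁ - μ₂₂` and `μ₁₂` by first order data is determined by
the values of `μ, μ₁, μ₂, μ₁₁` at a point. -/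
theorem eventually_eq_zero_of_canonical_system {x₀ : Coord 𝕜} {μ : Coord 𝕜 → 𝕜}
    {s r : Fin 3 → Coord 𝕜 → 𝕜} (hμ : AnalyticAt 𝕜 μ x₀) (hs : ∀ k, AnalyticAt 𝕜 (s k) x₀)
    (hr : ∀ k, AnalyticAt 𝕜 (r k) x₀)
    (hS : ∀ᶠ y in 𝓝 x₀, partialDeriv 0 (partialDeriv 0 μ) y - partialDeriv 1 (partialDeriv 1 μ) y =
      s 0 y * μ y + s 1 y * partialDeriv 0 μ y + s 2 y * partialDeriv 1 μ y)
    (hR : ∀ᶠ y in 𝓝 x₀, partialDeriv 0 (partialDeriv 1 μ) y =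
      r 0 y * μ y + r 1 y * partialDeriv 0 μ y + r 2 y * partialDeriv 1 μ y)
    (h0 : μ x₀ = 0) (h1 : partialDeriv 0 μ x₀ = 0) (h2 : partialDeriv 1 μ x₀ = 0)
    (h11 : partialDeriv 0 (partialDeriv 0 μ) x₀ = 0) : μ =ᶠ[𝓝 x₀] 0 := by
  -- The 2-jet of `μ` obeys a closed first-order system. With `S, R` the right-hand sides of the
  -- equations for `μ₁₁ - μ₂₂` and `μ₁₂`, the third derivatives are `μ₁₁₂ = ∂₁R`, `μ₁₂₂ = ∂₂R`,
  -- `μ₁₁₁ = ∂₂R + ∂₁S` and `μ₂₂₂ = ∂₁R - ∂₂S`; `r0, r1, s0, s1` are the coefficients of these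
  -- derivatives in the entries of `u`.
  let u : Fin 6 → Coord 𝕜 → 𝕜 := ![μ, partialDeriv 0 μ, partialDeriv 1 μ,
    partialDeriv 0 (partialDeriv 0 μ), partialDeriv 0 (partialDeriv 1 μ),
    partialDeriv 1 (partialDeriv 1 μ)]
  let r0 : Fin 6 → Coord 𝕜 → 𝕜 := ![partialDeriv 0 (r 0), partialDeriv 0 (r 1) + r 0,
    partialDeriv 0 (r 2), r 1, r 2, 0]
  let r1 : Fin 6 → Coord 𝕜 → 𝕜 := ![partialDeriv 1 (r 0), partialDeriv 1 (r 1),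
    partialDeriv 1 (r 2) + r 0, 0, r 1, r 2]
  let s0 : Fin 6 → Coord 𝕜 → 𝕜 := ![partialDeriv 0 (s 0), partialDeriv 0 (s 1) + s 0,
    partialDeriv 0 (s 2), s 1, s 2, 0]
  let s1 : Fin 6 → Coord 𝕜 → 𝕜 := ![partialDeriv 1 (s 0), partialDeriv 1 (s 1),
    partialDeriv 1 (s 2) + s 0, 0, s 1, s 2]
  let e : Fin 6 → Fin 6 → Coord 𝕜 → 𝕜 := fun j k _ => if k = j then 1 else 0
  let A : Fin 2 → Fin 6 → Fin 6 → Coord 𝕜 → 𝕜 :=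
    ![![e 1, e 3, e 4, r1 + s0, r0, r1], ![e 2, e 4, e 5, r0, r1, r0 - s1]]
  have hr0 : ∀ k, AnalyticAt 𝕜 (r0 k) x₀ := by
    intro k
    fin_cases k
    exacts [(hr 0).partialDeriv 0, ((hr 1).partialDeriv 0).add (hr 0), (hr 2).partialDeriv 0,
      hr 1, hr 2, analyticAt_const]
  have hr1 : ∀ k, AnalyticAt 𝕜 (r1 k) x₀ := by
    intro k
    fin_cases k
    exacts [(hr 0).partialDeriv 1, (hr 1).partialDeriv 1, ((hr 2).partialDeriv 1).add (hr 0),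
      analyticAt_const, hr 1, hr 2]
  have hs0 : ∀ k, AnalyticAt 𝕜 (s0 k) x₀ := by
    intro k
    fin_cases k
    exacts [(hs 0).partialDeriv 0, ((hs 1).partialDeriv 0).add (hs 0), (hs 2).partialDeriv 0,
      hs 1, hs 2, analyticAt_const]
  have hs1 : ∀ k, AnalyticAt 𝕜 (s1 k) x₀ := by
    intro k
    fin_cases k
    exacts [(hs 0).partialDeriv 1, (hs 1).partialDeriv 1, ((hs 2).partialDeriv 1).add (hs 0),
      analyticAt_const, hs 1, hs 2]
  have he : ∀ j k, AnalyticAt 𝕜 (e j k) x₀ := fun j k => analyticAt_const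
  have hA : ∀ i j k, AnalyticAt 𝕜 (A i j k) x₀ := by
    intro i j k
    fin_cases i <;> fin_cases j
    exacts [he 1 k, he 3 k, he 4 k, (hr1 k).add (hs0 k), hr0 k, hr1 k,
      he 2 k, he 4 k, he 5 k, hr0 k, hr1 k, (hr0 k).sub (hs1 k)]
  have hu : ∀ j, AnalyticAt 𝕜 (u j) x₀ := by
    intro j
    fin_cases j
    exacts [hμ, hμ.partialDeriv 0, hμ.partialDeriv 1, (hμ.partialDeriv 0).partialDeriv 0,
      (hμ.partialDeriv 1).partialDeriv 0, (hμ.partialDeriv 1).partialDeriv 1]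
  have hev : ∀ᶠ y in 𝓝 x₀, ∀ j, AnalyticAt 𝕜 (u j) y :=
    eventually_all.2 fun j => (hu j).eventually_analyticAt
  have hres := eventually_eq_zero_of_linear_system u A (fun i j k => (hA i j k).continuousAt)
    (hev.mono fun y hy j => (hy j).differentiableAt) ?_ ?_
  · filter_upwards [hres] with y hy using hy 0
  · filter_upwards [hμ.eventually_analyticAt, eventually_all.2 fun k => (hs k).eventually_analyticAt,
      eventually_all.2 fun k => (hr k).eventually_analyticAt, hS.eventually_nhds,
      hR.eventually_nhds] with y hμy hsy hry hSy hRy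
    have gS : germDeriv y 0 (germDeriv y 0 (germAt μ hμy))
          - germDeriv y 1 (germDeriv y 1 (germAt μ hμy)) = germAt _ (hsy 0) * germAt μ hμy + germAt _ (hsy 1) * germDeriv y 0 (germAt μ hμy)
          + germAt _ (hsy 2) * germDeriv y 1 (germAt μ hμy) :=
      (germAt_eq_iff (((hμy.partialDeriv 0).partialDeriv 0).sub
        ((hμy.partialDeriv 1).partialDeriv 1))
        ((((hsy 0).mul hμy).add ((hsy 1).mul (hμy.partialDeriv 0))).add
          ((hsy 2).mul (hμy.partialDeriv 1)))).2 hSy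
    have gR : germDeriv y 0 (germDeriv y 1 (germAt μ hμy))
        = germAt _ (hry 0) * germAt μ hμy + germAt _ (hry 1) * germDeriv y 0 (germAt μ hμy)
          + germAt _ (hry 2) * germDeriv y 1 (germAt μ hμy) :=
      (germAt_eq_iff ((hμy.partialDeriv 1).partialDeriv 0)
        ((((hry 0).mul hμy).add ((hry 1).mul (hμy.partialDeriv 0))).add
          ((hry 2).mul (hμy.partialDeriv 1)))).2 hRy
    have hS0 := congrArg (fun a => germValue y (germDeriv y 0 a)) gS
    have hS1 := congrArg (fun a => germValue y (germDeriv y 1 a)) gS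
    have hR0 := congrArg (fun a => germValue y (germDeriv y 0 a)) gR
    have hR1 := congrArg (fun a => germValue y (germDeriv y 1 a)) gR
    have c1 := partialDeriv_comm hμy 1 0
    have c2 := partialDeriv_comm (hμy.partialDeriv 0) 1 0
    have c3 := partialDeriv_comm (hμy.partialDeriv 1) 1 0
    have c4 : partialDeriv 0 (partialDeriv 1 (partialDeriv 0 μ)) y =
        partialDeriv 0 (partialDeriv 0 (partialDeriv 1 μ)) y := by
      have := congrArg (fun a => germValue y (germDeriv y 0 a)) (germDeriv_swap y (germAt μ hμy))
      simpa only [germDeriv_germAt, germValue_germAt] using this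
    simp only [map_add, map_sub, Derivation.leibniz, smul_eq_mul, map_mul, germDeriv_germAt,
      germValue_germAt] at hS0 hS1 hR0 hR1
    rw [c1] at hS1 hR1
    intro i j
    fin_cases i <;> fin_cases j <;>
      simp [A, u, e, r0, r1, s0, s1, Fin.sum_univ_six] <;> first | exact c1 | skip
    · linear_combination hS0 + hR1 - c3
    · linear_combination hR0
    · linear_combination hR1 - c3
    · linear_combination c2 + c4 + hR0
    · linear_combination hR1
    · linear_combination hR0 - hS1 + c2 + c4
  · have e12 := hR.self_of_nhds
    have e22 := hS.self_of_nhds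
    rw [h0, h1, h2] at e12 e22
    rw [h11] at e22
    intro j
    fin_cases j
    · exact h0
    · exact h1
    · exact h2
    · exact h11
    · exact e12.trans (by ring)
    · change partialDeriv 1 (partialDeriv 1 μ) x₀ = 0
      linear_combination -e22

end CanonicalSystem

/-! ### Product rules for partial derivatives -/

section PartialDerivRules

variable {𝕜 : Type*} [RCLike 𝕜] {f g : Coord 𝕜 → 𝕜} {x : Coord 𝕜}

theorem partialDeriv_add (i : Fin 2) (hf : DifferentiableAt 𝕜 f x) (hg : DifferentiableAt 𝕜 g x) :
    partialDeriv i (fun y => f y + g y) x = partialDeriv i f x + partialDeriv i g x := by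
  simp only [partialDeriv]
  rw [fderiv_fun_add hf hg]
  rfl

theorem partialDeriv_sub (i : Fin 2) (hf : DifferentiableAt 𝕜 f x) (hg : DifferentiableAt 𝕜 g x) :
    partialDeriv i (fun y => f y - g y) x = partialDeriv i f x - partialDeriv i g x := by
  simp only [partialDeriv]
  rw [fderiv_fun_sub hf hg]
  rfl

theorem partialDeriv_mul (i : Fin 2) (hf : DifferentiableAt 𝕜 f x) (hg : DifferentiableAt 𝕜 g x) :
    partialDeriv i (fun y => f y * g y) x = f x * partialDeriv i g x + g x * partialDeriv i f x := by
  simp only [partialDeriv]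
  rw [fderiv_fun_mul hf hg]
  rfl

theorem partialDeriv_const_mul (i : Fin 2) (c : 𝕜) (hf : DifferentiableAt 𝕜 f x) :
    partialDeriv i (fun y => c * f y) x = c * partialDeriv i f x := by
  simp only [partialDeriv]
  rw [fderiv_const_mul hf c]
  rfl

theorem partialDeriv_mul_mul (i j : Fin 2) (hf : AnalyticAt 𝕜 f x) (hg : AnalyticAt 𝕜 g x) :
    partialDeriv i (partialDeriv j (fun y => f y * g y)) x =
      f x * partialDeriv i (partialDeriv j g) x + partialDeriv i f x * partialDeriv j g x
      + partialDeriv j f x * partialDeriv i g x + g x * partialDeriv i (partialDeriv j f) x := by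
  have h : germDeriv x i (germDeriv x j (germAt f hf * germAt g hg)) =
      germAt f hf * germDeriv x i (germDeriv x j (germAt g hg))
      + germDeriv x i (germAt f hf) * germDeriv x j (germAt g hg)
      + germDeriv x j (germAt f hf) * germDeriv x i (germAt g hg)
      + germAt g hg * germDeriv x i (germDeriv x j (germAt f hf)) := by
    simp only [map_add, Derivation.leibniz, smul_eq_mul]
    ring
  exact congrArg (germValue x) h

end PartialDerivRules

/-! ### The Killing frame and conformal potentials of a superintegrable system -/

namespace SecondOrderSystem

variable {𝕜 : Type*} [RCLike 𝕜] {S : SecondOrderSystem 𝕜} {D : Set (Coord 𝕜)} {x : Coord 𝕜}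

/-- The difference `a¹¹ - a²²` of the diagonal coefficients of `L_k`. -/
def quadDiff (S : SecondOrderSystem 𝕜) (k : Fin 2) (x : Coord 𝕜) : 𝕜 :=
  S.quad k x 0 0 - S.quad k x 1 1

/-- Twice the off-diagonal coefficient of `L_k`. -/
def quadCross (S : SecondOrderSystem 𝕜) (k : Fin 2) (x : Coord 𝕜) : 𝕜 :=
  S.quad k x 0 1 + S.quad k x 0 1

/-- The determinant of the traceless parts of `L₁, L₂`. -/
def disc (S : SecondOrderSystem 𝕜) (x : Coord 𝕜) : 𝕜 :=
  S.quadCross 0 x * S.quadDiff 1 x - S.quadCross 1 x * S.quadDiff 0 x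

/-- The real part of the Wronskian of the traceless parts of `L₁, L₂`. -/
def wronskRe (S : SecondOrderSystem 𝕜) (x : Coord 𝕜) : 𝕜 :=
  partialDeriv 0 (S.quadDiff 0) x * S.quadDiff 1 x - partialDeriv 0 (S.quadCross 0) x * S.quadCross 1 x
    - S.quadDiff 0 x * partialDeriv 0 (S.quadDiff 1) x
    + S.quadCross 0 x * partialDeriv 0 (S.quadCross 1) x

/-- The imaginary part of the Wronskian of the traceless parts of `L₁, L₂`. -/
def wronskIm (S : SecondOrderSystem 𝕜) (x : Coord 𝕜) : 𝕜 :=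
  partialDeriv 0 (S.quadDiff 0) x * S.quadCross 1 x + partialDeriv 0 (S.quadCross 0) x * S.quadDiff 1 x
    - S.quadDiff 0 x * partialDeriv 0 (S.quadCross 1) x
    - S.quadCross 0 x * partialDeriv 0 (S.quadDiff 1) x

namespace IsSuperintegrableOn

theorem analyticAt_quadDiff (hS : S.IsSuperintegrableOn D) (hx : x ∈ D) (k : Fin 2) :
    AnalyticAt 𝕜 (S.quadDiff k) x :=
  (hS.analytic_quad k 0 0 x hx).sub (hS.analytic_quad k 1 1 x hx)

theorem analyticAt_quadCross (hS : S.IsSuperintegrableOn D) (hx : x ∈ D) (k : Fin 2) :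
    AnalyticAt 𝕜 (S.quadCross k) x :=
  (hS.analytic_quad k 0 1 x hx).add (hS.analytic_quad k 0 1 x hx)

theorem analyticAt_disc (hS : S.IsSuperintegrableOn D) (hx : x ∈ D) : AnalyticAt 𝕜 S.disc x :=
  ((hS.analyticAt_quadCross hx 0).mul (hS.analyticAt_quadDiff hx 1)).sub
    ((hS.analyticAt_quadCross hx 1).mul (hS.analyticAt_quadDiff hx 0))

theorem analyticAt_wronskRe (hS : S.IsSuperintegrableOn D) (hx : x ∈ D) :
    AnalyticAt 𝕜 S.wronskRe x :=
  (((((hS.analyticAt_quadDiff hx 0).partialDeriv 0).mul (hS.analyticAt_quadDiff hx 1)).sub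
    (((hS.analyticAt_quadCross hx 0).partialDeriv 0).mul (hS.analyticAt_quadCross hx 1))).sub
    ((hS.analyticAt_quadDiff hx 0).mul ((hS.analyticAt_quadDiff hx 1).partialDeriv 0))).add
    ((hS.analyticAt_quadCross hx 0).mul ((hS.analyticAt_quadCross hx 1).partialDeriv 0))

theorem analyticAt_wronskIm (hS : S.IsSuperintegrableOn D) (hx : x ∈ D) :
    AnalyticAt 𝕜 S.wronskIm x :=
  (((((hS.analyticAt_quadDiff hx 0).partialDeriv 0).mul (hS.analyticAt_quadCross hx 1)).add
    (((hS.analyticAt_quadCross hx 0).partialDeriv 0).mul (hS.analyticAt_quadDiff hx 1))).sub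
    ((hS.analyticAt_quadDiff hx 0).mul ((hS.analyticAt_quadCross hx 1).partialDeriv 0))).sub
    ((hS.analyticAt_quadCross hx 0).mul ((hS.analyticAt_quadDiff hx 1).partialDeriv 0))

theorem eventually_mem (hS : S.IsSuperintegrableOn D) (hx : x ∈ D) : ∀ᶠ y in 𝓝 x, y ∈ D :=
  hS.isOpen.mem_nhds hx

theorem eventually_symm (hS : S.IsSuperintegrableOn D) (hx : x ∈ D) (k : Fin 2) :
    ∀ᶠ y in 𝓝 x, (S.quad k y).IsSymm :=
  (hS.eventually_mem hx).mono fun y hy => hS.quad_symm k y hy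

theorem isKillingAt (hS : S.IsSuperintegrableOn D) (hx : x ∈ D) (k : Fin 2) :
    IsKillingAt S.metric (S.quad k) x :=
  ((poissonBracket_eq_zero_iff (hS.analytic_metric x hx).differentiableAt
    (hS.analytic_potential x hx).differentiableAt (hS.metric_ne_zero x hx)
    (fun i j => (hS.analytic_quad k i j x hx).differentiableAt)
    (hS.analytic_scalar k x hx).differentiableAt (hS.eventually_symm hx k)).1
      (hS.constant_of_motion k x hx)).1

/-- The difference of two Killing equations with the same gradient terms of the metric: half of the
Cauchy-Riemann equations for `quadDiff + i quadCross`, independent of the metric. -/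
theorem partialDeriv_quadCross (hS : S.IsSuperintegrableOn D) (hx : x ∈ D) (k : Fin 2) :
    partialDeriv 1 (S.quadCross k) x = partialDeriv 0 (S.quadDiff k) x := by
  have h := hS.isKillingAt hx k
  have hd (i j : Fin 2) := (hS.analytic_quad k i j x hx).differentiableAt
  refine mul_left_cancel₀ (hS.metric_ne_zero x hx) ?_
  rw [show S.quadCross k = fun y => S.quad k y 0 1 + S.quad k y 0 1 from rfl,
    show S.quadDiff k = fun y => S.quad k y 0 0 - S.quad k y 1 1 from rfl,
    partialDeriv_add _ (hd 0 1) (hd 0 1), partialDeriv_sub _ (hd 0 0) (hd 1 1)]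
  linear_combination h.eq011 - h.eq000

theorem partialDeriv_quadDiff (hS : S.IsSuperintegrableOn D) (hx : x ∈ D) (k : Fin 2) :
    partialDeriv 1 (S.quadDiff k) x = -partialDeriv 0 (S.quadCross k) x := by
  have h := hS.isKillingAt hx k
  have hd (i j : Fin 2) := (hS.analytic_quad k i j x hx).differentiableAt
  refine mul_left_cancel₀ (hS.metric_ne_zero x hx) ?_
  rw [show S.quadCross k = fun y => S.quad k y 0 1 + S.quad k y 0 1 from rfl,
    show S.quadDiff k = fun y => S.quad k y 0 0 - S.quad k y 1 1 from rfl,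
    partialDeriv_add _ (hd 0 1) (hd 0 1), partialDeriv_sub _ (hd 0 0) (hd 1 1)]
  linear_combination h.eq001 - h.eq111

theorem germ_quadCross (hS : S.IsSuperintegrableOn D) (hx : x ∈ D) (k : Fin 2) :
    germDeriv x 1 (germAt _ (hS.analyticAt_quadCross hx k)) =
      germDeriv x 0 (germAt _ (hS.analyticAt_quadDiff hx k)) :=
  (germAt_eq_iff ((hS.analyticAt_quadCross hx k).partialDeriv 1)
    ((hS.analyticAt_quadDiff hx k).partialDeriv 0)).2
    ((hS.eventually_mem hx).mono fun _ hy => hS.partialDeriv_quadCross hy k)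

theorem germ_quadDiff (hS : S.IsSuperintegrableOn D) (hx : x ∈ D) (k : Fin 2) :
    germDeriv x 1 (germAt _ (hS.analyticAt_quadDiff hx k)) =
      -germDeriv x 0 (germAt _ (hS.analyticAt_quadCross hx k)) :=
  (germAt_eq_iff ((hS.analyticAt_quadDiff hx k).partialDeriv 1)
    ((hS.analyticAt_quadCross hx k).partialDeriv 0).neg).2
    ((hS.eventually_mem hx).mono fun _ hy => hS.partialDeriv_quadDiff hy k)

theorem isKillingFrame (hS : S.IsSuperintegrableOn D) (hx : x ∈ D) :
    IsKillingFrame (germDeriv x 0) (germDeriv x 1) (germAt _ (hS.analyticAt_disc hx))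
      (germAt _ (hS.analyticAt_wronskRe hx)) (germAt _ (hS.analyticAt_wronskIm hx)) :=
  isKillingFrame_of_pairs (germDeriv_swap x) (hS.germ_quadCross hx 0) (hS.germ_quadDiff hx 0)
    (hS.germ_quadCross hx 1) (hS.germ_quadDiff hx 1)

end IsSuperintegrableOn

theorem IsAdmissiblePotentialAt.eventually {V : Coord 𝕜 → 𝕜} (hV : S.IsAdmissiblePotentialAt V x) :
    ∀ᶠ y in 𝓝 x, S.IsAdmissiblePotentialAt V y := by
  obtain ⟨hVx, W, hW⟩ := hV
  filter_upwards [hVx.eventually_analyticAt, (hW 0).1.eventually_analyticAt,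
    (hW 1).1.eventually_analyticAt, (hW 0).2.eventually_nhds, (hW 1).2.eventually_nhds]
    with y h1 h2 h3 h4 h5
  refine ⟨h1, W, fun k => ?_⟩
  fin_cases k
  exacts [⟨h2, h4⟩, ⟨h3, h5⟩]

theorem IsAdmissiblePotentialAt.isConformalPotential (hS : S.IsSuperintegrableOn D) (hx : x ∈ D)
    {V : Coord 𝕜 → 𝕜} (hV : S.IsAdmissiblePotentialAt V x) :
    IsConformalPotential (germDeriv x 0) (germDeriv x 1) (germAt _ (hS.analyticAt_disc hx))
      (germAt _ (hS.analyticAt_wronskRe hx)) (germAt _ (hS.analyticAt_wronskIm hx))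
      (germAt (fun y => S.metric y * V y) ((hS.analytic_metric x hx).mul hV.1)) := by
  obtain ⟨hVx, W, hW⟩ := hV
  have hl := hS.analytic_metric x hx
  have key : ∀ k, _ := fun k => bertrand_darboux (germDeriv_swap x)
    (l := germAt _ hl) (a := germAt _ (hS.analytic_quad k 0 0 x hx))
    (b := germAt _ (hS.analytic_quad k 0 1 x hx)) (c := germAt _ (hS.analytic_quad k 1 1 x hx))
    (V := germAt V hVx) (W := germAt (W k) (hW k).1)
    (q := germAt _ (hS.analyticAt_quadDiff hx k)) (p := germAt _ (hS.analyticAt_quadCross hx k))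
    ((germAt_eq_iff (((hl.mul ((hS.analytic_quad k 0 0 x hx).partialDeriv 0)).add
      ((hS.analytic_quad k 0 0 x hx).mul (hl.partialDeriv 0))).add
      ((hS.analytic_quad k 0 1 x hx).mul (hl.partialDeriv 1))) analyticAt_const).2
      ((hS.eventually_mem hx).mono fun y hy => (hS.isKillingAt hy k).eq000))
    ((germAt_eq_iff (((hl.mul ((hS.analytic_quad k 1 1 x hx).partialDeriv 1)).add
      ((hS.analytic_quad k 0 1 x hx).mul (hl.partialDeriv 0))).add
      ((hS.analytic_quad k 1 1 x hx).mul (hl.partialDeriv 1))) analyticAt_const).2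
      ((hS.eventually_mem hx).mono fun y hy => (hS.isKillingAt hy k).eq111))
    rfl rfl (hS.germ_quadCross hx k) (hS.germ_quadDiff hx k)
    ((germAt_eq_iff ((hW k).1.partialDeriv 0) (hl.mul
      (((hS.analytic_quad k 0 0 x hx).mul (hVx.partialDeriv 0)).add
      ((hS.analytic_quad k 0 1 x hx).mul (hVx.partialDeriv 1))))).2 (by
        filter_upwards [hS.eventually_mem hx, hVx.eventually_analyticAt,
          (hW k).1.eventually_analyticAt, (hW k).2] with y hy h1 h2 h3
        exact ((poissonBracket_eq_zero_iff (hS.analytic_metric y hy).differentiableAt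
          h1.differentiableAt (hS.metric_ne_zero y hy)
          (fun i j => (hS.analytic_quad k i j y hy).differentiableAt)
          h2.differentiableAt (hS.eventually_symm hy k)).1 h3).2.eq0))
    ((germAt_eq_iff ((hW k).1.partialDeriv 1) (hl.mul
      (((hS.analytic_quad k 0 1 x hx).mul (hVx.partialDeriv 0)).add
      ((hS.analytic_quad k 1 1 x hx).mul (hVx.partialDeriv 1))))).2 (by
        filter_upwards [hS.eventually_mem hx, hVx.eventually_analyticAt,
          (hW k).1.eventually_analyticAt, (hW k).2] with y hy h1 h2 h3
        exact ((poissonBracket_eq_zero_iff (hS.analytic_metric y hy).differentiableAt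
          h1.differentiableAt (hS.metric_ne_zero y hy)
          (fun i j => (hS.analytic_quad k i j y hy).differentiableAt)
          h2.differentiableAt (hS.eventually_symm hy k)).1 h3).2.eq1))
  exact isConformalPotential_of_pairs (germDeriv_swap x) (hS.germ_quadCross hx 0)
    (hS.germ_quadDiff hx 0) (hS.germ_quadCross hx 1) (hS.germ_quadDiff hx 1) (key 0) (key 1)

end SecondOrderSystem

/-! ### Nondegeneracy, integrability and the canonical conformal factor -/

namespace SecondOrderSystem

variable {𝕜 : Type*} [RCLike 𝕜] {S : SecondOrderSystem 𝕜} {D : Set (Coord 𝕜)} {x : Coord 𝕜}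

/-- `H₀` spans the multiples of the identity, so independence of the three forms is independence of
the two traceless parts in a plane, measured by their determinant. -/
theorem linearIndependent_forms_iff (hl : S.metric x ≠ 0) (hs : ∀ k, (S.quad k x).IsSymm) :
    (∀ c₀ c₁ c₂ : 𝕜, (∀ p : Coord 𝕜, c₀ * hamiltonian S.metric 0 (x, p)
      + c₁ * quadraticIntegral (S.quad 0) 0 (x, p)
      + c₂ * quadraticIntegral (S.quad 1) 0 (x, p) = 0) → c₀ = 0 ∧ c₁ = 0 ∧ c₂ = 0) ↔
    S.disc x ≠ 0 := by
  have s0 := (hs 0).apply 0 1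
  have s1 := (hs 1).apply 0 1
  simp only [hamiltonian, quadraticIntegral, Fin.sum_univ_two, Pi.zero_apply, add_zero, s0, s1, disc,
    quadCross, quadDiff]
  constructor
  · intro h hd
    have key : ∀ c₁ c₂ : 𝕜, c₁ * (S.quad 0 x 0 0 - S.quad 0 x 1 1)
        + c₂ * (S.quad 1 x 0 0 - S.quad 1 x 1 1) = 0 →
        c₁ * (S.quad 0 x 0 1 + S.quad 0 x 0 1) + c₂ * (S.quad 1 x 0 1 + S.quad 1 x 0 1) = 0 →
        c₁ = 0 ∧ c₂ = 0 := by
      intro c₁ c₂ h1 h2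
      -- The multiple of `H₀` is chosen to cancel the coefficient of `p 0 ^ 2`; the hypotheses on
      -- the traceless parts then take care of the rest.
      refine (h (-(S.metric x * (c₁ * S.quad 0 x 0 0 + c₂ * S.quad 1 x 0 0))) c₁ c₂ fun p => ?_).2
      field_simp
      linear_combination -p 1 ^ 2 * h1 + p 0 * p 1 * h2
    -- If the determinant vanishes, the columns of the other traceless part give relations, so both
    -- its entries are zero; the same holds for the first tensor, and `(1, 0)` becomes a nontrivial
    -- relation.
    have h1 := key (S.quad 1 x 0 0 - S.quad 1 x 1 1) (-(S.quad 0 x 0 0 - S.quad 0 x 1 1)) (by ring)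
      (by linear_combination hd)
    have h2 := key (S.quad 1 x 0 1 + S.quad 1 x 0 1) (-(S.quad 0 x 0 1 + S.quad 0 x 0 1))
      (by linear_combination -hd) (by ring)
    exact one_ne_zero (key 1 0 (by linear_combination -h1.2) (by linear_combination -h2.2)).1
  · intro hd c₀ c₁ c₂ h
    have e1 := h ![1, 0]
    have e2 := h ![0, 1]
    have e3 := h ![1, 1]
    simp only [Matrix.cons_val_zero, Matrix.cons_val_one] at e1 e2 e3
    have hQ : c₁ * (S.quad 0 x 0 0 - S.quad 0 x 1 1) + c₂ * (S.quad 1 x 0 0 - S.quad 1 x 1 1) = 0 := by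
      linear_combination e1 - e2
    have hP : c₁ * (S.quad 0 x 0 1 + S.quad 0 x 0 1) + c₂ * (S.quad 1 x 0 1 + S.quad 1 x 0 1) = 0 := by
      linear_combination e3 - e1 - e2
    have h1 : c₁ = 0 := by
      refine (mul_eq_zero.1 (?_ : c₁ * _ = 0)).resolve_right hd
      linear_combination (S.quad 1 x 0 0 - S.quad 1 x 1 1) * hP
        - (S.quad 1 x 0 1 + S.quad 1 x 0 1) * hQ
    have h2 : c₂ = 0 := by
      refine (mul_eq_zero.1 (?_ : c₂ * _ = 0)).resolve_right hd
      linear_combination (S.quad 0 x 0 1 + S.quad 0 x 0 1) * hQ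
        - (S.quad 0 x 0 0 - S.quad 0 x 1 1) * hP
    subst h1 h2
    refine ⟨?_, rfl, rfl⟩
    have : c₀ * (1 / S.metric x) = 0 := by linear_combination e1
    exact (mul_eq_zero.1 this).resolve_right (one_div_ne_zero hl)

theorem IsNondegenerateOn.disc_ne_zero (hS : S.IsSuperintegrableOn D) (hnd : S.IsNondegenerateOn D)
    (hx : x ∈ D) : S.disc x ≠ 0 :=
  (linearIndependent_forms_iff (hS.metric_ne_zero x hx) fun k => hS.quad_symm k x hx).1
    (hnd.1 x hx)

/-- The values of `λ V, (λ V)₁, (λ V)₂, (λ V)₁₁` can be prescribed for admissible potentials `V`. -/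
theorem IsNondegenerateOn.exists_admissible (hS : S.IsSuperintegrableOn D)
    (hnd : S.IsNondegenerateOn D) (hx : x ∈ D) (c : Fin 4 → 𝕜) :
    ∃ V : Coord 𝕜 → 𝕜, S.IsAdmissiblePotentialAt V x ∧
      HasPotentialData (fun y => S.metric y * V y) x c := by
  have hl := hS.analytic_metric x hx
  have hl0 := hS.metric_ne_zero x hx
  -- The product rule for `λ V` is triangular in the jets of `V`, and is inverted order by order.
  set c₀ := c 0 / S.metric x with hc₀
  set c₁ := (c 1 - partialDeriv 0 S.metric x * c₀) / S.metric x with hc₁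
  obtain ⟨V, hV, ⟨h0, h1, h2, h3⟩, -⟩ := hnd.2 x hx ![c₀, c₁,
    (c 2 - partialDeriv 1 S.metric x * c₀) / S.metric x,
    (c 3 - partialDeriv 0 (partialDeriv 0 S.metric) x * c₀ - 2 * partialDeriv 0 S.metric x * c₁)
      / S.metric x]
  change V x = c₀ at h0
  change partialDeriv 0 V x = c₁ at h1
  change partialDeriv 1 V x = _ / S.metric x at h2
  change partialDeriv 0 (partialDeriv 0 V) x = _ / S.metric x at h3
  refine ⟨V, hV, ?_, ?_, ?_, ?_⟩
  · simp only [h0, hc₀]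
    field_simp
  · rw [partialDeriv_mul _ hl.differentiableAt hV.1.differentiableAt, h0, h1, hc₁]
    field_simp
    ring
  · rw [partialDeriv_mul _ hl.differentiableAt hV.1.differentiableAt, h0, h2]
    field_simp
    ring
  · rw [partialDeriv_mul_mul _ _ hl hV.1, h0, h1, h3]
    field_simp
    ring

/-- The canonical equations for conformal potentials, at a point. -/
structure IsCanonicalAt (S : SecondOrderSystem 𝕜) (μ : Coord 𝕜 → 𝕜) (x : Coord 𝕜) : Prop where
  eqS : 2 * S.disc x * (partialDeriv 0 (partialDeriv 0 μ) x - partialDeriv 1 (partialDeriv 1 μ) x) =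
    -3 * (partialDeriv 0 S.disc x + S.wronskIm x) * partialDeriv 0 μ x
      + 3 * (partialDeriv 1 S.disc x + S.wronskRe x) * partialDeriv 1 μ x
      + (-(partialDeriv 0 (partialDeriv 0 S.disc) x - partialDeriv 1 (partialDeriv 1 S.disc) x)
        - 2 * partialDeriv 0 S.wronskIm x) * μ x
  eqR : 4 * S.disc x * partialDeriv 0 (partialDeriv 1 μ) x =
    -3 * (partialDeriv 1 S.disc x - S.wronskRe x) * partialDeriv 0 μ x
      - 3 * (partialDeriv 0 S.disc x - S.wronskIm x) * partialDeriv 1 μ x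
      + (2 * partialDeriv 0 S.wronskRe x - 2 * partialDeriv 0 (partialDeriv 1 S.disc) x) * μ x

/-- The integrability conditions of the canonical equations, at a point. -/
structure IsIntegrableAt (S : SecondOrderSystem 𝕜) (x : Coord 𝕜) : Prop where
  re : 8 * S.disc x ^ 2 * partialDeriv 0 (partialDeriv 0 S.wronskRe) x
      - 10 * S.disc x * (partialDeriv 0 S.wronskRe x * partialDeriv 0 S.disc x
        + partialDeriv 0 S.wronskIm x * partialDeriv 1 S.disc x)
      - 3 * S.disc x * (S.wronskRe x *
          (partialDeriv 0 (partialDeriv 0 S.disc) x - partialDeriv 1 (partialDeriv 1 S.disc) x)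
        + 2 * S.wronskIm x * partialDeriv 0 (partialDeriv 1 S.disc) x)
      + 6 * (S.wronskRe x * (partialDeriv 0 S.disc x ^ 2 - partialDeriv 1 S.disc x ^ 2)
        + 2 * S.wronskIm x * partialDeriv 0 S.disc x * partialDeriv 1 S.disc x)
      + 6 * (S.wronskRe x ^ 2 + S.wronskIm x ^ 2) * partialDeriv 1 S.disc x
      + 8 * S.disc x * (S.wronskRe x * partialDeriv 0 S.wronskIm x
        - S.wronskIm x * partialDeriv 0 S.wronskRe x) = 0
  im : -8 * S.disc x ^ 2 * partialDeriv 0 (partialDeriv 0 S.wronskIm) x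
      - 10 * S.disc x * (partialDeriv 0 S.wronskRe x * partialDeriv 1 S.disc x
        - partialDeriv 0 S.wronskIm x * partialDeriv 0 S.disc x)
      - 3 * S.disc x * (2 * S.wronskRe x * partialDeriv 0 (partialDeriv 1 S.disc) x
        - S.wronskIm x *
          (partialDeriv 0 (partialDeriv 0 S.disc) x - partialDeriv 1 (partialDeriv 1 S.disc) x))
      + 6 * (2 * S.wronskRe x * partialDeriv 0 S.disc x * partialDeriv 1 S.disc x
        - S.wronskIm x * (partialDeriv 0 S.disc x ^ 2 - partialDeriv 1 S.disc x ^ 2))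
      + 6 * (S.wronskRe x ^ 2 + S.wronskIm x ^ 2) * partialDeriv 0 S.disc x
      - 8 * S.disc x * (S.wronskRe x * partialDeriv 0 S.wronskRe x
        + S.wronskIm x * partialDeriv 0 S.wronskIm x) = 0

theorem IsAdmissiblePotentialAt.isCanonicalAt (hS : S.IsSuperintegrableOn D) (hx : x ∈ D)
    {V : Coord 𝕜 → 𝕜} (hV : S.IsAdmissiblePotentialAt V x) :
    S.IsCanonicalAt (fun y => S.metric y * V y) x :=
  ⟨congrArg (germValue x) (hV.isConformalPotential hS hx).eqS,
    congrArg (germValue x) (hV.isConformalPotential hS hx).eqR⟩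

/-- The compatibility relation is linear in the gradient of `μ` where `μ = 0`. Potentials with `μ =
0` and gradient `(1, 0)`, respectively `(0, 1)`, make its two coefficients vanish separately. -/
theorem IsNondegenerateOn.isIntegrableAt (hS : S.IsSuperintegrableOn D)
    (hnd : S.IsNondegenerateOn D) (hx : x ∈ D) : S.IsIntegrableAt x := by
  have hd := hnd.disc_ne_zero hS hx
  constructor
  · obtain ⟨V, hV, h0, h1, h2, -⟩ := hnd.exists_admissible hS hx ![0, 1, 0, 0]
    have h := (hV.isConformalPotential hS hx).integrability (germValue x) (germDeriv_swap x)
      (hS.isKillingFrame hx) hd h0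
    simp only [germDeriv_germAt, germValue_germAt, h1, h2] at h
    simpa using h
  · obtain ⟨V, hV, h0, h1, h2, -⟩ := hnd.exists_admissible hS hx ![0, 0, 1, 0]
    have h := (hV.isConformalPotential hS hx).integrability (germValue x) (germDeriv_swap x)
      (hS.isKillingFrame hx) hd h0
    simp only [germDeriv_germAt, germValue_germAt, h1, h2] at h
    simpa using h.symm

/-- The conformal factor of the constant curvature metric attached to a nondegenerate system. -/
def canonicalFactor (S : SecondOrderSystem 𝕜) (x : Coord 𝕜) : 𝕜 :=
  (S.wronskRe x * S.wronskRe x + S.wronskIm x * S.wronskIm x) / (S.disc x * S.disc x)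

theorem analyticAt_canonicalFactor (hS : S.IsSuperintegrableOn D) (hnd : S.IsNondegenerateOn D)
    (hx : x ∈ D) : AnalyticAt 𝕜 S.canonicalFactor x :=
  (((hS.analyticAt_wronskRe hx).mul (hS.analyticAt_wronskRe hx)).add
    ((hS.analyticAt_wronskIm hx).mul (hS.analyticAt_wronskIm hx))).div
    ((hS.analyticAt_disc hx).mul (hS.analyticAt_disc hx))
    (mul_ne_zero (hnd.disc_ne_zero hS hx) (hnd.disc_ne_zero hS hx))

theorem canonicalFactor_spec (hS : S.IsSuperintegrableOn D) (hnd : S.IsNondegenerateOn D)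
    (hx : x ∈ D) : S.IsCanonicalAt S.canonicalFactor x ∧
      S.canonicalFactor x * (partialDeriv 0 (partialDeriv 0 S.canonicalFactor) x
        + partialDeriv 1 (partialDeriv 1 S.canonicalFactor) x)
      - (partialDeriv 0 S.canonicalFactor x ^ 2 + partialDeriv 1 S.canonicalFactor x ^ 2) =
      2 * S.canonicalFactor x ^ 3 := by
  have hm := analyticAt_canonicalFactor hS hnd hx
  have hδ := hS.analyticAt_disc hx
  have hX := hS.analyticAt_wronskRe hx
  have hY := hS.analyticAt_wronskIm hx
  have h := (hS.isKillingFrame hx).canonical_values (germValue x) (germDeriv_swap x)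
    (m := germAt _ hm) (hnd.disc_ne_zero hS hx)
    ((germAt_eq_iff (hm.mul (hδ.mul hδ)) ((hX.mul hX).add (hY.mul hY))).2
      ((hS.eventually_mem hx).mono fun y hy => div_mul_cancel₀ _
        (mul_ne_zero (hnd.disc_ne_zero hS hy) (hnd.disc_ne_zero hS hy))))
    (hnd.isIntegrableAt hS hx).re (hnd.isIntegrableAt hS hx).im
  exact ⟨⟨h.1, h.2.1⟩, h.2.2⟩

/-- Identifies the explicit factor, known only to solve the canonical equations, with `λ U` for an
admissible `U` having the same four initial values. -/
theorem eventuallyEq_of_isCanonicalAt (hS : S.IsSuperintegrableOn D) (hnd : S.IsNondegenerateOn D)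
    (hx : x ∈ D) {μ ν : Coord 𝕜 → 𝕜} {c : Fin 4 → 𝕜} (hμ : AnalyticAt 𝕜 μ x)
    (hν : AnalyticAt 𝕜 ν x) (hcμ : ∀ᶠ y in 𝓝 x, S.IsCanonicalAt μ y)
    (hcν : ∀ᶠ y in 𝓝 x, S.IsCanonicalAt ν y) (hdμ : HasPotentialData μ x c)
    (hdν : HasPotentialData ν x c) : μ =ᶠ[𝓝 x] ν := by
  have hδ := hS.analyticAt_disc hx
  have hX := hS.analyticAt_wronskRe hx
  have hY := hS.analyticAt_wronskIm hx
  have hd := hnd.disc_ne_zero hS hx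
  have h2δ : AnalyticAt 𝕜 (fun y => 2 * S.disc y) x := analyticAt_const.mul hδ
  have h4δ : AnalyticAt 𝕜 (fun y => 4 * S.disc y) x := analyticAt_const.mul hδ
  have hsub : ∀ᶠ y in 𝓝 x, (∀ i, partialDeriv i (fun z => μ z - ν z) y =
      partialDeriv i μ y - partialDeriv i ν y) ∧
      ∀ i j, partialDeriv i (partialDeriv j (fun z => μ z - ν z)) y =
        partialDeriv i (partialDeriv j μ) y - partialDeriv i (partialDeriv j ν) y := by
    filter_upwards [hμ.eventually_analyticAt, hν.eventually_analyticAt] with y h1 h2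
    refine ⟨fun i => partialDeriv_sub i h1.differentiableAt h2.differentiableAt, fun i j => ?_⟩
    exact congrArg (germValue y) (show germDeriv y i (germDeriv y j (germAt μ h1 - germAt ν h2)) =
      germDeriv y i (germDeriv y j (germAt μ h1)) - germDeriv y i (germDeriv y j (germAt ν h2)) by
        simp only [map_sub])
  have hsx := hsub.self_of_nhds
  have h := eventually_eq_zero_of_canonical_system (μ := fun y => μ y - ν y)
    (s := ![fun y => (-(partialDeriv 0 (partialDeriv 0 S.disc) y
        - partialDeriv 1 (partialDeriv 1 S.disc) y) - 2 * partialDeriv 0 S.wronskIm y)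
          / (2 * S.disc y),
      fun y => (-3 * (partialDeriv 0 S.disc y + S.wronskIm y)) / (2 * S.disc y),
      fun y => (3 * (partialDeriv 1 S.disc y + S.wronskRe y)) / (2 * S.disc y)])
    (r := ![fun y => (2 * partialDeriv 0 S.wronskRe y
        - 2 * partialDeriv 0 (partialDeriv 1 S.disc) y) / (4 * S.disc y),
      fun y => (-3 * (partialDeriv 1 S.disc y - S.wronskRe y)) / (4 * S.disc y),
      fun y => (-3 * (partialDeriv 0 S.disc y - S.wronskIm y)) / (4 * S.disc y)])
    (hμ.sub hν) ?_ ?_ ?_ ?_ ?_ ?_ ?_ ?_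
  · filter_upwards [h] with y hy using sub_eq_zero.1 hy
  · intro k
    fin_cases k
    · exact (((((hδ.partialDeriv 0).partialDeriv 0).sub ((hδ.partialDeriv 1).partialDeriv 1)).neg).sub
        (analyticAt_const.mul (hY.partialDeriv 0))).div h2δ (mul_ne_zero two_ne_zero hd)
    · exact (analyticAt_const.mul ((hδ.partialDeriv 0).add hY)).div h2δ (mul_ne_zero two_ne_zero hd)
    · exact (analyticAt_const.mul ((hδ.partialDeriv 1).add hX)).div h2δ (mul_ne_zero two_ne_zero hd)
  · intro k
    fin_cases k
    · exact ((analyticAt_const.mul (hX.partialDeriv 0)).sub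
        (analyticAt_const.mul ((hδ.partialDeriv 1).partialDeriv 0))).div h4δ
        (mul_ne_zero (OfNat.ofNat_ne_zero 4 : (4 : 𝕜) ≠ 0) hd)
    · exact (analyticAt_const.mul ((hδ.partialDeriv 1).sub hX)).div h4δ
        (mul_ne_zero (OfNat.ofNat_ne_zero 4 : (4 : 𝕜) ≠ 0) hd)
    · exact (analyticAt_const.mul ((hδ.partialDeriv 0).sub hY)).div h4δ
        (mul_ne_zero (OfNat.ofNat_ne_zero 4 : (4 : 𝕜) ≠ 0) hd)
  · filter_upwards [hcμ, hcν, hsub, hS.eventually_mem hx] with y h1 h2 h3 hy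
    have hdy := hnd.disc_ne_zero hS hy
    simp only [Matrix.cons_val_zero, Matrix.cons_val_one, Matrix.cons_val, h3.1, h3.2]
    field_simp
    linear_combination h1.eqS - h2.eqS
  · filter_upwards [hcμ, hcν, hsub, hS.eventually_mem hx] with y h1 h2 h3 hy
    have hdy := hnd.disc_ne_zero hS hy
    simp only [Matrix.cons_val_zero, Matrix.cons_val_one, Matrix.cons_val, h3.1, h3.2]
    field_simp
    linear_combination h1.eqR - h2.eqR
  · simp only [hdμ.1, hdν.1, sub_self]
  · rw [hsx.1, hdμ.2.1, hdν.2.1, sub_self]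
  · rw [hsx.1, hdμ.2.2.1, hdν.2.2.1, sub_self]
  · rw [hsx.2, hdμ.2.2.2, hdν.2.2.2, sub_self]

end SecondOrderSystem

/-! ### The Stäckel transform at a point -/

section PointwiseStackel

variable {𝕜 : Type*} [RCLike 𝕜] {lam U w : Coord 𝕜 → 𝕜}
  {a : Coord 𝕜 → Matrix (Fin 2) (Fin 2) 𝕜} {x : Coord 𝕜}

/-- The subtracted trace term, multiplied by the new metric, is just `w`. Its gradient is `lam a
dU`, exactly the excess that the factor `U` creates in the Killing equations. -/
theorem IsKillingAt.stackel (hl : DifferentiableAt 𝕜 lam x) (hU : DifferentiableAt 𝕜 U x)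
    (hw : DifferentiableAt 𝕜 w x) (ha : ∀ i j, DifferentiableAt 𝕜 (fun y => a y i j) x)
    (hl0 : lam x ≠ 0) (hU0 : U x ≠ 0) (hK : IsKillingAt lam a x) (hs : IsScalarPartAt lam U a w x) :
    IsKillingAt (fun y => lam y * U y)
      (fun y => a y - (w y / (U y * lam y)) • (1 : Matrix (Fin 2) (Fin 2) 𝕜)) x := by
  have hg : DifferentiableAt 𝕜 (fun y => w y / (U y * lam y)) x :=
    (hw.fun_mul ((hU.fun_mul hl).inv (mul_ne_zero hU0 hl0))).congr_of_eventuallyEq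
      (Eventually.of_forall fun y => div_eq_mul_inv (w y) (U y * lam y))
  have hev : (fun y => (lam y * U y) * (w y / (U y * lam y))) =ᶠ[𝓝 x] w := by
    filter_upwards [hl.continuousAt.eventually_ne hl0, hU.continuousAt.eventually_ne hU0]
      with y h1 h2
    field_simp
  have hd (i : Fin 2) : (lam x * U x) * partialDeriv i (fun y => w y / (U y * lam y)) x
      + (w x / (U x * lam x)) * (lam x * partialDeriv i U x + U x * partialDeriv i lam x) =
      partialDeriv i w x := by
    rw [← partialDeriv_mul i hl hU, ← partialDeriv_mul i (hl.fun_mul hU) hg,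
      (hev.partialDeriv i).eq_of_nhds]
  have h0 := hd 0
  have h1 := hd 1
  rw [hs.eq0] at h0
  rw [hs.eq1] at h1
  have e00 : (fun y => (a y - (w y / (U y * lam y)) • (1 : Matrix (Fin 2) (Fin 2) 𝕜)) 0 0) =
      fun y => a y 0 0 - w y / (U y * lam y) := by
    funext y; simp
  have e11 : (fun y => (a y - (w y / (U y * lam y)) • (1 : Matrix (Fin 2) (Fin 2) 𝕜)) 1 1) =
      fun y => a y 1 1 - w y / (U y * lam y) := by
    funext y; simp
  have e01 : (fun y => (a y - (w y / (U y * lam y)) • (1 : Matrix (Fin 2) (Fin 2) 𝕜)) 0 1) =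
      fun y => a y 0 1 := by
    funext y; simp
  have f00 := congrFun e00 x
  have f11 := congrFun e11 x
  have f01 := congrFun e01 x
  constructor <;>
  simp only [e00, e11, e01, f00, f11, f01, partialDeriv_mul _ hl hU, partialDeriv_sub _ (ha _ _) hg]
  · linear_combination U x * hK.eq000 - h0
  · linear_combination U x * hK.eq111 - h1
  · linear_combination U x * hK.eq001 - h1
  · linear_combination U x * hK.eq011 - h0

/-- By the product rule `d(w V) = V dw + w dV`: the first term accounts for `V dU`, the second for
the trace subtracted from `a`. -/
theorem isScalarPartAt_stackel_iff {V W : Coord 𝕜 → 𝕜} (hU : DifferentiableAt 𝕜 U x)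
    (hw : DifferentiableAt 𝕜 w x) (hV : DifferentiableAt 𝕜 V x) (hW : DifferentiableAt 𝕜 W x)
    (hl0 : lam x ≠ 0) (hU0 : U x ≠ 0) (hs : IsScalarPartAt lam U a w x) :
    IsScalarPartAt (fun y => lam y * U y) V
      (fun y => a y - (w y / (U y * lam y)) • (1 : Matrix (Fin 2) (Fin 2) 𝕜)) W x ↔
    IsScalarPartAt lam (fun y => U y * V y) a (fun y => W y + w y * V y) x := by
  have hp (i : Fin 2) := partialDeriv_mul i hU hV
  have hq (i : Fin 2) : partialDeriv i (fun y => W y + w y * V y) x = _ :=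
    partialDeriv_add i hW (hw.fun_mul hV)
  have hr (i : Fin 2) := partialDeriv_mul i hw hV
  have h0 := hs.eq0
  have h1 := hs.eq1
  have hc : lam x * U x * (w x / (U x * lam x)) = w x := by field_simp
  constructor
  · intro h
    have g0 := h.eq0
    have g1 := h.eq1
    simp only [Matrix.sub_apply, Matrix.smul_apply, Matrix.one_apply_eq, smul_eq_mul, ne_eq,
      zero_ne_one, not_false_eq_true, Matrix.one_apply_ne, mul_zero, sub_zero, mul_one] at g0 g1
    constructor
    · rw [hp, hp, hq, hr, h0, g0]
      linear_combination -partialDeriv 0 V x * hc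
    · rw [hp, hp, hq, hr, h1, g1]
      linear_combination -partialDeriv 1 V x * hc
  · intro h
    have g0 := h.eq0
    have g1 := h.eq1
    rw [hp, hp, hq, hr, h0] at g0
    rw [hp, hp, hq, hr, h1] at g1
    constructor <;>
    simp only [Matrix.sub_apply, Matrix.smul_apply, Matrix.one_apply_eq, smul_eq_mul, ne_eq,
      zero_ne_one, not_false_eq_true, Matrix.one_apply_ne, mul_zero, sub_zero, mul_one]
    · linear_combination g0 + partialDeriv 0 V x * hc
    · linear_combination g1 + partialDeriv 1 V x * hc

open SecondOrderSystem in
theorem hasPotentialData_mul_iff {V : Coord 𝕜 → 𝕜} (hU : AnalyticAt 𝕜 U x) (hV : AnalyticAt 𝕜 V x)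
    (hU0 : U x ≠ 0) (c : Fin 4 → 𝕜) :
    HasPotentialData (fun y => U y * V y) x ![U x * c 0, U x * c 1 + c 0 * partialDeriv 0 U x,
      U x * c 2 + c 0 * partialDeriv 1 U x, U x * c 3 + 2 * (partialDeriv 0 U x * c 1)
        + c 0 * partialDeriv 0 (partialDeriv 0 U) x] ↔ HasPotentialData V x c := by
  simp only [HasPotentialData, partialDeriv_mul _ hU.differentiableAt hV.differentiableAt,
    partialDeriv_mul_mul _ _ hU hV, Matrix.cons_val_zero, Matrix.cons_val_one, Matrix.cons_val]
  constructor
  · rintro ⟨h0, h1, h2, h3⟩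
    have e0 : V x = c 0 := mul_left_cancel₀ hU0 h0
    have e1 : partialDeriv 0 V x = c 1 := mul_left_cancel₀ hU0 (by rw [e0] at h1; simpa using h1)
    have e2 : partialDeriv 1 V x = c 2 := mul_left_cancel₀ hU0 (by rw [e0] at h2; simpa using h2)
    refine ⟨e0, e1, e2, mul_left_cancel₀ hU0 ?_⟩
    rw [e0, e1] at h3
    linear_combination h3
  · rintro ⟨h0, h1, h2, h3⟩
    rw [h0, h1, h2, h3]
    exact ⟨rfl, rfl, rfl, by ring⟩

end PointwiseStackel

/-! ### Stäckel transforms of systems -/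

namespace SecondOrderSystem

variable {𝕜 : Type*} [RCLike 𝕜] {S : SecondOrderSystem 𝕜} {D N : Set (Coord 𝕜)} {x : Coord 𝕜}
  {U : Coord 𝕜 → 𝕜} {w : Fin 2 → Coord 𝕜 → 𝕜}

/-- The metric and the quadratic parts of `L₁, L₂` are analytic, and the latter are Killing
tensors. -/
structure IsKillingSystemOn (S : SecondOrderSystem 𝕜) (D : Set (Coord 𝕜)) : Prop where
  isOpen : IsOpen D
  analytic_metric : AnalyticOnNhd 𝕜 S.metric D
  metric_ne_zero : ∀ x ∈ D, S.metric x ≠ 0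
  analytic_quad : ∀ k i j, AnalyticOnNhd 𝕜 (fun x => S.quad k x i j) D
  quad_symm : ∀ k, ∀ x ∈ D, (S.quad k x).IsSymm
  killing : ∀ k, ∀ x ∈ D, IsKillingAt S.metric (S.quad k) x

theorem IsSuperintegrableOn.isKillingSystemOn (hS : S.IsSuperintegrableOn D) :
    S.IsKillingSystemOn D :=
  ⟨hS.isOpen, hS.analytic_metric, hS.metric_ne_zero, hS.analytic_quad, hS.quad_symm,
    fun k _ hx => hS.isKillingAt hx k⟩

theorem IsKillingSystemOn.poissonBracket_eq_zero_iff (hS : S.IsKillingSystemOn D) (hx : x ∈ D)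
    (k : Fin 2) {V W : Coord 𝕜 → 𝕜} (hV : DifferentiableAt 𝕜 V x) (hW : DifferentiableAt 𝕜 W x) :
    (∀ p, poissonBracket (quadraticIntegral (S.quad k) W) (hamiltonian S.metric V) (x, p) = 0) ↔
      IsScalarPartAt S.metric V (S.quad k) W x := by
  have hsym : ∀ᶠ y in 𝓝 x, (S.quad k y).IsSymm := by
    filter_upwards [hS.isOpen.mem_nhds hx] with y hy using hS.quad_symm k y hy
  rw [_root_.poissonBracket_eq_zero_iff (hS.analytic_metric x hx).differentiableAt hV
    (hS.metric_ne_zero x hx) (fun i j => (hS.analytic_quad k i j x hx).differentiableAt) hW hsym]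
  exact and_iff_right (hS.killing k x hx)

theorem IsKillingSystemOn.isAdmissiblePotentialAt_iff (hS : S.IsKillingSystemOn D) (hx : x ∈ D)
    {V : Coord 𝕜 → 𝕜} : S.IsAdmissiblePotentialAt V x ↔ AnalyticAt 𝕜 V x ∧
      ∃ W : Fin 2 → Coord 𝕜 → 𝕜, ∀ k, AnalyticAt 𝕜 (W k) x ∧
        ∀ᶠ y in 𝓝 x, IsScalarPartAt S.metric V (S.quad k) (W k) y := by
  refine and_congr_right fun hV => exists_congr fun W => forall_congr' fun k =>
    and_congr_right fun hW => ?_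
  refine eventually_congr ?_
  filter_upwards [hS.isOpen.mem_nhds hx, hV.eventually_analyticAt, hW.eventually_analyticAt]
    with y hy h1 h2
  exact hS.poissonBracket_eq_zero_iff hy k h1.differentiableAt h2.differentiableAt

theorem isScalarPartAt_congr {lam V V' W W' : Coord 𝕜 → 𝕜}
    {a : Coord 𝕜 → Matrix (Fin 2) (Fin 2) 𝕜} (hV : V =ᶠ[𝓝 x] V') (hW : W =ᶠ[𝓝 x] W') :
    IsScalarPartAt lam V a W x ↔ IsScalarPartAt lam V' a W' x := by
  have h1 (i : Fin 2) := (hV.partialDeriv i).eq_of_nhds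
  have h2 (i : Fin 2) := (hW.partialDeriv i).eq_of_nhds
  constructor
  · rintro ⟨h, h'⟩
    exact ⟨by rw [← h1, ← h1, ← h2]; exact h, by rw [← h1, ← h1, ← h2]; exact h'⟩
  · rintro ⟨h, h'⟩
    exact ⟨by rw [h1, h1, h2]; exact h, by rw [h1, h1, h2]; exact h'⟩

theorem IsKillingSystemOn.isAdmissiblePotentialAt_congr (hS : S.IsKillingSystemOn D) (hx : x ∈ D)
    {V V' : Coord 𝕜 → 𝕜} (h : V =ᶠ[𝓝 x] V') (hV : S.IsAdmissiblePotentialAt V x) :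
    S.IsAdmissiblePotentialAt V' x := by
  rw [hS.isAdmissiblePotentialAt_iff hx] at hV ⊢
  obtain ⟨h1, W, hW⟩ := hV
  refine ⟨h1.congr h, W, fun k => ⟨(hW k).1, ?_⟩⟩
  filter_upwards [(hW k).2, h.eventually_nhds] with y hy h2
  exact (isScalarPartAt_congr h2 EventuallyEq.rfl).1 hy

-- The transform alters the tensors by multiples of the identity only; hence everything built from
-- the traceless parts is invariant.
@[simp]
theorem quadDiff_stackelTransform (k : Fin 2) :
    (S.stackelTransform U w).quadDiff k = S.quadDiff k := by
  funext y
  simp [quadDiff, stackelTransform]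

@[simp]
theorem quadCross_stackelTransform (k : Fin 2) :
    (S.stackelTransform U w).quadCross k = S.quadCross k := by
  funext y
  simp [quadCross, stackelTransform]

@[simp]
theorem disc_stackelTransform : (S.stackelTransform U w).disc = S.disc := by
  funext y
  simp [disc]

@[simp]
theorem wronskRe_stackelTransform : (S.stackelTransform U w).wronskRe = S.wronskRe := by
  funext y
  simp [wronskRe]

@[simp]
theorem wronskIm_stackelTransform : (S.stackelTransform U w).wronskIm = S.wronskIm := by
  funext y
  simp [wronskIm]

namespace IsStackelMultiplierOn

theorem isOpen_setOf_ne_zero (hU : S.IsStackelMultiplierOn N U w) (hN : IsOpen N) :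
    IsOpen {x | x ∈ N ∧ U x ≠ 0} :=
  hU.analytic_multiplier.continuousOn.isOpen_inter_preimage hN isOpen_compl_singleton

theorem isScalarPartAt (hU : S.IsStackelMultiplierOn N U w) (hS : S.IsKillingSystemOn D)
    (hND : N ⊆ D) (hx : x ∈ N) (k : Fin 2) : IsScalarPartAt S.metric U (S.quad k) (w k) x :=
  (hS.poissonBracket_eq_zero_iff (hND hx) k (hU.analytic_multiplier x hx).differentiableAt
    (hU.analytic_scalar k x hx).differentiableAt).1 (hU.constant_of_motion k x hx)

theorem isKillingSystemOn (hU : S.IsStackelMultiplierOn N U w) (hS : S.IsKillingSystemOn D)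
    (hN : IsOpen N) (hND : N ⊆ D) :
    (S.stackelTransform U w).IsKillingSystemOn {x | x ∈ N ∧ U x ≠ 0} where
  isOpen := hU.isOpen_setOf_ne_zero hN
  analytic_metric := fun x hx =>
    (hS.analytic_metric x (hND hx.1)).mul (hU.analytic_multiplier x hx.1)
  metric_ne_zero := fun x hx => mul_ne_zero (hS.metric_ne_zero x (hND hx.1)) hx.2
  analytic_quad := fun k i j x hx => by
    have h := (hS.analytic_quad k i j x (hND hx.1)).sub
      (((hU.analytic_scalar k x hx.1).div ((hU.analytic_multiplier x hx.1).mul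
        (hS.analytic_metric x (hND hx.1)))
        (mul_ne_zero hx.2 (hS.metric_ne_zero x (hND hx.1)))).mul
        (analyticAt_const (v := (1 : Matrix (Fin 2) (Fin 2) 𝕜) i j)))
    exact h
  quad_symm := fun k x hx => (hS.quad_symm k x (hND hx.1)).sub (Matrix.isSymm_one.smul _)
  killing := fun k x hx => (hS.killing k x (hND hx.1)).stackel
    (hS.analytic_metric x (hND hx.1)).differentiableAt
    (hU.analytic_multiplier x hx.1).differentiableAt
    (hU.analytic_scalar k x hx.1).differentiableAt
    (fun i j => (hS.analytic_quad k i j x (hND hx.1)).differentiableAt)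
    (hS.metric_ne_zero x (hND hx.1)) hx.2 (hU.isScalarPartAt hS hND hx.1 k)

theorem isScalarPartAt_iff (hU : S.IsStackelMultiplierOn N U w) (hS : S.IsKillingSystemOn D)
    (hND : N ⊆ D) (hx : x ∈ N) (hx0 : U x ≠ 0) (k : Fin 2) {V W : Coord 𝕜 → 𝕜}
    (hV : DifferentiableAt 𝕜 V x) (hW : DifferentiableAt 𝕜 W x) :
    IsScalarPartAt (S.stackelTransform U w).metric V ((S.stackelTransform U w).quad k) W x ↔
      IsScalarPartAt S.metric (fun y => U y * V y) (S.quad k) (fun y => W y + w k y * V y) x :=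
  isScalarPartAt_stackel_iff (hU.analytic_multiplier x hx).differentiableAt
    (hU.analytic_scalar k x hx).differentiableAt hV hW (hS.metric_ne_zero x (hND hx)) hx0
    (hU.isScalarPartAt hS hND hx k)

theorem isAdmissiblePotentialAt_iff (hU : S.IsStackelMultiplierOn N U w)
    (hS : S.IsKillingSystemOn D) (hN : IsOpen N) (hND : N ⊆ D) (hx : x ∈ N) (hx0 : U x ≠ 0)
    {V : Coord 𝕜 → 𝕜} (hV : AnalyticAt 𝕜 V x) :
    (S.stackelTransform U w).IsAdmissiblePotentialAt V x ↔
      S.IsAdmissiblePotentialAt (fun y => U y * V y) x := by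
  rw [(hU.isKillingSystemOn hS hN hND).isAdmissiblePotentialAt_iff ⟨hx, hx0⟩,
    hS.isAdmissiblePotentialAt_iff (hND hx)]
  have hUa := hU.analytic_multiplier x hx
  constructor
  · rintro ⟨-, W, hW⟩
    refine ⟨hUa.mul hV, fun k y => W k y + w k y * V y, fun k =>
      ⟨(hW k).1.add ((hU.analytic_scalar k x hx).mul hV), ?_⟩⟩
    filter_upwards [(hW k).2, hV.eventually_analyticAt, (hW k).1.eventually_analyticAt,
      hN.mem_nhds hx, hUa.continuousAt.eventually_ne hx0] with y h1 h2 h3 h4 h5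
    exact (hU.isScalarPartAt_iff hS hND h4 h5 k h2.differentiableAt h3.differentiableAt).1 h1
  · rintro ⟨-, W, hW⟩
    have ha (k : Fin 2) : AnalyticAt 𝕜 (fun y => W k y - w k y * V y) x :=
      (hW k).1.sub ((hU.analytic_scalar k x hx).mul hV)
    refine ⟨hV, fun k y => W k y - w k y * V y, fun k => ⟨ha k, ?_⟩⟩
    filter_upwards [(hW k).2, hV.eventually_analyticAt, (ha k).eventually_analyticAt,
      hN.mem_nhds hx, hUa.continuousAt.eventually_ne hx0] with y h1 h2 h3 h4 h5
    rw [hU.isScalarPartAt_iff hS hND h4 h5 k h2.differentiableAt h3.differentiableAt]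
    simpa only [sub_add_cancel] using h1

/-- Multiplication by `U ≠ 0` is a bijection from the admissible germs of the transform to those of
the original system, and acts on the four initial values by an invertible triangular map. -/
theorem isNondegenerateOn (hU : S.IsStackelMultiplierOn N U w) (hS : S.IsSuperintegrableOn D)
    (hnd : S.IsNondegenerateOn D) (hN : IsOpen N) (hND : N ⊆ D) :
    (S.stackelTransform U w).IsNondegenerateOn {x | x ∈ N ∧ U x ≠ 0} := by
  have hK := hU.isKillingSystemOn hS.isKillingSystemOn hN hND
  constructor
  · intro x hx
    refine (linearIndependent_forms_iff (hK.metric_ne_zero x hx)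
      fun k => hK.quad_symm k x hx).2 ?_
    rw [disc_stackelTransform]
    exact hnd.disc_ne_zero hS (hND hx.1)
  · rintro x ⟨hx, hx0⟩ c
    have hUa := hU.analytic_multiplier x hx
    obtain ⟨V, hV, hVc, huniq⟩ := hnd.2 x (hND hx) ![U x * c 0,
      U x * c 1 + c 0 * partialDeriv 0 U x, U x * c 2 + c 0 * partialDeriv 1 U x,
      U x * c 3 + 2 * (partialDeriv 0 U x * c 1) + c 0 * partialDeriv 0 (partialDeriv 0 U) x]
    have ha : AnalyticAt 𝕜 (fun y => V y / U y) x := hV.1.div hUa hx0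
    have hne := hUa.continuousAt.eventually_ne hx0
    have he : V =ᶠ[𝓝 x] fun y => U y * (V y / U y) :=
      hne.mono fun y hy => (mul_div_cancel₀ _ hy).symm
    refine ⟨fun y => V y / U y, ?_, ?_, fun V' hV' hc => ?_⟩
    · rw [hU.isAdmissiblePotentialAt_iff hS.isKillingSystemOn hN hND hx hx0 ha]
      exact hS.isKillingSystemOn.isAdmissiblePotentialAt_congr (hND hx) he hV
    · rw [← hasPotentialData_mul_iff hUa ha hx0]
      have h1 (i : Fin 2) := he.partialDeriv i
      obtain ⟨d0, d1, d2, d3⟩ := hVc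
      exact ⟨he.eq_of_nhds.symm.trans d0, (h1 0).eq_of_nhds.symm.trans d1,
        (h1 1).eq_of_nhds.symm.trans d2, ((h1 0).partialDeriv 0).eq_of_nhds.symm.trans d3⟩
    · have := huniq _ ((hU.isAdmissiblePotentialAt_iff hS.isKillingSystemOn hN hND hx hx0 hV'.1).1
        hV') ((hasPotentialData_mul_iff hUa hV'.1 hx0 c).2 hc)
      filter_upwards [this, hne] with y h1 h2
      rw [← h1, mul_div_cancel_left₀ _ h2]

theorem isSuperintegrableOn (hU : S.IsStackelMultiplierOn N U w) (hS : S.IsSuperintegrableOn D)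
    (hN : IsOpen N) (hND : N ⊆ D)
    (hfi : {x | x ∈ N ∧ U x ≠ 0} ×ˢ (Set.univ : Set (Coord 𝕜)) ⊆
      closure {z | z.1 ∈ {x | x ∈ N ∧ U x ≠ 0} ∧ LinearIndependent 𝕜
        ![fderiv 𝕜 (S.stackelTransform U w).ham z, fderiv 𝕜 ((S.stackelTransform U w).integral 0) z,
          fderiv 𝕜 ((S.stackelTransform U w).integral 1) z]}) :
    (S.stackelTransform U w).IsSuperintegrableOn {x | x ∈ N ∧ U x ≠ 0} := by
  have hK := hU.isKillingSystemOn hS.isKillingSystemOn hN hND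
  have hpot : AnalyticOnNhd 𝕜 (S.stackelTransform U w).potential {x | x ∈ N ∧ U x ≠ 0} :=
    fun x hx => (hS.analytic_potential x (hND hx.1)).div (hU.analytic_multiplier x hx.1) hx.2
  have hsc : ∀ k, AnalyticOnNhd 𝕜 ((S.stackelTransform U w).scalar k) {x | x ∈ N ∧ U x ≠ 0} :=
    fun k x hx => (hS.analytic_scalar k x (hND hx.1)).sub
      (((hU.analytic_scalar k x hx.1).div (hU.analytic_multiplier x hx.1) hx.2).mul
        (hS.analytic_potential x (hND hx.1)))
  refine ⟨hK.isOpen, hK.analytic_metric, hK.metric_ne_zero, hpot, hK.analytic_quad, hK.quad_symm,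
    hsc, fun k x hx => ?_, hfi⟩
  refine (hK.poissonBracket_eq_zero_iff hx k (hpot x hx).differentiableAt
    (hsc k x hx).differentiableAt).2 ?_
  rw [hU.isScalarPartAt_iff hS.isKillingSystemOn hND hx.1 hx.2 k (hpot x hx).differentiableAt
    (hsc k x hx).differentiableAt]
  have hne : ∀ᶠ y in 𝓝 x, U y ≠ 0 :=
    (hU.analytic_multiplier x hx.1).continuousAt.eventually_ne hx.2
  refine (isScalarPartAt_congr (hne.mono fun y hy => ?_) (hne.mono fun y hy => ?_)).1
    ((hS.isKillingSystemOn.poissonBracket_eq_zero_iff (hND hx.1) k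
      (hS.analytic_potential x (hND hx.1)).differentiableAt
      (hS.analytic_scalar k x (hND hx.1)).differentiableAt).1
      (hS.constant_of_motion k x (hND hx.1)))
  · exact (mul_div_cancel₀ _ hy).symm
  · simp only [stackelTransform]
    ring

end IsStackelMultiplierOn

end SecondOrderSystem

/-- The left side is `μ² Δ log μ`, so the curvature is `-c / 2`. -/
theorem hasConstantCurvatureOn_of_eq {𝕜 : Type*} [RCLike 𝕜] {μ : Coord 𝕜 → 𝕜}
    {M : Set (Coord 𝕜)} (c : 𝕜) (h0 : ∀ x ∈ M, μ x ≠ 0)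
    (h : ∀ x ∈ M, μ x * (partialDeriv 0 (partialDeriv 0 μ) x + partialDeriv 1 (partialDeriv 1 μ) x)
      - (partialDeriv 0 μ x ^ 2 + partialDeriv 1 μ x ^ 2) = c * μ x ^ 3) :
    HasConstantCurvatureOn μ M := by
  refine ⟨-c / 2, fun x hx => ?_⟩
  have h1 := h0 x hx
  have h2 := h x hx
  simp only [gaussianCurvature, Fin.sum_univ_two]
  field_simp
  linear_combination -h2

/-! ### Functional independence through a Jacobian minor -/

section Minor

variable {𝕜 : Type*} [RCLike 𝕜]

theorem linearIndependent_of_det_ne_zero {E : Type*} [NormedAddCommGroup E] [NormedSpace 𝕜 E]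
    {n : ℕ} {f : Fin n → E →L[𝕜] 𝕜} (e : Fin n → E)
    (h : (Matrix.of fun i j => f i (e j)).det ≠ 0) : LinearIndependent 𝕜 f := by
  let ev : (E →L[𝕜] 𝕜) →ₗ[𝕜] (Fin n → 𝕜) :=
    { toFun := fun g j => g (e j), map_add' := fun _ _ => rfl, map_smul' := fun _ _ => rfl }
  exact LinearIndependent.of_comp ev (Matrix.linearIndependent_rows_of_det_ne_zero h)

/-- Doubling the momenta separates the quartic from the quadratic part; a binary quartic is
determined by its values at five directions. -/
theorem coeff_eq_zero_of_quartic_add_quadratic {c₀ c₁ c₂ c₃ c₄ d₀ d₁ d₂ : 𝕜}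
    (h : ∀ p : Coord 𝕜, c₀ * p 0 ^ 4 + c₁ * (p 0 ^ 3 * p 1) + c₂ * (p 0 ^ 2 * p 1 ^ 2)
      + c₃ * (p 0 * p 1 ^ 3) + c₄ * p 1 ^ 4 + (d₀ * p 0 ^ 2 + d₁ * (p 0 * p 1) + d₂ * p 1 ^ 2) = 0) :
    c₀ = 0 ∧ c₁ = 0 ∧ c₂ = 0 ∧ c₃ = 0 ∧ c₄ = 0 := by
  have key : ∀ s t : 𝕜, c₀ * s ^ 4 + c₁ * (s ^ 3 * t) + c₂ * (s ^ 2 * t ^ 2) + c₃ * (s * t ^ 3)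
      + c₄ * t ^ 4 = 0 := by
    intro s t
    have e1 := h ![s, t]
    have e2 := h ![2 * s, 2 * t]
    simp only [Matrix.cons_val_zero, Matrix.cons_val_one] at e1 e2
    linear_combination (1 / 12) * e2 - (1 / 3) * e1
  have e1 := key 1 0
  have e2 := key 0 1
  have e3 := key 1 1
  have e4 := key 1 (-1)
  have e5 := key 2 1
  refine ⟨?_, ?_, ?_, ?_, ?_⟩
  · linear_combination e1
  · linear_combination (1 / 6) * e5 - (1 / 3) * (e3 + e4) - 2 * e1 + (1 / 2) * e2 - (1 / 6) * (e3 - e4)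
  · linear_combination (1 / 2) * (e3 + e4) - e1 - e2
  · linear_combination (2 / 3) * (e3 - e4) - (1 / 6) * e5 + (1 / 3) * (e3 + e4) + 2 * e1 - (1 / 2) * e2
  · linear_combination e2

/-- A minor of the Jacobian of `H, L₁, L₂` vanishing at all momenta forces the Wronskians of the
traceless parts and a derivative of the traces to vanish. -/
theorem wronskian_eq_zero_of_minor {l l₀ v : 𝕜} {a b c a₀ b₀ c₀ s : Fin 2 → 𝕜} (hl : l ≠ 0)
    (hd : (b 0 + b 0) * (a 1 - c 1) - (b 1 + b 1) * (a 0 - c 0) ≠ 0)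
    (h : ∀ p : Coord 𝕜, (!![2 * p 0 / l, 2 * p 1 / l, -((p 0 ^ 2 + p 1 ^ 2) * l₀ / l ^ 2) + v;
      2 * (a 0 * p 0 + b 0 * p 1), 2 * (b 0 * p 0 + c 0 * p 1),
        a₀ 0 * p 0 ^ 2 + 2 * b₀ 0 * p 0 * p 1 + c₀ 0 * p 1 ^ 2 + s 0;
      2 * (a 1 * p 0 + b 1 * p 1), 2 * (b 1 * p 0 + c 1 * p 1),
        a₀ 1 * p 0 ^ 2 + 2 * b₀ 1 * p 0 * p 1 + c₀ 1 * p 1 ^ 2 + s 1]).det = 0) :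
    (∀ k, l * (a₀ k + c₀ k) + l₀ * (a k + c k) = 0) ∧
    (a₀ 0 - c₀ 0) * (a 1 - c 1) - (b₀ 0 + b₀ 0) * (b 1 + b 1) - (a 0 - c 0) * (a₀ 1 - c₀ 1)
      + (b 0 + b 0) * (b₀ 1 + b₀ 1) = 0 ∧
    (a₀ 0 - c₀ 0) * (b 1 + b 1) + (b₀ 0 + b₀ 0) * (a 1 - c 1) - (a 0 - c 0) * (b₀ 1 + b₀ 1)
      - (b 0 + b 0) * (a₀ 1 - c₀ 1) = 0 := by
  obtain ⟨Q, hQ⟩ : ∃ Q : Fin 2 → 𝕜, ∀ k, Q k = a k - c k := ⟨_, fun _ => rfl⟩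
  obtain ⟨P, hP⟩ : ∃ P : Fin 2 → 𝕜, ∀ k, P k = b k + b k := ⟨_, fun _ => rfl⟩
  obtain ⟨q, hq⟩ : ∃ q : Fin 2 → 𝕜, ∀ k, q k = a₀ k - c₀ k := ⟨_, fun _ => rfl⟩
  obtain ⟨r, hr⟩ : ∃ r : Fin 2 → 𝕜, ∀ k, r k = b₀ k + b₀ k := ⟨_, fun _ => rfl⟩
  -- Subtracting `l (a k + c k) / 2` times the row of `H` leaves the traceless parts in the momentum
  -- columns. In the last column the trace then survives only through `S k`, the derivative of `λ tr
  -- a_k`, and through the momentum-free term `κ k`.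
  obtain ⟨S, hS⟩ : ∃ S : Fin 2 → 𝕜, ∀ k, S k = l * (a₀ k + c₀ k) + l₀ * (a k + c k) :=
    ⟨_, fun _ => rfl⟩
  obtain ⟨κ, hκ⟩ : ∃ κ : Fin 2 → 𝕜, ∀ k, κ k = s k - l * (a k + c k) * v / 2 := ⟨_, fun _ => rfl⟩
  simp only [← hQ, ← hP, ← hq, ← hr, ← hS] at hd ⊢
  obtain ⟨e0, e1, e2, e3, e4⟩ := coeff_eq_zero_of_quartic_add_quadratic
    (c₀ := l₀ * (P 0 * Q 1 - P 1 * Q 0) + l * (P 0 * q 1 - P 1 * q 0) + (P 0 * S 1 - P 1 * S 0))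
    (c₁ := 2 * l * (P 0 * r 1 - Q 0 * q 1 - P 1 * r 0 + Q 1 * q 0) - 2 * (Q 0 * S 1 - Q 1 * S 0))
    (c₂ := -2 * (l₀ * (P 0 * Q 1 - P 1 * Q 0) + l * (P 0 * q 1 - P 1 * q 0))
      + 4 * (l₀ * (P 0 * Q 1 - P 1 * Q 0) + l * (Q 1 * r 0 - Q 0 * r 1)))
    (c₃ := -2 * l * (P 0 * r 1 - Q 0 * q 1 - P 1 * r 0 + Q 1 * q 0) - 2 * (Q 0 * S 1 - Q 1 * S 0))
    (c₄ := l₀ * (P 0 * Q 1 - P 1 * Q 0) + l * (P 0 * q 1 - P 1 * q 0) - (P 0 * S 1 - P 1 * S 0))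
    (d₀ := -v * l ^ 2 * (P 0 * Q 1 - P 1 * Q 0) + 2 * l * (P 0 * κ 1 - P 1 * κ 0))
    (d₁ := 4 * l * (Q 1 * κ 0 - Q 0 * κ 1))
    (d₂ := -v * l ^ 2 * (P 0 * Q 1 - P 1 * Q 0) - 2 * l * (P 0 * κ 1 - P 1 * κ 0)) fun p => by
      have hp := congrArg (fun t => l ^ 2 * t) (h p)
      simp only [Matrix.det_fin_three, Matrix.of_apply, Matrix.cons_val', Matrix.cons_val_zero,
        Matrix.cons_val_one, Matrix.cons_val, mul_zero] at hp
      rw [← hp]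
      simp only [hQ, hP, hq, hr, hS, hκ]
      field_simp
      ring
  have f1 : P 0 * S 1 - P 1 * S 0 = 0 := by linear_combination (e0 - e4) / 2
  have f2 : Q 0 * S 1 - Q 1 * S 0 = 0 := by linear_combination -(e1 + e3) / 4
  -- `f1` and `f2` make the vector `S` parallel to both `P` and `Q`, which are independent by `hd`;
  -- the Wronskian comes from the remaining quartic coefficients.
  refine ⟨?_, mul_left_cancel₀ hl ?_, mul_left_cancel₀ hl ?_⟩
  · intro k
    refine mul_left_cancel₀ hd ?_
    fin_cases k
    · simp only [Fin.zero_eta, Fin.isValue]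
      linear_combination Q 0 * f1 - P 0 * f2
    · simp only [Fin.mk_one, Fin.isValue]
      linear_combination Q 1 * f1 - P 1 * f2
  · linear_combination (e1 - e3) / 4
  · linear_combination -((e0 + e4) / 2 - (e2 + (e0 + e4)) / 4)

end Minor

theorem AnalyticAt.matrix_det {𝕜 E : Type*} [NontriviallyNormedField 𝕜] [NormedAddCommGroup E]
    [NormedSpace 𝕜 E] {n : ℕ} {A : E → Matrix (Fin n) (Fin n) 𝕜} {x : E}
    (hA : ∀ i j, AnalyticAt 𝕜 (fun y => A y i j) x) : AnalyticAt 𝕜 (fun y => (A y).det) x := by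
  simp only [Matrix.det_apply']
  exact Finset.analyticAt_fun_sum _ fun σ _ => analyticAt_const.mul
    (Finset.analyticAt_fun_prod _ fun i _ => hA (σ i) i)

namespace SecondOrderSystem

variable {𝕜 : Type*} [RCLike 𝕜] {S : SecondOrderSystem 𝕜} {M : Set (Coord 𝕜)} {x : Coord 𝕜}

/-- For fixed `x` the minor in the directions `p₁, p₂, x₁` is a polynomial in the momenta. Were it
zero near some `p`, it would be zero for all momenta, contradicting `hgood`. -/
theorem mem_closure_setOf_linearIndependent (hS : S.IsKillingSystemOn M) (hx : x ∈ M)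
    (hV : DifferentiableAt 𝕜 S.potential x) (hW : ∀ k, DifferentiableAt 𝕜 (S.scalar k) x)
    (hd : S.disc x ≠ 0) (hgood : S.wronskRe x ≠ 0 ∨ S.wronskIm x ≠ 0 ∨
      ∃ k, partialDeriv 0 (fun y => S.metric y * (S.quad k y 0 0 + S.quad k y 1 1)) x ≠ 0)
    (p : Coord 𝕜) : p ∈ closure {p | LinearIndependent 𝕜
      ![fderiv 𝕜 S.ham (x, p), fderiv 𝕜 (S.integral 0) (x, p), fderiv 𝕜 (S.integral 1) (x, p)]} := by
  have hl := (hS.analytic_metric x hx).differentiableAt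
  have hl0 := hS.metric_ne_zero x hx
  have ha (k i j : Fin 2) := (hS.analytic_quad k i j x hx).differentiableAt
  set m : Coord 𝕜 → 𝕜 := fun p => (!![2 * p 0 / S.metric x, 2 * p 1 / S.metric x,
      -((p 0 ^ 2 + p 1 ^ 2) * partialDeriv 0 S.metric x / S.metric x ^ 2)
        + partialDeriv 0 S.potential x;
      2 * (S.quad 0 x 0 0 * p 0 + S.quad 0 x 0 1 * p 1),
        2 * (S.quad 0 x 0 1 * p 0 + S.quad 0 x 1 1 * p 1),
        partialDeriv 0 (fun y => S.quad 0 y 0 0) x * p 0 ^ 2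
          + 2 * partialDeriv 0 (fun y => S.quad 0 y 0 1) x * p 0 * p 1
          + partialDeriv 0 (fun y => S.quad 0 y 1 1) x * p 1 ^ 2 + partialDeriv 0 (S.scalar 0) x;
      2 * (S.quad 1 x 0 0 * p 0 + S.quad 1 x 0 1 * p 1),
        2 * (S.quad 1 x 0 1 * p 0 + S.quad 1 x 1 1 * p 1),
        partialDeriv 0 (fun y => S.quad 1 y 0 0) x * p 0 ^ 2
          + 2 * partialDeriv 0 (fun y => S.quad 1 y 0 1) x * p 0 * p 1
          + partialDeriv 0 (fun y => S.quad 1 y 1 1) x * p 1 ^ 2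
          + partialDeriv 0 (S.scalar 1) x]).det with hm
  have hind : ∀ q, m q ≠ 0 → LinearIndependent 𝕜
      ![fderiv 𝕜 S.ham (x, q), fderiv 𝕜 (S.integral 0) (x, q), fderiv 𝕜 (S.integral 1) (x, q)] := by
    intro q hq
    refine linearIndependent_of_det_ne_zero
      ![(0, Pi.single 0 1), (0, Pi.single 1 1), (Pi.single 0 1, 0)] ?_
    refine fun h0 => hq (Eq.trans (congrArg Matrix.det ?_) h0)
    have h10 (k : Fin 2) : (fun y => S.quad k y 1 0) =ᶠ[𝓝 x] fun y => S.quad k y 0 1 := by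
      filter_upwards [hS.isOpen.mem_nhds hx] with y hy using (hS.quad_symm k y hy).apply 0 1
    have hH (v w : Coord 𝕜) := fderiv_hamiltonian hl hV hl0 q v w
    have hL (k : Fin 2) (v w : Coord 𝕜) := fderiv_quadraticIntegral (ha k) (hW k) q v w
    ext i j
    fin_cases i <;> fin_cases j <;>
    simp [ham, integral, hH, hL, Fin.sum_univ_two, (h10 _).fderiv_eq, (h10 _).eq_of_nhds,
      partialDeriv] <;> ring
  have han : AnalyticOnNhd 𝕜 m Set.univ := by
    intro q _
    have hp (i : Fin 2) : AnalyticAt 𝕜 (fun p : Coord 𝕜 => p i) q :=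
      (ContinuousLinearMap.proj i : Coord 𝕜 →L[𝕜] 𝕜).analyticAt q
    have h0 := hp 0
    have h1 := hp 1
    refine AnalyticAt.matrix_det fun i j => ?_
    fin_cases i <;> fin_cases j <;>
    simp only [Fin.zero_eta, Fin.mk_one, Fin.reduceFinMk, Matrix.of_apply, Matrix.cons_val',
      Matrix.cons_val_zero, Matrix.cons_val_one, Matrix.cons_val, div_eq_mul_inv]
    · exact (analyticAt_const.mul h0).mul analyticAt_const
    · exact (analyticAt_const.mul h1).mul analyticAt_const
    · exact (((((h0.pow 2).add (h1.pow 2)).mul analyticAt_const).mul analyticAt_const).neg).add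
        analyticAt_const
    · exact analyticAt_const.mul ((analyticAt_const.mul h0).add (analyticAt_const.mul h1))
    · exact analyticAt_const.mul ((analyticAt_const.mul h0).add (analyticAt_const.mul h1))
    · exact (((analyticAt_const.mul (h0.pow 2)).add ((analyticAt_const.mul h0).mul h1)).add
        (analyticAt_const.mul (h1.pow 2))).add analyticAt_const
    · exact analyticAt_const.mul ((analyticAt_const.mul h0).add (analyticAt_const.mul h1))
    · exact analyticAt_const.mul ((analyticAt_const.mul h0).add (analyticAt_const.mul h1))
    · exact (((analyticAt_const.mul (h0.pow 2)).add ((analyticAt_const.mul h0).mul h1)).add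
        (analyticAt_const.mul (h1.pow 2))).add analyticAt_const
  by_contra hp
  have hzero : m =ᶠ[𝓝 p] 0 := by
    rw [mem_closure_iff_frequently, not_frequently] at hp
    filter_upwards [hp] with q hq
    by_contra h
    exact hq (hind q h)
  have hall := han.eqOn_zero_of_preconnected_of_eventuallyEq_zero isPreconnected_univ
    (Set.mem_univ p) hzero
  obtain ⟨h1, h2, h3⟩ := wronskian_eq_zero_of_minor
    (a := fun k => S.quad k x 0 0) (b := fun k => S.quad k x 0 1) (c := fun k => S.quad k x 1 1)
    (a₀ := fun k => partialDeriv 0 (fun y => S.quad k y 0 0) x)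
    (b₀ := fun k => partialDeriv 0 (fun y => S.quad k y 0 1) x)
    (c₀ := fun k => partialDeriv 0 (fun y => S.quad k y 1 1) x)
    (s := fun k => partialDeriv 0 (S.scalar k) x) hl0 hd fun q => hall (Set.mem_univ q)
  have hQ (k : Fin 2) : partialDeriv 0 (S.quadDiff k) x = _ := partialDeriv_sub 0 (ha k 0 0) (ha k 1 1)
  have hP (k : Fin 2) : partialDeriv 0 (S.quadCross k) x = _ := partialDeriv_add 0 (ha k 0 1) (ha k 0 1)
  rcases hgood with h | h | ⟨k, h⟩
  · refine h ?_
    rw [wronskRe, hQ, hQ, hP, hP]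
    exact h2
  · refine h ?_
    rw [wronskIm, hQ, hQ, hP, hP]
    exact h3
  · refine h ?_
    rw [partialDeriv_mul 0 hl ((ha k 0 0).fun_add (ha k 1 1)), partialDeriv_add 0 (ha k 0 0) (ha k 1 1)]
    linear_combination h1 k

theorem functionally_independent_of_dense {G : Set (Coord 𝕜)} (hGM : G ⊆ M) (hG : M ⊆ closure G)
    (h : ∀ x ∈ G, ∀ p, p ∈ closure {p | LinearIndependent 𝕜
      ![fderiv 𝕜 S.ham (x, p), fderiv 𝕜 (S.integral 0) (x, p), fderiv 𝕜 (S.integral 1) (x, p)]}) :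
    M ×ˢ (Set.univ : Set (Coord 𝕜)) ⊆ closure {z | z.1 ∈ M ∧ LinearIndependent 𝕜
      ![fderiv 𝕜 S.ham z, fderiv 𝕜 (S.integral 0) z, fderiv 𝕜 (S.integral 1) z]} := by
  rintro ⟨x, p⟩ ⟨hx, -⟩
  rw [mem_closure_iff_nhds]
  intro t ht
  obtain ⟨u, hu, v, hv, huv⟩ := mem_nhds_prod_iff.1 ht
  obtain ⟨y, hyu, hyG⟩ := mem_closure_iff_nhds.1 (hG hx) u hu
  obtain ⟨q, hqv, hq⟩ := mem_closure_iff_nhds.1 (h y hyG p) v hv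
  exact ⟨(y, q), huv ⟨hyu, hqv⟩, hGM hyG, hq⟩

end SecondOrderSystem

/-! ### Zeros of analytic germs and uniqueness in null coordinates -/

section FrequentlyNonzero

variable {𝕜 : Type*} [RCLike 𝕜] {f g : Coord 𝕜 → 𝕜} {x : Coord 𝕜}

theorem AnalyticAt.eventually_frequently_ne_zero (hf : AnalyticAt 𝕜 f x)
    (h : ∃ᶠ z in 𝓝 x, f z ≠ 0) : ∀ᶠ y in 𝓝 x, ∃ᶠ z in 𝓝 y, f z ≠ 0 := by
  obtain ⟨r, hr, hball⟩ := Metric.eventually_nhds_iff_ball.1 hf.eventually_analyticAt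
  filter_upwards [Metric.ball_mem_nhds x hr] with y hy hy0
  refine h ?_
  have hz : f =ᶠ[𝓝 y] 0 := hy0.mono fun z hz => not_not.1 hz
  have hE := AnalyticOnNhd.eqOn_zero_of_preconnected_of_eventuallyEq_zero (f := f) hball
    (convex_ball x r).isPreconnected hy hz
  filter_upwards [Metric.ball_mem_nhds x hr] with z hz using not_not.2 (hE hz)

/-- Analytic germs form an integral domain. This lets `X² + Y² = 0` be split into null factors over
`ℂ`. -/
theorem AnalyticAt.eventually_eq_zero_or_of_mul (hf : AnalyticAt 𝕜 f x) (hg : AnalyticAt 𝕜 g x)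
    (h : ∀ᶠ y in 𝓝 x, f y * g y = 0) : (∀ᶠ y in 𝓝 x, f y = 0) ∨ ∀ᶠ y in 𝓝 x, g y = 0 := by
  by_contra! hne
  have h1 : ∃ᶠ y in 𝓝 x, f y ≠ 0 := hne.1
  have h2 : ∃ᶠ y in 𝓝 x, g y ≠ 0 := hne.2
  obtain ⟨y, hy, hfy, hgy, h0⟩ := (h2.and_eventually ((hf.eventually_frequently_ne_zero h1).and
    (hg.eventually_analyticAt.and h.eventually_nhds))).exists
  obtain ⟨z, hz, hgz, hz0⟩ :=
    (hfy.and_eventually ((hgy.continuousAt.eventually_ne hy).and h0)).exists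
  exact mul_ne_zero hz hgz hz0

/-- Each partial derivative is a combination of `∂₁ - i∂₂` and `∂₁ + i∂₂`, so the hypotheses form a
total linear system for `F` and `G`. -/
theorem eventually_eq_zero_of_null_system {F G α β : Coord 𝕜 → 𝕜} {i : 𝕜} (hi : i * i = -1)
    (hF : AnalyticAt 𝕜 F x) (hG : AnalyticAt 𝕜 G x) (hα : ContinuousAt α x) (hβ : ContinuousAt β x)
    (h : ∀ᶠ y in 𝓝 x, partialDeriv 0 F y + i * partialDeriv 1 F y = 0 ∧
      partialDeriv 0 F y - i * partialDeriv 1 F y = G y ∧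
      partialDeriv 0 G y + i * partialDeriv 1 G y = 0 ∧
      partialDeriv 0 G y - i * partialDeriv 1 G y = α y * G y + β y * F y)
    (hF0 : F x = 0) (hG0 : G x = 0) : ∀ᶠ y in 𝓝 x, F y = 0 ∧ G y = 0 := by
  have key := eventually_eq_zero_of_linear_system ![F, G]
    (fun a j k y => (if a = 0 then 1 else i) * ((1 / 2) * !![0, 1; β y, α y] j k))
    (x₀ := x) ?_ ?_ ?_ ?_
  · filter_upwards [key] with y hy using ⟨hy 0, hy 1⟩
  · intro a j k
    refine continuousAt_const.mul (continuousAt_const.mul ?_)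
    fin_cases j <;> fin_cases k
    exacts [continuousAt_const, continuousAt_const, hβ, hα]
  · filter_upwards [hF.eventually_analyticAt, hG.eventually_analyticAt] with y h1 h2 j
    fin_cases j
    exacts [h1.differentiableAt, h2.differentiableAt]
  · filter_upwards [h] with y ⟨h1, h2, h3, h4⟩ a j
    fin_cases a <;> fin_cases j <;> simp [Fin.sum_univ_two]
    · linear_combination (1 / 2) * (h1 + h2)
    · linear_combination (1 / 2) * (h3 + h4)
    · linear_combination (-i / 2) * (h1 - h2) + partialDeriv 1 F y * hi
    · linear_combination (-i / 2) * (h3 - h4) + partialDeriv 1 G y * hi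
  · intro j
    fin_cases j
    exacts [hF0, hG0]

end FrequentlyNonzero

/-! ### From a suitable admissible potential to the conclusion -/

namespace SecondOrderSystem

variable {𝕜 : Type*} [RCLike 𝕜] {S : SecondOrderSystem 𝕜} {D N : Set (Coord 𝕜)}
  {x x₀ : Coord 𝕜} {U : Coord 𝕜 → 𝕜} {w : Fin 2 → Coord 𝕜 → 𝕜}

/-- The transformed `λU tr` is `λU tr a_k - 2 w_k`; its derivative involves only traceless parts and
`λU`, so it can be made nonzero by the initial data of `U`. -/
theorem IsStackelMultiplierOn.partialDeriv_trace (hU : S.IsStackelMultiplierOn N U w)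
    (hS : S.IsKillingSystemOn D) (hN : IsOpen N) (hND : N ⊆ D) (hx : x ∈ N) (hx0 : U x ≠ 0)
    (k : Fin 2) :
    partialDeriv 0 (fun y => (S.stackelTransform U w).metric y *
      ((S.stackelTransform U w).quad k y 0 0 + (S.stackelTransform U w).quad k y 1 1)) x =
    -(S.quadDiff k x * partialDeriv 0 (fun y => S.metric y * U y) x
      + S.quadCross k x * partialDeriv 1 (fun y => S.metric y * U y) x
      + partialDeriv 0 (S.quadDiff k) x * (S.metric x * U x)) := by
  have hl := (hS.analytic_metric x (hND hx)).differentiableAt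
  have hu := (hU.analytic_multiplier x hx).differentiableAt
  have hw := (hU.analytic_scalar k x hx).differentiableAt
  have ha (i j : Fin 2) := (hS.analytic_quad k i j x (hND hx)).differentiableAt
  have hev : (fun y => (S.stackelTransform U w).metric y *
      ((S.stackelTransform U w).quad k y 0 0 + (S.stackelTransform U w).quad k y 1 1)) =ᶠ[𝓝 x]
      fun y => S.metric y * U y * (S.quad k y 0 0 + S.quad k y 1 1) - 2 * w k y := by
    filter_upwards [hN.mem_nhds hx, hu.continuousAt.eventually_ne hx0] with y h1 h2
    have h3 := hS.metric_ne_zero y (hND h1)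
    simp [stackelTransform]
    field_simp
    ring
  have hsp := (hU.isScalarPartAt hS hND hx k).eq0
  have hK := hS.killing k x (hND hx)
  rw [(hev.partialDeriv 0).eq_of_nhds,
    partialDeriv_sub 0 ((hl.fun_mul hu).fun_mul ((ha 0 0).fun_add (ha 1 1))) (hw.const_mul 2),
    partialDeriv_const_mul 0 2 hw, hsp,
    partialDeriv_mul 0 (hl.fun_mul hu) ((ha 0 0).fun_add (ha 1 1)),
    partialDeriv_add 0 (ha 0 0) (ha 1 1), partialDeriv_mul 0 hl hu, partialDeriv_mul 1 hl hu,
    show partialDeriv 0 (S.quadDiff k) x = _ from partialDeriv_sub 0 (ha 0 0) (ha 1 1),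
    quadDiff, quadCross]
  linear_combination 2 * U x * hK.eq000

/-- An admissible potential is a Stäckel multiplier with the properties of the main theorem, if the
metric multiplied by it is nonzero and of constant curvature, and the transformed system is
functionally independent on a dense set. -/
theorem exists_stackelTransform_of_isAdmissiblePotentialAt (hS : S.IsSuperintegrableOn D)
    (hnd : S.IsNondegenerateOn D) (hx₀ : x₀ ∈ D) (hU : S.IsAdmissiblePotentialAt U x₀)
    (hU0 : ∃ᶠ y in 𝓝 x₀, U y ≠ 0)
    (hind : ∀ᶠ y in 𝓝 x₀, U y ≠ 0 → ∃ᶠ z in 𝓝 y, S.wronskRe z ≠ 0 ∨ S.wronskIm z ≠ 0 ∨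
      S.quadDiff 0 z * partialDeriv 0 (fun y => S.metric y * U y) z
        + S.quadCross 0 z * partialDeriv 1 (fun y => S.metric y * U y) z
        + partialDeriv 0 (S.quadDiff 0) z * (S.metric z * U z) ≠ 0)
    (c : 𝕜) (hcurv : ∀ᶠ y in 𝓝 x₀, U y ≠ 0 → S.metric y * U y *
        (partialDeriv 0 (partialDeriv 0 fun y => S.metric y * U y) y
          + partialDeriv 1 (partialDeriv 1 fun y => S.metric y * U y) y)
      - (partialDeriv 0 (fun y => S.metric y * U y) y ^ 2
        + partialDeriv 1 (fun y => S.metric y * U y) y ^ 2) = c * (S.metric y * U y) ^ 3) :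
    ∃ (N : Set (Coord 𝕜)) (U : Coord 𝕜 → 𝕜) (w : Fin 2 → Coord 𝕜 → 𝕜),
      IsOpen N ∧ x₀ ∈ N ∧ N ⊆ D ∧ S.IsStackelMultiplierOn N U w ∧
      (S.stackelTransform U w).IsSuperintegrableOn {x | x ∈ N ∧ U x ≠ 0} ∧
      (S.stackelTransform U w).IsNondegenerateOn {x | x ∈ N ∧ U x ≠ 0} ∧
      HasConstantCurvatureOn (S.stackelTransform U w).metric {x | x ∈ N ∧ U x ≠ 0} := by
  obtain ⟨hUa, w, hw⟩ := hU
  obtain ⟨N, hN, hNo, hxN⟩ := eventually_nhds_iff.1 ((hS.eventually_mem hx₀).and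
    (hUa.eventually_analyticAt.and ((eventually_all.2 fun k =>
    (hw k).1.eventually_analyticAt.and (hw k).2).and
    ((hUa.eventually_frequently_ne_zero hU0).and (hind.and hcurv)))))
  have hND : N ⊆ D := fun y hy => (hN y hy).1
  have hM : S.IsStackelMultiplierOn N U w :=
    { analytic_multiplier := fun y hy => (hN y hy).2.1
      analytic_scalar := fun k y hy => ((hN y hy).2.2.1 k).1
      constant_of_motion := fun k y hy => ((hN y hy).2.2.1 k).2
      dense_ne_zero := fun y hy => mem_closure_iff_frequently.2
        (((hN y hy).2.2.2.1.and_eventually (hNo.mem_nhds hy)).mono fun z hz => ⟨hz.2, hz.1⟩) }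
  have hK := hM.isKillingSystemOn hS.isKillingSystemOn hNo hND
  refine ⟨N, U, w, hNo, hxN, hND, hM, ?_, hM.isNondegenerateOn hS hnd hNo hND, ?_⟩
  · refine hM.isSuperintegrableOn hS hNo hND (functionally_independent_of_dense
      (G := {z | (z ∈ N ∧ U z ≠ 0) ∧ (S.wronskRe z ≠ 0 ∨ S.wronskIm z ≠ 0 ∨
      S.quadDiff 0 z * partialDeriv 0 (fun y => S.metric y * U y) z
        + S.quadCross 0 z * partialDeriv 1 (fun y => S.metric y * U y) z
        + partialDeriv 0 (S.quadDiff 0) z * (S.metric z * U z) ≠ 0)}) (fun z hz => hz.1) ?_ ?_)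
    · intro y hy
      exact mem_closure_iff_frequently.2 ((((hN y hy.1).2.2.2.2.1 hy.2).and_eventually
        (hK.isOpen.mem_nhds hy)).mono fun z hz => ⟨hz.2, hz.1⟩)
    · rintro z ⟨hz, hgood⟩ p
      refine mem_closure_setOf_linearIndependent hK hz
        ((hS.analytic_potential z (hND hz.1)).div (hM.analytic_multiplier z hz.1)
          hz.2).differentiableAt
        (fun k => ((hS.analytic_scalar k z (hND hz.1)).sub
          (((hM.analytic_scalar k z hz.1).div (hM.analytic_multiplier z hz.1) hz.2).mul
            (hS.analytic_potential z (hND hz.1)))).differentiableAt) ?_ ?_ p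
      · rw [disc_stackelTransform]
        exact hnd.disc_ne_zero hS (hND hz.1)
      · rw [wronskRe_stackelTransform, wronskIm_stackelTransform]
        refine hgood.imp_right (Or.imp_right fun h => ⟨0, ?_⟩)
        rw [hM.partialDeriv_trace hS.isKillingSystemOn hNo hND hz.1 hz.2]
        exact neg_ne_zero.2 h
  · exact hasConstantCurvatureOn_of_eq c hK.metric_ne_zero fun y hy => (hN y hy.1).2.2.2.2.2 hy.2

end SecondOrderSystem

/-! ### Sums of two squares over the reals -/

section SumOfSquares

variable {𝕜 : Type*} [RCLike 𝕜]

theorem RCLike.eq_zero_of_mul_self_add_mul_self (hI : (RCLike.I : 𝕜) = 0) {a b : 𝕜}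
    (h : a * a + b * b = 0) : a = 0 ∧ b = 0 := by
  have ha := RCLike.re_add_im a
  have hb := RCLike.re_add_im b
  rw [hI, mul_zero, add_zero] at ha hb
  rw [← ha, ← hb] at h ⊢
  have h' : RCLike.re a * RCLike.re a + RCLike.re b * RCLike.re b = 0 := by exact_mod_cast h
  have h1 : RCLike.re a = 0 := by nlinarith [mul_self_nonneg (RCLike.re a), mul_self_nonneg (RCLike.re b)]
  have h2 : RCLike.re b = 0 := by nlinarith [mul_self_nonneg (RCLike.re a), mul_self_nonneg (RCLike.re b)]
  rw [h1, h2]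
  simp

end SumOfSquares

/-! ### Null derivations `∂₁ ± i∂₂` -/

section NullFrame

variable {A : Type*} [CommRing A] {d₁ d₂ : Derivation ℤ A A}
variable {K : Type*} [Field K] [CharZero K] (v : A →+* K)

theorem null_comm (hcomm : ∀ a, d₂ (d₁ a) = d₁ (d₂ a)) {i : A} (hi₁ : d₁ i = 0) (hi₂ : d₂ i = 0)
    (a : A) : (d₁ + i • d₂) ((d₁ - i • d₂) a) = (d₁ - i • d₂) ((d₁ + i • d₂) a) := by
  simp only [map_add, map_sub, Derivation.leibniz, smul_eq_mul, hcomm, Derivation.add_apply,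
    Derivation.sub_apply, Derivation.smul_apply, hi₁, hi₂]
  ring

theorem null_laplace (hcomm : ∀ a, d₂ (d₁ a) = d₁ (d₂ a)) {i : A} (hi : i * i = -1)
    (hi₁ : d₁ i = 0) (hi₂ : d₂ i = 0) (a : A) :
    (d₁ - i • d₂) ((d₁ + i • d₂) a) = d₁ (d₁ a) + d₂ (d₂ a) := by
  simp only [map_add, Derivation.leibniz, smul_eq_mul, hcomm, Derivation.add_apply,
    Derivation.sub_apply, Derivation.smul_apply, hi₁, hi₂]
  linear_combination -d₂ (d₂ a) * hi

/-- Expresses `DF` through the Laplacian of `μ`; this determines the initial second derivatives for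
which `DF` vanishes. -/
theorem null_form_deriv (hcomm : ∀ a, d₂ (d₁ a) = d₁ (d₂ a)) {i : A} (hi : i * i = -1)
    (hi₁ : d₁ i = 0) (hi₂ : d₂ i = 0) (δ μ : A) :
    (d₁ - i • d₂) (2 * δ * (d₁ + i • d₂) μ + (d₁ + i • d₂) δ * μ) =
      2 * ((d₁ - i • d₂) δ * (d₁ + i • d₂) μ + δ * (d₁ (d₁ μ) + d₂ (d₂ μ)))
        + (d₁ (d₁ δ) + d₂ (d₂ δ)) * μ + (d₁ + i • d₂) δ * (d₁ - i • d₂) μ := by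
  rw [← null_laplace hcomm hi hi₁ hi₂, ← null_laplace hcomm hi hi₁ hi₂]
  generalize d₁ - i • d₂ = D
  generalize d₁ + i • d₂ = E
  simp only [map_add, Derivation.leibniz, smul_eq_mul, Derivation.map_ofNat_eq_zero]
  ring

theorem null_integrability_of_frame (hcomm : ∀ a, d₂ (d₁ a) = d₁ (d₂ a)) {i δ X Y : A}
    (hi : i * i = -1) (hi₁ : d₁ i = 0) (hi₂ : d₂ i = 0) (hXY : X + i * Y = 0)
    (hf : IsKillingFrame d₁ d₂ δ X Y)
    (hJ : 8 * v δ ^ 2 * v (d₁ (d₁ X)) - 10 * v δ * (v (d₁ X) * v (d₁ δ) + v (d₁ Y) * v (d₂ δ))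
        - 3 * v δ * (v X * (v (d₁ (d₁ δ)) - v (d₂ (d₂ δ))) + 2 * v Y * v (d₁ (d₂ δ)))
        + 6 * (v X * (v (d₁ δ) ^ 2 - v (d₂ δ) ^ 2) + 2 * v Y * v (d₁ δ) * v (d₂ δ))
        + 6 * (v X ^ 2 + v Y ^ 2) * v (d₂ δ)
        + 8 * v δ * (v X * v (d₁ Y) - v Y * v (d₁ X)) = 0)
    (hJ' : -8 * v δ ^ 2 * v (d₁ (d₁ Y))
        - 10 * v δ * (v (d₁ X) * v (d₂ δ) - v (d₁ Y) * v (d₁ δ))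
        - 3 * v δ * (2 * v X * v (d₁ (d₂ δ)) - v Y * (v (d₁ (d₁ δ)) - v (d₂ (d₂ δ))))
        + 6 * (2 * v X * v (d₁ δ) * v (d₂ δ) - v Y * (v (d₁ δ) ^ 2 - v (d₂ δ) ^ 2))
        + 6 * (v X ^ 2 + v Y ^ 2) * v (d₁ δ) - 8 * v δ * (v X * v (d₁ X) + v Y * v (d₁ Y)) = 0) :
    2 * v δ ^ 2 * v ((d₁ + i • d₂) ((d₁ + i • d₂) (X - i * Y)))
      - 5 * v δ * v ((d₁ + i • d₂) δ) * v ((d₁ + i • d₂) (X - i * Y))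
      - 3 * v δ * v (X - i * Y) * v ((d₁ + i • d₂) ((d₁ + i • d₂) δ))
      + 6 * v (X - i * Y) * v ((d₁ + i • d₂) δ) ^ 2 = 0 := by
  have hv : v i * v i = -1 := by rw [← map_mul, hi, map_neg, map_one]
  have h1 : d₁ X + i * d₁ Y = 0 := by
    have := congrArg d₁ hXY
    simp only [map_add, Derivation.leibniz, smul_eq_mul, hi₁, map_zero] at this
    linear_combination this
  have hEB : (d₁ + i • d₂) (X - i * Y) = d₁ X + d₁ X - i * (d₁ Y + d₁ Y) := by
    simp only [map_sub, Derivation.leibniz, smul_eq_mul, Derivation.add_apply,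
      Derivation.smul_apply, hi₁, hi₂, hf.cr₁, hf.cr₂]
    linear_combination -d₁ X * hi
  have hEEB : (d₁ + i • d₂) (d₁ X + d₁ X - i * (d₁ Y + d₁ Y)) =
      4 * (d₁ (d₁ X) - i * d₁ (d₁ Y)) := by
    simp only [map_add, map_sub, map_neg, Derivation.leibniz, smul_eq_mul, Derivation.add_apply,
      Derivation.smul_apply, hi₁, hi₂, hcomm, hf.cr₁, hf.cr₂]
    linear_combination -2 * d₁ (d₁ X) * hi
  have hEE : (d₁ + i • d₂) ((d₁ + i • d₂) δ) = d₁ (d₁ δ) - d₂ (d₂ δ) + 2 * i * d₁ (d₂ δ) := by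
    simp only [map_add, Derivation.leibniz, smul_eq_mul, Derivation.add_apply,
      Derivation.smul_apply, hi₁, hi₂, hcomm]
    linear_combination d₂ (d₂ δ) * hi
  have h := null_integrability hv (by rw [← map_mul, ← map_add, hXY, map_zero])
    (by rw [← map_mul, ← map_add, h1, map_zero]) hJ hJ'
  rw [hEB, hEEB, hEE]
  simp only [map_add, map_sub, map_mul, map_ofNat, Derivation.add_apply, Derivation.smul_apply,
    smul_eq_mul]
  linear_combination h

theorem IsConformalPotential.null_form_eq (hcomm : ∀ a, d₂ (d₁ a) = d₁ (d₂ a)) {i δ X Y μ : A}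
    (hi : i * i = -1) (hi₁ : d₁ i = 0) (hi₂ : d₂ i = 0) (hXY : X + i * Y = 0)
    (hf : IsKillingFrame d₁ d₂ δ X Y) (hμ : IsConformalPotential d₁ d₂ δ X Y μ) :
    (d₁ + i • d₂) (2 * δ * (d₁ + i • d₂) μ + (d₁ + i • d₂) δ * μ) = 0 := by
  have h := (hμ.null_form hcomm hi hi₁ hi₂ hXY hf).2
  generalize d₁ + i • d₂ = E at h ⊢
  simp only [map_add, Derivation.leibniz, smul_eq_mul, Derivation.map_ofNat_eq_zero]
  linear_combination h

theorem IsKillingFrame.flat_of_null_form (hcomm : ∀ a, d₂ (d₁ a) = d₁ (d₂ a)) {i δ X Y μ : A}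
    (hi : i * i = -1) (hi₁ : d₁ i = 0) (hi₂ : d₂ i = 0) (hXY : X + i * Y = 0)
    (hf : IsKillingFrame d₁ d₂ δ X Y) (hδ : v δ ≠ 0)
    (hF : v (2 * δ * (d₁ + i • d₂) μ + (d₁ + i • d₂) δ * μ) = 0)
    (hDF : v ((d₁ - i • d₂) (2 * δ * (d₁ + i • d₂) μ + (d₁ + i • d₂) δ * μ)) = 0) :
    v μ * (v (d₁ (d₁ μ)) + v (d₂ (d₂ μ))) = v (d₁ μ) ^ 2 + v (d₂ μ) ^ 2 := by
  have hv : v i * v i = -1 := by rw [← map_mul, hi, map_neg, map_one]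
  have h := flat_of_null_system v hδ (null_disc hcomm hi hi₁ hi₂ hXY hf) hF hDF
  rw [null_laplace hcomm hi hi₁ hi₂] at h
  simp only [map_add, map_sub, map_mul, Derivation.add_apply, Derivation.sub_apply,
    Derivation.smul_apply, smul_eq_mul] at h
  linear_combination h - v (d₂ μ) ^ 2 * hv

end NullFrame

/-! ### The three cases of the theorem -/

namespace SecondOrderSystem

variable {𝕜 : Type*} [RCLike 𝕜] {S : SecondOrderSystem 𝕜} {D : Set (Coord 𝕜)} {x₀ : Coord 𝕜}

/-- The conclusion of the main theorem: Stäckel equivalence, near `x₀`, to a system on a space of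
constant curvature. -/
def HasConstantCurvatureTransformAt (S : SecondOrderSystem 𝕜) (D : Set (Coord 𝕜))
    (x₀ : Coord 𝕜) : Prop :=
  ∃ (N : Set (Coord 𝕜)) (U : Coord 𝕜 → 𝕜) (w : Fin 2 → Coord 𝕜 → 𝕜),
    IsOpen N ∧ x₀ ∈ N ∧ N ⊆ D ∧ S.IsStackelMultiplierOn N U w ∧
    (S.stackelTransform U w).IsSuperintegrableOn {x | x ∈ N ∧ U x ≠ 0} ∧
    (S.stackelTransform U w).IsNondegenerateOn {x | x ∈ N ∧ U x ≠ 0} ∧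
    HasConstantCurvatureOn (S.stackelTransform U w).metric {x | x ∈ N ∧ U x ≠ 0}

theorem IsAdmissiblePotentialAt.analyticAt_mul (hS : S.IsSuperintegrableOn D) (hx₀ : x₀ ∈ D)
    {U : Coord 𝕜 → 𝕜} (hU : S.IsAdmissiblePotentialAt U x₀) :
    AnalyticAt 𝕜 (fun y => S.metric y * U y) x₀ :=
  (hS.analytic_metric x₀ hx₀).mul hU.1

theorem IsAdmissiblePotentialAt.eventually_ne_zero {U : Coord 𝕜 → 𝕜} (hU : S.IsAdmissiblePotentialAt U x₀) (h1 : S.metric x₀ * U x₀ = 1) :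
    ∀ᶠ y in 𝓝 x₀, U y ≠ 0 :=
  hU.1.continuousAt.eventually_ne (right_ne_zero_of_mul (h1.trans_ne one_ne_zero))

theorem hasConstantCurvatureTransformAt_of_wronskian_ne_zero (hS : S.IsSuperintegrableOn D)
    (hnd : S.IsNondegenerateOn D) (hx₀ : x₀ ∈ D)
    (hn : ∃ᶠ y in 𝓝 x₀, S.wronskRe y * S.wronskRe y + S.wronskIm y * S.wronskIm y ≠ 0) :
    S.HasConstantCurvatureTransformAt D x₀ := by
  have hm := analyticAt_canonicalFactor hS hnd hx₀
  obtain ⟨U, hU, hUd⟩ := hnd.exists_admissible hS hx₀ ![S.canonicalFactor x₀,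
    partialDeriv 0 S.canonicalFactor x₀, partialDeriv 1 S.canonicalFactor x₀,
    partialDeriv 0 (partialDeriv 0 S.canonicalFactor) x₀]
  have heq : (fun y => S.metric y * U y) =ᶠ[𝓝 x₀] S.canonicalFactor := by
    refine eventuallyEq_of_isCanonicalAt hS hnd hx₀ (hU.analyticAt_mul hS hx₀) hm ?_ ?_ hUd
      ⟨rfl, rfl, rfl, rfl⟩
    · filter_upwards [hU.eventually, hS.eventually_mem hx₀] with y h1 h2
        using h1.isCanonicalAt hS h2
    · filter_upwards [hS.eventually_mem hx₀] with y h using (canonicalFactor_spec hS hnd h).1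
  refine exists_stackelTransform_of_isAdmissiblePotentialAt hS hnd hx₀ hU ?_ ?_ 2 ?_
  · refine (hn.and_eventually (heq.and (hS.eventually_mem hx₀))).mono ?_
    rintro y ⟨h1, h2, h3⟩ h0
    have hd := hnd.disc_ne_zero hS h3
    simp only [h0, mul_zero] at h2
    exact div_ne_zero h1 (mul_ne_zero hd hd) h2.symm
  · filter_upwards [heq, hS.eventually_mem hx₀] with y h1 h2 h3
    have h4 : S.canonicalFactor y ≠ 0 := h1 ▸ mul_ne_zero (hS.metric_ne_zero y h2) h3
    have h5 : S.wronskRe y ≠ 0 ∨ S.wronskIm y ≠ 0 := by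
      by_contra! h
      exact h4 (by simp [canonicalFactor, h.1, h.2])
    exact Frequently.filter_mono (frequently_pure.2 (h5.imp_right Or.inl)) (pure_le_nhds y)
  · filter_upwards [heq.eventually_nhds, hS.eventually_mem hx₀] with y h1 h2 _
    have h3 (i : Fin 2) := EventuallyEq.partialDeriv h1 i
    rw [((h3 0).partialDeriv 0).eq_of_nhds, ((h3 1).partialDeriv 1).eq_of_nhds,
      (h3 0).eq_of_nhds, (h3 1).eq_of_nhds, show S.metric y * U y = S.canonicalFactor y from EventuallyEq.eq_of_nhds (f := fun y => S.metric y * U y) h1]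
    exact (canonicalFactor_spec hS hnd h2).2

theorem hasConstantCurvatureTransformAt_of_wronskian_eq_zero (hS : S.IsSuperintegrableOn D)
    (hnd : S.IsNondegenerateOn D) (hx₀ : x₀ ∈ D) (hX : ∀ᶠ y in 𝓝 x₀, S.wronskRe y = 0)
    (hY : ∀ᶠ y in 𝓝 x₀, S.wronskIm y = 0) : S.HasConstantCurvatureTransformAt D x₀ := by
  have hd := hnd.disc_ne_zero hS hx₀
  -- The Wronskian gives no functional independence here, so the gradient `(a, b)` of `μ`, with `μ =
  -- 1` at `x₀`, must make the trace derivative nonzero. If none did, `quadDiff 0` and `quadCross 0`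
  -- would vanish at `x₀`, against `disc ≠ 0`.
  obtain ⟨a, b, hab⟩ : ∃ a b : 𝕜, S.quadDiff 0 x₀ * a + S.quadCross 0 x₀ * b
      + partialDeriv 0 (S.quadDiff 0) x₀ ≠ 0 := by
    by_contra! h
    have h0 := h 0 0
    have h1 := h 1 0
    have h2 := h 0 1
    refine hd ?_
    rw [disc]
    linear_combination S.quadDiff 1 x₀ * (h2 - h0) - S.quadCross 1 x₀ * (h1 - h0)
  set s : 𝕜 := (-3 * partialDeriv 0 S.disc x₀ * a + 3 * partialDeriv 1 S.disc x₀ * b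
    - (partialDeriv 0 (partialDeriv 0 S.disc) x₀ - partialDeriv 1 (partialDeriv 1 S.disc) x₀))
      / (2 * S.disc x₀) with hs
  -- `s` is the value of `μ₁₁ - μ₂₂` dictated by the canonical equation, and flatness at `x₀`
  -- requires `μ₁₁ + μ₂₂ = a² + b²`.
  obtain ⟨U, hU, hUd⟩ := hnd.exists_admissible hS hx₀ ![1, a, b, (a ^ 2 + b ^ 2 + s) / 2]
  obtain ⟨u0, u1, u2, u11⟩ : S.metric x₀ * U x₀ = 1 ∧
    partialDeriv 0 (fun y => S.metric y * U y) x₀ = a ∧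
    partialDeriv 1 (fun y => S.metric y * U y) x₀ = b ∧
    partialDeriv 0 (partialDeriv 0 (fun y => S.metric y * U y)) x₀ = (a ^ 2 + b ^ 2 + s) / 2 := hUd
  have hne := hU.eventually_ne_zero u0
  have hμ := hU.analyticAt_mul hS hx₀
  set μ : Coord 𝕜 → 𝕜 := fun y => S.metric y * U y with hμdef
  set G : Coord 𝕜 → 𝕜 := fun y => μ y * (partialDeriv 0 (partialDeriv 0 μ) y
    + partialDeriv 1 (partialDeriv 1 μ) y) - (partialDeriv 0 μ y * partialDeriv 0 μ y
      + partialDeriv 1 μ y * partialDeriv 1 μ y) with hG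
  have hGa : AnalyticAt 𝕜 G x₀ := (hμ.mul (((hμ.partialDeriv 0).partialDeriv 0).add
    ((hμ.partialDeriv 1).partialDeriv 1))).sub (((hμ.partialDeriv 0).mul (hμ.partialDeriv 0)).add
      ((hμ.partialDeriv 1).mul (hμ.partialDeriv 1)))
  have hδ := hS.analyticAt_disc hx₀
  have hG0 : G x₀ = 0 := by
    have hS' := (hU.isCanonicalAt hS hx₀).eqS
    have hY1 : partialDeriv 0 S.wronskIm x₀ = 0 := by
      rw [(EventuallyEq.partialDeriv (g := fun _ => 0) hY 0).eq_of_nhds]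
      simp [partialDeriv]
    rw [hX.self_of_nhds, hY.self_of_nhds, hY1] at hS'
    change 2 * S.disc x₀ * (partialDeriv 0 (partialDeriv 0 μ) x₀
      - partialDeriv 1 (partialDeriv 1 μ) x₀) = -3 * (partialDeriv 0 S.disc x₀ + 0)
        * partialDeriv 0 μ x₀ + 3 * (partialDeriv 1 S.disc x₀ + 0) * partialDeriv 1 μ x₀
        + (-(partialDeriv 0 (partialDeriv 0 S.disc) x₀ - partialDeriv 1 (partialDeriv 1 S.disc) x₀)
          - 2 * 0) * μ x₀ at hS'
    have e0 : μ x₀ = 1 := u0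
    rw [e0, u1, u2] at hS'
    have hs' : partialDeriv 0 (partialDeriv 0 μ) x₀ - partialDeriv 1 (partialDeriv 1 μ) x₀ = s := by
      rw [hs, eq_div_iff (mul_ne_zero two_ne_zero hd)]
      linear_combination hS'
    simp only [hG, e0, u1, u2]
    linear_combination 2 * u11 - hs'
  have hflat : ∀ᶠ y in 𝓝 x₀, G y = 0 := by
    have key := eventually_eq_zero_of_linear_system ![G]
      (fun i _ _ y => -3 * partialDeriv i S.disc y / (2 * S.disc y)) (x₀ := x₀) ?_ ?_ ?_ ?_
    · filter_upwards [key] with y hy using hy 0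
    · intro i _ _
      exact ((analyticAt_const.mul (hδ.partialDeriv i)).div (analyticAt_const.mul hδ)
        (mul_ne_zero two_ne_zero hd)).continuousAt
    · filter_upwards [hGa.eventually_analyticAt] with y hy j
      fin_cases j
      exact hy.differentiableAt
    · filter_upwards [hU.eventually, hS.eventually_mem hx₀, hX.eventually_nhds,
        hY.eventually_nhds] with y hUy hy hXy hYy i j
      have hdy := hnd.disc_ne_zero hS hy
      have hf := hS.isKillingFrame hy
      have hp := hUy.isConformalPotential hS hy
      have gX : germAt _ (hS.analyticAt_wronskRe hy) = 0 :=
        (germAt_eq_iff (hS.analyticAt_wronskRe hy) analyticAt_const).2 hXy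
      have gY : germAt _ (hS.analyticAt_wronskIm hy) = 0 :=
        (germAt_eq_iff (hS.analyticAt_wronskIm hy) analyticAt_const).2 hYy
      rw [gX, gY] at hf hp
      have h := hp.flatness_values (germValue y) (germDeriv_swap y) hf hdy
      have h0 : 2 * S.disc y * partialDeriv 0 G y = -3 * partialDeriv 0 S.disc y * G y := h.1
      have h1 : 2 * S.disc y * partialDeriv 1 G y = -3 * partialDeriv 1 S.disc y * G y := h.2
      fin_cases j
      simp only [Fin.zero_eta, Matrix.cons_val_fin_one, Finset.univ_unique, Fin.default_eq_zero,
        Finset.sum_const, Finset.card_singleton, one_smul]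
      rw [div_mul_eq_mul_div, eq_div_iff (mul_ne_zero two_ne_zero hdy)]
      fin_cases i
      · exact (mul_comm _ _).trans h0
      · exact (mul_comm _ _).trans h1
    · intro j
      fin_cases j
      exact hG0
  refine exists_stackelTransform_of_isAdmissiblePotentialAt hS hnd hx₀ hU hne.frequently ?_ 0 ?_
  · have hQ := hS.analyticAt_quadDiff hx₀ 0
    have hcont : ContinuousAt (fun z => S.quadDiff 0 z * partialDeriv 0 μ z
        + S.quadCross 0 z * partialDeriv 1 μ z + partialDeriv 0 (S.quadDiff 0) z * μ z) x₀ :=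
      (((hQ.mul (hμ.partialDeriv 0)).add ((hS.analyticAt_quadCross hx₀ 0).mul
        (hμ.partialDeriv 1))).add ((hQ.partialDeriv 0).mul hμ)).continuousAt
    have hne0 : S.quadDiff 0 x₀ * partialDeriv 0 μ x₀ + S.quadCross 0 x₀ * partialDeriv 1 μ x₀
        + partialDeriv 0 (S.quadDiff 0) x₀ * μ x₀ ≠ 0 := by
      rw [u1, u2, show μ x₀ = 1 from u0, mul_one]
      exact hab
    filter_upwards [hcont.eventually_ne hne0] with y hy _
    exact Frequently.filter_mono (frequently_pure.2 (Or.inr (Or.inr hy))) (pure_le_nhds y)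
  · filter_upwards [hflat] with y hy _
    rw [zero_mul, pow_two, pow_two]
    exact hy

theorem hasConstantCurvatureTransformAt_of_null_wronskian (hS : S.IsSuperintegrableOn D)
    (hnd : S.IsNondegenerateOn D) (hx₀ : x₀ ∈ D) {i : 𝕜} (hi : i * i = -1)
    (hXY : ∀ᶠ y in 𝓝 x₀, S.wronskRe y + i * S.wronskIm y = 0)
    (hX : ∃ᶠ y in 𝓝 x₀, S.wronskRe y ≠ 0) : S.HasConstantCurvatureTransformAt D x₀ := by
  have hd := hnd.disc_ne_zero hS hx₀
  have hδ := hS.analyticAt_disc hx₀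
  have hXa := hS.analyticAt_wronskRe hx₀
  have hYa := hS.analyticAt_wronskIm hx₀
  have h2d : 2 * S.disc x₀ ≠ 0 := mul_ne_zero two_ne_zero hd
  -- With `μ = 1` and `Dμ = 0` at `x₀`, the number `e` is the value of `Eμ` for which `F = 0`, `s`
  -- is the value of the Laplacian for which `DF = 0`, and `t` is the value of `μ₁₁ - μ₂₂` forced by
  -- the canonical equation.
  set e : 𝕜 := -(partialDeriv 0 S.disc x₀ + i * partialDeriv 1 S.disc x₀) / (2 * S.disc x₀) with he
  set s : 𝕜 := -(2 * (partialDeriv 0 S.disc x₀ - i * partialDeriv 1 S.disc x₀) * e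
    + (partialDeriv 0 (partialDeriv 0 S.disc) x₀ + partialDeriv 1 (partialDeriv 1 S.disc) x₀))
      / (2 * S.disc x₀) with hs
  set t : 𝕜 := (-3 * (partialDeriv 0 S.disc x₀ + S.wronskIm x₀) * (e / 2)
    + 3 * (partialDeriv 1 S.disc x₀ + S.wronskRe x₀) * (-i * e / 2)
    + (-(partialDeriv 0 (partialDeriv 0 S.disc) x₀ - partialDeriv 1 (partialDeriv 1 S.disc) x₀)
      - 2 * partialDeriv 0 S.wronskIm x₀)) / (2 * S.disc x₀) with ht
  rw [eq_div_iff h2d] at he hs ht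
  obtain ⟨U, hU, hUd⟩ := hnd.exists_admissible hS hx₀ ![1, e / 2, -i * e / 2, (s + t) / 2]
  obtain ⟨u0, u1, u2, u11⟩ : S.metric x₀ * U x₀ = 1 ∧
    partialDeriv 0 (fun y => S.metric y * U y) x₀ = e / 2 ∧
    partialDeriv 1 (fun y => S.metric y * U y) x₀ = -i * e / 2 ∧
    partialDeriv 0 (partialDeriv 0 (fun y => S.metric y * U y)) x₀ = (s + t) / 2 := hUd
  have hne := hU.eventually_ne_zero u0
  have hμ := hU.analyticAt_mul hS hx₀
  have hS₀ := (hU.isCanonicalAt hS hx₀).eqS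
  set μ : Coord 𝕜 → 𝕜 := fun y => S.metric y * U y with hμdef
  change μ x₀ = 1 at u0
  set F : Coord 𝕜 → 𝕜 := fun y => 2 * S.disc y * (partialDeriv 0 μ y + i * partialDeriv 1 μ y)
    + (partialDeriv 0 S.disc y + i * partialDeriv 1 S.disc y) * μ y with hF
  set G : Coord 𝕜 → 𝕜 := fun y => partialDeriv 0 F y - i * partialDeriv 1 F y with hG
  set B : Coord 𝕜 → 𝕜 := fun y => S.wronskRe y - i * S.wronskIm y with hB
  set δ' : Coord 𝕜 → 𝕜 := fun y => partialDeriv 0 S.disc y - i * partialDeriv 1 S.disc y with hδ'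
  have hc {y : Coord 𝕜} : AnalyticAt 𝕜 (fun _ : Coord 𝕜 => i) y := analyticAt_const
  have hBa : AnalyticAt 𝕜 B x₀ := hXa.sub (hc.mul hYa)
  have hδ'a : AnalyticAt 𝕜 δ' x₀ := (hδ.partialDeriv 0).sub (hc.mul (hδ.partialDeriv 1))
  have hFa : AnalyticAt 𝕜 F x₀ := ((analyticAt_const.mul hδ).mul ((hμ.partialDeriv 0).add
    (hc.mul (hμ.partialDeriv 1)))).add (((hδ.partialDeriv 0).add
      (hc.mul (hδ.partialDeriv 1))).mul hμ)
  have hGa : AnalyticAt 𝕜 G x₀ := (hFa.partialDeriv 0).sub (hc.mul (hFa.partialDeriv 1))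
  have hic (y : Coord 𝕜) (k : Fin 2) : germDeriv y k (germAt (fun _ => i) hc) = 0 :=
    (germAt_eq_iff (hc.partialDeriv k) analyticAt_const).2
      (Eventually.of_forall fun z => by simp [partialDeriv])
  have hii (y : Coord 𝕜) : germAt (fun _ => i) hc * germAt (fun _ => i) hc =
      (-1 : AnalyticGerm y) :=
    (germAt_eq_iff (hc.mul hc) analyticAt_const.neg).2 (Eventually.of_forall fun z => hi)
  have hF0 : F x₀ = 0 := by
    simp only [hF, u0, u1, u2]
    linear_combination he - S.disc x₀ * e * hi
  have hG0 : G x₀ = 0 := by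
    have h := congrArg (germValue x₀) (null_form_deriv (germDeriv_swap x₀) (hii x₀) (hic x₀ 0)
      (hic x₀ 1) (germAt _ hδ) (germAt μ hμ))
    have h' : G x₀ = 2 * ((partialDeriv 0 S.disc x₀ - i * partialDeriv 1 S.disc x₀)
        * (partialDeriv 0 μ x₀ + i * partialDeriv 1 μ x₀)
        + S.disc x₀ * (partialDeriv 0 (partialDeriv 0 μ) x₀ + partialDeriv 1 (partialDeriv 1 μ) x₀))
      + (partialDeriv 0 (partialDeriv 0 S.disc) x₀ + partialDeriv 1 (partialDeriv 1 S.disc) x₀) * μ x₀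
      + (partialDeriv 0 S.disc x₀ + i * partialDeriv 1 S.disc x₀)
        * (partialDeriv 0 μ x₀ - i * partialDeriv 1 μ x₀) := h
    have ht' : partialDeriv 0 (partialDeriv 0 μ) x₀ - partialDeriv 1 (partialDeriv 1 μ) x₀ = t := by
      refine mul_left_cancel₀ h2d ?_
      rw [mul_comm _ t, ht, hS₀, u1, u2, show S.metric x₀ * U x₀ = 1 from u0, mul_one]
    have hs' : partialDeriv 0 (partialDeriv 0 μ) x₀ + partialDeriv 1 (partialDeriv 1 μ) x₀ = s := by
      linear_combination 2 * u11 - ht'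
    rw [h', hs', u0, u1, u2]
    linear_combination hs + (-(partialDeriv 0 S.disc x₀ - i * partialDeriv 1 S.disc x₀) * e * hi
      + (partialDeriv 0 S.disc x₀ + i * partialDeriv 1 S.disc x₀) * (e / 2) * hi)
  have hloc : ∀ᶠ y in 𝓝 x₀, ∀ hy : y ∈ D, S.IsAdmissiblePotentialAt U y ∧
      germAt _ (hS.analyticAt_wronskRe hy) + germAt (fun _ => i) hc
        * germAt _ (hS.analyticAt_wronskIm hy) = 0 := by
    filter_upwards [hU.eventually, hXY.eventually_nhds] with y h1 h2 hy
    exact ⟨h1, (germAt_eq_iff ((hS.analyticAt_wronskRe hy).add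
      (hc.mul (hS.analyticAt_wronskIm hy))) analyticAt_const).2 h2⟩
  have hzero : ∀ᶠ y in 𝓝 x₀, F y = 0 ∧ G y = 0 := by
    refine eventually_eq_zero_of_null_system hi hFa hGa
      (α := fun y => δ' y / (2 * S.disc y))
      (β := fun y => (-δ' y ^ 2 + S.disc y * (partialDeriv 0 δ' y - i * partialDeriv 1 δ' y)
        - i * (4 * S.disc y * (partialDeriv 0 B y + i * partialDeriv 1 B y)
          - 6 * B y * (partialDeriv 0 S.disc y + i * partialDeriv 1 S.disc y)))
        / (2 * S.disc y ^ 2)) ?_ ?_ ?_ hF0 hG0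
    · exact (hδ'a.div (analyticAt_const.mul hδ) h2d).continuousAt
    · exact ((((hδ'a.pow 2).neg.add (hδ.mul ((hδ'a.partialDeriv 0).sub
        (hc.mul (hδ'a.partialDeriv 1))))).sub (hc.mul (((analyticAt_const.mul hδ).mul
        ((hBa.partialDeriv 0).add (hc.mul (hBa.partialDeriv 1)))).sub ((analyticAt_const.mul hBa).mul
        ((hδ.partialDeriv 0).add (hc.mul (hδ.partialDeriv 1))))))).div
        (analyticAt_const.mul (hδ.pow 2))
        (mul_ne_zero two_ne_zero (pow_ne_zero 2 hd))).continuousAt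
    · filter_upwards [hloc, hS.eventually_mem hx₀] with y hyl hy
      obtain ⟨hUy, hXYy⟩ := hyl hy
      have hdy := hnd.disc_ne_zero hS hy
      have hf := hS.isKillingFrame hy
      have hp := hUy.isConformalPotential hS hy
      have hI := hnd.isIntegrableAt hS hy
      have hEF := hp.null_form_eq (germDeriv_swap y) (hii y) (hic y 0) (hic y 1) hXYy hf
      have hEG := null_comm (germDeriv_swap y) (hic y 0) (hic y 1)
        (2 * germAt _ (hS.analyticAt_disc hy) * (germDeriv y 0 + germAt (x := y) (fun _ => i) hc
          • germDeriv y 1) (germAt μ (hUy.analyticAt_mul hS hy))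
          + (germDeriv y 0 + germAt (x := y) (fun _ => i) hc • germDeriv y 1)
            (germAt _ (hS.analyticAt_disc hy)) * germAt μ (hUy.analyticAt_mul hS hy))
      rw [hEF, map_zero] at hEG
      have hnf := hp.null_form (germDeriv_swap y) (hii y) (hic y 0) (hic y 1) hXYy hf
      have hDG := null_system_of_frame (germValue y)
        (null_comm (germDeriv_swap y) (hic y 0) (hic y 1))
        (by rw [Derivation.add_apply, Derivation.smul_apply, hic, hic, smul_zero, add_zero])
        (null_disc (germDeriv_swap y) (hii y) (hic y 0) (hic y 1) hXYy hf) hnf.1 hnf.2 hdy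
        (null_integrability_of_frame (germValue y) (germDeriv_swap y) (hii y) (hic y 0) (hic y 1)
          hXYy hf hI.re hI.im)
      have hDG' : 2 * S.disc y ^ 2 * (partialDeriv 0 G y - i * partialDeriv 1 G y) =
          S.disc y * δ' y * G y + (-δ' y ^ 2 + S.disc y * (partialDeriv 0 δ' y
            - i * partialDeriv 1 δ' y) - i * (4 * S.disc y * (partialDeriv 0 B y
            + i * partialDeriv 1 B y) - 6 * B y * (partialDeriv 0 S.disc y
            + i * partialDeriv 1 S.disc y))) * F y := hDG
      refine ⟨congrArg (germValue y) hEF, rfl, congrArg (germValue y) hEG, ?_⟩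
      field_simp
      linear_combination hDG'
  refine exists_stackelTransform_of_isAdmissiblePotentialAt hS hnd hx₀ hU hne.frequently ?_ 0 ?_
  · filter_upwards [hXa.eventually_frequently_ne_zero hX] with y hy _
    exact hy.mono fun z hz => Or.inl hz
  · filter_upwards [hzero, hloc, hS.eventually_mem hx₀] with y hy hyl hyD _
    obtain ⟨hUy, hXYy⟩ := hyl hyD
    have h := (hS.isKillingFrame hyD).flat_of_null_form (germValue y) (germDeriv_swap y) (hii y)
      (hic y 0) (hic y 1) hXYy (μ := germAt μ (hUy.analyticAt_mul hS hyD))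
      (hnd.disc_ne_zero hS hyD) hy.1 hy.2
    rw [zero_mul, sub_eq_zero]
    exact h

/-- When `X² + Y²` vanishes near `x₀`, a real Wronskian vanishes itself; a complex one lies on one
of the two null lines, and the sign of `i` is chosen accordingly. -/
theorem hasConstantCurvatureTransformAt (hS : S.IsSuperintegrableOn D)
    (hnd : S.IsNondegenerateOn D) (hx₀ : x₀ ∈ D) : S.HasConstantCurvatureTransformAt D x₀ := by
  by_cases hn : ∃ᶠ y in 𝓝 x₀, S.wronskRe y * S.wronskRe y + S.wronskIm y * S.wronskIm y ≠ 0
  · exact hasConstantCurvatureTransformAt_of_wronskian_ne_zero hS hnd hx₀ hn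
  simp only [not_frequently, not_not] at hn
  have hXa := hS.analyticAt_wronskRe hx₀
  have hYa := hS.analyticAt_wronskIm hx₀
  rcases RCLike.I_mul_I (K := 𝕜) with hI | hI
  · exact hasConstantCurvatureTransformAt_of_wronskian_eq_zero hS hnd hx₀
      (hn.mono fun y hy => (RCLike.eq_zero_of_mul_self_add_mul_self hI hy).1)
      (hn.mono fun y hy => (RCLike.eq_zero_of_mul_self_add_mul_self hI hy).2)
  · obtain ⟨i, hi, hXY⟩ : ∃ i : 𝕜, i * i = -1 ∧
        ∀ᶠ y in 𝓝 x₀, S.wronskRe y + i * S.wronskIm y = 0 := by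
      rcases (hXa.add (analyticAt_const.mul hYa)).eventually_eq_zero_or_of_mul
        (hXa.add (analyticAt_const.mul hYa)) (f := fun y => S.wronskRe y + RCLike.I * S.wronskIm y)
        (g := fun y => S.wronskRe y + -RCLike.I * S.wronskIm y)
        (hn.mono fun y hy => by linear_combination hy - S.wronskIm y * S.wronskIm y * hI) with h | h
      · exact ⟨_, hI, h⟩
      · exact ⟨_, by rw [neg_mul_neg, hI], h⟩
    by_cases hX : ∃ᶠ y in 𝓝 x₀, S.wronskRe y ≠ 0
    · exact hasConstantCurvatureTransformAt_of_null_wronskian hS hnd hx₀ hi hXY hX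
    simp only [not_frequently, not_not] at hX
    refine hasConstantCurvatureTransformAt_of_wronskian_eq_zero hS hnd hx₀ hX ?_
    filter_upwards [hX, hXY] with y h1 h2
    linear_combination i * h1 - i * h2 + S.wronskIm y * hi

end SecondOrderSystem

end

theorem theorem11 {𝕜 : Type*} [RCLike 𝕜] (D : Set (Coord 𝕜)) (S : SecondOrderSystem 𝕜)
    (hS : S.IsSuperintegrableOn D) (hnd : S.IsNondegenerateOn D) (x₀ : Coord 𝕜) (hx₀ : x₀ ∈ D) :
    ∃ (N : Set (Coord 𝕜)) (U : Coord 𝕜 → 𝕜) (w : Fin 2 → Coord 𝕜 → 𝕜),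
      IsOpen N ∧ x₀ ∈ N ∧ N ⊆ D ∧ S.IsStackelMultiplierOn N U w ∧
      (S.stackelTransform U w).IsSuperintegrableOn {x | x ∈ N ∧ U x ≠ 0} ∧
      (S.stackelTransform U w).IsNondegenerateOn {x | x ∈ N ∧ U x ≠ 0} ∧
      HasConstantCurvatureOn (S.stackelTransform U w).metric {x | x ∈ N ∧ U x ≠ 0} :=
  SecondOrderSystem.hasConstantCurvatureTransformAt hS hnd hx₀
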